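/- **Proposition 3.1 (existence of minimizers).** Let $n\in\{2,3\}$, let $\Omega\subset\mathbb{R}^n$ be a bounded open set with smooth boundary, and let $\varepsilon>0$, $S>0$, $0<\sigma<1$. Let $W(r)=\frac14(1-r^2)^2$ and $c_0=\int_{-1}^1\sqrt{2W(s)}\,ds$. Let $0<\lambda<1$ and $0<\overline\lambda<1$ with $\overline\lambda^{-1}(1-\lambda)<1$, and let $\widetilde W\in C_c^\infty(\mathbb{R})$ satisfy $\widetilde W(s)=1$ for $|s|\le 1-\lambda$, $\widetilde W(s)=0$ for $|s|>\overline\lambda^{-1}(1-\lambda)$, with $\widetilde W$ nondecreasing on $[-\overline\lambda^{-1}(1-\lambda),-(1-\lambda)]$ and nonincreasing on $[1-\lambda,\overline\lambda^{-1}(1-\lambda)]$. For $u\in W^{2,2}(\Omega)$ and $\phi\in W^{1,2}(\Omega)$ put $$\mathcal{A}_{u,\varepsilon}(\phi)=\Big|\int_\Omega\tfrac1\varepsilon\widetilde W(u)\,\phi\,dx\Big|+\int_\Omega\Big(\tfrac{9}{\varepsilon^{3/2}}\widetilde W(\overline\lambda u)+\varepsilon\Big)W(\phi)\,dx+\int_\Omega\Big(\tfrac{8}{\varepsilon^{3/2}}\widetilde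 W(\overline\lambda u)+\varepsilon\Big)|\nabla\phi|^2\,dx ,$$ $$\mathcal{S}_\varepsilon(u)=\frac1{c_0}\int_\Omega\Big(\tfrac\varepsilon2|\nabla u|^2+\tfrac1\varepsilon W(u)\Big)dx,\qquad \mathcal{W}_\varepsilon(u)=\frac1{c_0}\int_\Omega\tfrac1\varepsilon\Big(\varepsilon\Delta u-\tfrac1\varepsilon W'(u)\Big)^2dx,$$ $$\mathcal{E}_\varepsilon(u)=\mathcal{W}_\varepsilon(u)+\frac{1}{\varepsilon^{1-\sigma}}\big(\mathcal{S}_\varepsilon(u)-S\big)^2+\frac{1}{\varepsilon^{1/2-\sigma/2}}\Big(\inf_{\phi\in W^{1,2}(\Omega)}\mathcal{A}_{u,\varepsilon}(\phi)-\int_\Omega\tfrac1\varepsilon\widetilde W(u)\,dx\Big)^2 .$$ Then: 1. For every $u\in W^{2,2}(\Omega)$, the functional $\mathcal{A}_{u,\varepsilon}$ attains its minimum over $W^{1,2}(\Omega)$, and the minimum is finite. 2. The functional $\mathcal{E}_\varepsilon$ attains its minimum over the class of $u\in W^{2,2}(\Omega)$ subject to $u=-1$ on $\mathbb{R}^n\setminus\Omega$,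 that is, over all $u:\mathbb{R}^n\to\mathbb{R}$ with $u|_\Omega\in W^{2,2}(\Omega)$, $u=-1$ outside $\Omega$, and $u+1\in W^{2,2}(\mathbb{R}^n)$. -/

import Mathlib

open MeasureTheory Set
open scoped ENNReal ContDiff

noncomputable section

namespace PhaseField

/-- The ambient space `ℝⁿ` with its Euclidean norm. -/
abbrev Space (n : ℕ) := EuclideanSpace ℝ (Fin n)

variable {n : ℕ}

/-- The boundary of the open set `Ω` is smooth: near each boundary point, `Ω` is the sublevel set
`{f < 0}` of a smooth function with non-vanishing differential at that point. -/
def HasSmoothBoundary (Ω : Set (Space n)) : Prop :=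
  ∀ x ∈ frontier Ω, ∃ U : Set (Space n), IsOpen U ∧ x ∈ U ∧ ∃ f : Space n → ℝ,
    ContDiffOn ℝ ∞ f U ∧ fderiv ℝ f x ≠ 0 ∧ Ω ∩ U = {y ∈ U | f y < 0}

/-! ### Sobolev spaces

Elements of the Sobolev spaces are represented by functions on `ℝⁿ`, of which only the values in
`Ω`, up to null sets, matter. -/

/-- `η` is a test function in `C_c^∞(Ω)`. -/
structure IsTestFunction (Ω : Set (Space n)) (η : Space n → ℝ) : Prop where
  smooth : ContDiff ℝ ∞ η
  compact : HasCompactSupport η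
  support : tsupport η ⊆ Ω

/-- `G` is an `L²` weak gradient of `f` in `Ω`. -/
structure IsWeakGrad (Ω : Set (Space n)) (f : Space n → ℝ) (G : Space n → Space n) : Prop where
  memLp : MemLp G 2 (volume.restrict Ω)
  integral_eq : ∀ η : Space n → ℝ, IsTestFunction Ω η → ∀ i : Fin n,
    ∫ x in Ω, f x * fderiv ℝ η x (EuclideanSpace.single i 1) = -∫ x in Ω, G x i * η x

/-- `f ∈ W^{1,2}(Ω)`. -/
def MemW12 (Ω : Set (Space n)) (f : Space n → ℝ) : Prop :=
  MemLp f 2 (volume.restrict Ω) ∧ ∃ G : Space n → Space n, IsWeakGrad Ω f G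

open Classical in
/-- The weak gradient of `f ∈ W^{1,2}(Ω)` (unique up to null subsets of `Ω`), and `0` for other
functions `f`. -/
def weakGrad (Ω : Set (Space n)) (f : Space n → ℝ) : Space n → Space n :=
  if h : ∃ G : Space n → Space n, IsWeakGrad Ω f G then h.choose else 0

/-- `f ∈ W^{2,2}(Ω)`: `f` and all of its first weak derivatives belong to `W^{1,2}(Ω)`. -/
def MemW22 (Ω : Set (Space n)) (f : Space n → ℝ) : Prop :=
  MemW12 Ω f ∧ ∀ i : Fin n, MemW12 Ω (fun x => weakGrad Ω f x i)

/-- The weak Laplacian `Δf = ∑ᵢ ∂ᵢ∂ᵢ f` of `f ∈ W^{2,2}(Ω)`. -/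
def weakLaplacian (Ω : Set (Space n)) (f : Space n → ℝ) (x : Space n) : ℝ :=
  ∑ i : Fin n, weakGrad Ω (fun y => weakGrad Ω f y i) x i

/-! ### The energies -/

/-- The double well potential `W(r) = (1 - r²)² / 4`. -/
def doubleWell (r : ℝ) : ℝ := (1 - r ^ 2) ^ 2 / 4

/-- The constant `c₀ = ∫_{-1}^{1} √(2 W(s)) ds`. -/
def c₀ : ℝ := ∫ s in (-1 : ℝ)..1, √(2 * doubleWell s)

/-- The conditions on `λ`, `λ̄` (written `l`, `L`) and on the cut-off function `W̃` (written `V`). -/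
structure IsCutoff (l L : ℝ) (V : ℝ → ℝ) : Prop where
  l_pos : 0 < l
  l_lt_one : l < 1
  L_pos : 0 < L
  L_lt_one : L < 1
  inv_mul_lt_one : L⁻¹ * (1 - l) < 1
  smooth : ContDiff ℝ ∞ V
  compact : HasCompactSupport V
  eq_one : ∀ s, |s| ≤ 1 - l → V s = 1
  eq_zero : ∀ s, L⁻¹ * (1 - l) < |s| → V s = 0
  monotone_left : MonotoneOn V (Icc (-(L⁻¹ * (1 - l))) (-(1 - l)))
  antitone_right : AntitoneOn V (Icc (1 - l) (L⁻¹ * (1 - l)))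

/-- The diffuse area `S_ε(u)` (Modica–Mortola functional). -/
def diffuseArea (Ω : Set (Space n)) (ε : ℝ) (u : Space n → ℝ) : ℝ :=
  1 / c₀ * ∫ x in Ω, (ε / 2 * ‖weakGrad Ω u x‖ ^ 2 + 1 / ε * doubleWell (u x))

/-- The diffuse Willmore energy `W_ε(u)`. -/
def diffuseWillmore (Ω : Set (Space n)) (ε : ℝ) (u : Space n → ℝ) : ℝ :=
  1 / c₀ * ∫ x in Ω, 1 / ε * (ε * weakLaplacian Ω u x - 1 / ε * deriv doubleWell (u x)) ^ 2

/-- The functional `A_{u,ε}(φ)`, for `φ ∈ W^{1,2}(Ω)`. The two integrals with nonnegative integrand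
are taken in `[0, ∞]`, so that no convention about non-integrable functions enters. -/
def connFunctional (Ω : Set (Space n)) (L : ℝ) (V : ℝ → ℝ) (ε : ℝ) (u φ : Space n → ℝ) : ℝ≥0∞ :=
  ENNReal.ofReal |∫ x in Ω, 1 / ε * V (u x) * φ x| +
  (∫⁻ x in Ω, ENNReal.ofReal
    ((9 / ε ^ (3 / 2 : ℝ) * V (L * u x) + ε) * doubleWell (φ x))) +
  ∫⁻ x in Ω, ENNReal.ofReal
    ((8 / ε ^ (3 / 2 : ℝ) * V (L * u x) + ε) * ‖weakGrad Ω φ x‖ ^ 2)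

/-- The infimum of `A_{u,ε}` over `W^{1,2}(Ω)`; it is finite for bounded `Ω`, since
`A_{u,ε}(0) < ∞`. -/
def connInf (Ω : Set (Space n)) (L : ℝ) (V : ℝ → ℝ) (ε : ℝ) (u : Space n → ℝ) : ℝ :=
  (⨅ (φ : Space n → ℝ) (_ : MemW12 Ω φ), connFunctional Ω L V ε u φ).toReal

/-- The total energy `E_ε(u)`, with area parameter `S` and exponent `σ`. For `n ≤ 3` and `u` in the
class `IsConfined Ω` below (`Ω` bounded), `u` is essentially bounded by Sobolev embedding, so all
integrals in `diffuseWillmore`, `diffuseArea` and here converge. -/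
def totalEnergy (Ω : Set (Space n)) (L : ℝ) (V : ℝ → ℝ) (S σ ε : ℝ) (u : Space n → ℝ) : ℝ :=
  diffuseWillmore Ω ε u
    + 1 / ε ^ (1 - σ) * (diffuseArea Ω ε u - S) ^ 2
    + 1 / ε ^ (1 / 2 - σ / 2) * (connInf Ω L V ε u - ∫ x in Ω, 1 / ε * V (u x)) ^ 2

/-- The phase fields of class `W^{2,2}(Ω)` subject to `u = -1` on `ℝⁿ \ Ω`: functions on all of
`ℝⁿ` that equal `-1` outside `Ω` and are of Sobolev class `W^{2,2}` across `∂Ω`, in the sense that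
`u + 1 ∈ W^{2,2}(ℝⁿ)`. -/
structure IsConfined (Ω : Set (Space n)) (u : Space n → ℝ) : Prop where
  memW22 : MemW22 Ω u
  eq_neg_one : ∀ x, x ∉ Ω → u x = -1
  memW22_add_one : MemW22 univ (fun x => u x + 1)

end PhaseField

end

/-!
Both minimizers are found by the direct method, and the analysis rests on a small amount of Fourier
analysis. For functions in `L²(ℝⁿ)` that vanish outside a bounded set, a weak derivative `∂ᵢ` becomes
multiplication by `2πi ξᵢ` (`IsWeakPartial.ft_eq`). Plancherel's theorem then yields

* `‖∂ᵢ∂ⱼ f‖₂ ≤ ‖Δf‖₂` (`IsSupportedJet.integral_snd_sq_le`);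
* for `n ≤ 3`, the embedding `H² ⊂ L^∞` in the form `‖f‖_∞² ≤ C ‖f‖₂² + δ ‖Δf‖₂²` with `δ > 0`
  arbitrary (`exists_sq_le_of_isSupportedJet`), because `(M + |ξ|²)⁻¹` is small in `L²` for large `M`;
* Rellich's theorem (`tendsto_integral_sq_of_weakTendsto_zero`).

*The functional `A_{u,ε}`.* Both weights are at least `ε`, so a minimizing sequence is bounded in
`W^{1,2}(Ω)` and has a weakly convergent subsequence. Rellich's theorem applied to `η φₖ` for cut-off
functions `η` gives convergence in measure, without any regularity of `∂Ω`
(`tendstoInMeasure_of_weakTendsto`). The linear term is weakly continuous, Fatou's lemma applies to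
the double well term, and the gradient term is weakly lower semicontinuous
(`exists_minimizer_connFunctional`).

*The total energy.* A smooth boundary is a null set, so all derivatives of `u + 1` up to order two
vanish almost everywhere outside `Ω`, and the estimates above apply to `u + 1`. A bound on the energy
bounds the diffuse area, hence `‖u + 1‖_{H¹}`, and the Willmore term bounds `Δu` up to `W'(u)`.
Since `W'(u)² = 4 u² W(u)`, the squared `L²` norm of `W'(u)` is controlled by `‖u‖_∞²` times the area, which
is absorbed into `‖Δu‖₂²` by choosing `δ` small (`exists_bound_of_totalEnergy_le`). A weakly
convergent subsequence in `H²(ℝⁿ)` then converges strongly in `H¹` and uniformly. The diffuse area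
and the integral of the cut-off function converge, the infimum of `A_{u,ε}` is Lipschitz in `u` with
respect to the uniform norm (`exists_abs_connInf_sub_le`), and the Willmore term is the squared `L²`
norm of a weakly convergent sequence, so the energy is lower semicontinuous
(`JetTendsto.exists_le_totalEnergy`).
-/

namespace PhaseField

open Filter Topology
open scoped FourierTransform SchwartzMap

variable {n : ℕ}

/-! ### Weak derivatives and second order jets -/

/-- `g` is an `L²` weak partial derivative `∂ᵢ f` of `f` in `Ω`. -/
structure IsWeakPartial (Ω : Set (Space n)) (i : Fin n) (f g : Space n → ℝ) : Prop where
  memLp : MemLp g 2 (volume.restrict Ω)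
  integral_eq : ∀ η : Space n → ℝ, IsTestFunction Ω η →
    ∫ x in Ω, f x * fderiv ℝ η x (EuclideanSpace.single i 1) = -∫ x in Ω, g x * η x

lemma memLp_euclidean_iff {α ι : Type*} [MeasurableSpace α] [Fintype ι] {μ : Measure α}
    {G : α → EuclideanSpace ℝ ι} : MemLp G 2 μ ↔ ∀ i, MemLp (fun x => G x i) 2 μ := by
  classical
  refine ⟨fun h i => ?_, fun h => ?_⟩
  · exact (EuclideanSpace.proj i : EuclideanSpace ℝ ι →L[ℝ] ℝ).comp_memLp' h
  · have h1 : MemLp (fun x => ∑ i, G x i • EuclideanSpace.single i (1 : ℝ)) 2 μ := by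
      refine memLp_finsetSum _ fun i _ => ?_
      exact (ContinuousLinearMap.toSpanSingleton ℝ
        (EuclideanSpace.single i (1 : ℝ) : EuclideanSpace ℝ ι)).comp_memLp' (h i)
    refine h1.ae_eq (Filter.Eventually.of_forall fun x => ?_)
    ext j
    simp [Finset.sum_apply, Pi.single_apply]

lemma integrable_mul_of_memLp {α : Type*} [MeasurableSpace α] {μ : Measure α} {f g : α → ℝ}
    (hf : MemLp f 2 μ) (hg : MemLp g 2 μ) : Integrable (fun x => f x * g x) μ :=
  hf.integrable_mul hg

lemma isWeakGrad_iff {Ω : Set (Space n)} {f : Space n → ℝ} {G : Space n → Space n} :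
    IsWeakGrad Ω f G ↔ ∀ i, IsWeakPartial Ω i f (fun x => G x i) :=
  ⟨fun h i => ⟨memLp_euclidean_iff.1 h.memLp i, fun η hη => h.integral_eq η hη i⟩,
    fun h => ⟨memLp_euclidean_iff.2 fun i => (h i).memLp, fun η hη i => (h i).integral_eq η hη⟩⟩

namespace IsTestFunction

variable {Ω : Set (Space n)} {η ψ : Space n → ℝ}

lemma mono {Ω' : Set (Space n)} (h : IsTestFunction Ω η) (hΩ : Ω ⊆ Ω') : IsTestFunction Ω' η :=
  ⟨h.smooth, h.compact, h.support.trans hΩ⟩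

lemma eq_zero (h : IsTestFunction Ω η) {x : Space n} (hx : x ∉ Ω) : η x = 0 :=
  image_eq_zero_of_notMem_tsupport fun h' => hx (h.support h')

lemma fderiv_eq_zero (h : IsTestFunction Ω η) {x : Space n} (hx : x ∉ Ω) : fderiv ℝ η x = 0 :=
  fderiv_of_notMem_tsupport (𝕜 := ℝ) fun h' => hx (h.support h')

lemma continuous_partial (h : IsTestFunction Ω η) (v : Space n) :
    Continuous fun x => fderiv ℝ η x v :=
  (h.smooth.continuous_fderiv (by simp)).clm_apply continuous_const

lemma compact_partial (h : IsTestFunction Ω η) (v : Space n) :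
    HasCompactSupport fun x => fderiv ℝ η x v :=
  h.compact.fderiv_apply (𝕜 := ℝ) v

lemma memLp (h : IsTestFunction Ω η) {μ : Measure (Space n)} [IsFiniteMeasureOnCompacts μ]
    (p : ℝ≥0∞) : MemLp η p μ :=
  h.smooth.continuous.memLp_of_hasCompactSupport h.compact

lemma memLp_partial (h : IsTestFunction Ω η) {μ : Measure (Space n)} [IsFiniteMeasureOnCompacts μ]
    (p : ℝ≥0∞) (v : Space n) : MemLp (fun x => fderiv ℝ η x v) p μ :=
  (h.continuous_partial v).memLp_of_hasCompactSupport (h.compact_partial v)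

lemma mul (h : IsTestFunction Ω η) (hψ : ContDiff ℝ ∞ ψ) :
    IsTestFunction Ω (fun x => η x * ψ x) :=
  ⟨h.smooth.mul hψ, h.compact.mul_right, (tsupport_mul_subset_left).trans h.support⟩

end IsTestFunction

namespace IsWeakPartial

variable {Ω : Set (Space n)} {i : Fin n} {f g f' g' : Space n → ℝ}

lemma congr (h : IsWeakPartial Ω i f g) (hf : f =ᵐ[volume.restrict Ω] f')
    (hg : g =ᵐ[volume.restrict Ω] g') : IsWeakPartial Ω i f' g' := by
  refine ⟨h.memLp.ae_eq hg, fun η hη => ?_⟩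
  have e1 : ∫ x in Ω, f' x * fderiv ℝ η x (EuclideanSpace.single i 1) =
      ∫ x in Ω, f x * fderiv ℝ η x (EuclideanSpace.single i 1) :=
    integral_congr_ae (by filter_upwards [hf] with x hx; rw [hx])
  have e2 : ∫ x in Ω, g' x * η x = ∫ x in Ω, g x * η x :=
    integral_congr_ae (by filter_upwards [hg] with x hx; rw [hx])
  rw [e1, e2, h.integral_eq η hη]

lemma mono {Ω' : Set (Space n)} (h : IsWeakPartial Ω i f g) (hΩ : Ω' ⊆ Ω)
    (hm : MeasurableSet Ω) : IsWeakPartial Ω' i f g := by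
  refine ⟨h.memLp.mono_measure (Measure.restrict_mono hΩ le_rfl), fun η hη => ?_⟩
  have h1 := h.integral_eq η (hη.mono hΩ)
  rwa [setIntegral_eq_of_subset_of_forall_sdiff_eq_zero hm hΩ,
    setIntegral_eq_of_subset_of_forall_sdiff_eq_zero hm hΩ] at h1
  · intro x hx; simp [hη.eq_zero hx.2]
  · intro x hx; simp [hη.fderiv_eq_zero hx.2]

/-- Weak partial derivatives are unique, by the fundamental lemma of the calculus of variations. -/
lemma unique (hΩ : IsOpen Ω) (h : IsWeakPartial Ω i f g) (h' : IsWeakPartial Ω i f g') :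
    g =ᵐ[volume.restrict Ω] g' := by
  have h0 : ∀ᵐ x ∂(volume : Measure (Space n)), x ∈ Ω → g x - g' x = 0 := by
    refine hΩ.ae_eq_zero_of_integral_contDiff_smul_eq_zero ?_ ?_
    · exact locallyIntegrableOn_of_locallyIntegrable_restrict
        ((h.memLp.sub h'.memLp).locallyIntegrable (by norm_num))
    · intro η h1 h2 h3
      have hη : IsTestFunction Ω η := ⟨h1, h2, h3⟩
      rw [← setIntegral_eq_integral_of_forall_compl_eq_zero (s := Ω) (μ := volume)
        (fun x hx => by simp [hη.eq_zero hx])]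
      have e : ∫ x in Ω, g x * η x = ∫ x in Ω, g' x * η x := by
        have := (h.integral_eq η hη).symm.trans (h'.integral_eq η hη)
        linarith
      have e2 : ∫ x in Ω, η x • (g x - g' x) = ∫ x in Ω, g x * η x - g' x * η x :=
        integral_congr_ae (Filter.Eventually.of_forall fun x => by simp only [smul_eq_mul]; ring)
      rw [e2, integral_sub (integrable_mul_of_memLp h.memLp (hη.memLp 2))
        (integrable_mul_of_memLp h'.memLp (hη.memLp 2)), e, sub_self]
  rw [Filter.EventuallyEq, ae_restrict_iff' hΩ.measurableSet]
  filter_upwards [h0] with x hx hx' using sub_eq_zero.1 (hx hx')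

lemma sub (h : IsWeakPartial Ω i f g) (h' : IsWeakPartial Ω i f' g')
    (hf : MemLp f 2 (volume.restrict Ω)) (hf' : MemLp f' 2 (volume.restrict Ω)) :
    IsWeakPartial Ω i (fun x => f x - f' x) (fun x => g x - g' x) := by
  refine ⟨h.memLp.sub h'.memLp, fun η hη => ?_⟩
  simp_rw [sub_mul]
  rw [integral_sub (integrable_mul_of_memLp hf (hη.memLp_partial 2 _))
      (integrable_mul_of_memLp hf' (hη.memLp_partial 2 _)),
    integral_sub (integrable_mul_of_memLp h.memLp (hη.memLp 2)) (integrable_mul_of_memLp h'.memLp (hη.memLp 2)),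
    h.integral_eq η hη, h'.integral_eq η hη]
  ring

lemma const (c : ℝ) : IsWeakPartial Ω i (fun _ => c) (fun _ => 0) := by
  refine ⟨MemLp.zero, fun η hη => ?_⟩
  have e : ∫ x in Ω, c * fderiv ℝ η x (EuclideanSpace.single i 1) =
      ∫ x, c * fderiv ℝ η x (EuclideanSpace.single i 1) :=
    setIntegral_eq_integral_of_forall_compl_eq_zero
      (fun x hx => by simp [hη.fderiv_eq_zero hx])
  rw [e, integral_const_mul]
  have hd : ∫ x, (1 : ℝ) * fderiv ℝ η x (EuclideanSpace.single i 1) =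
      -∫ x, fderiv ℝ (fun _ : Space n => (1 : ℝ)) x (EuclideanSpace.single i 1) * η x := by
    refine integral_mul_fderiv_eq_neg_fderiv_mul_of_integrable (𝕜 := ℝ) ?_ ?_ ?_ ?_ ?_
    · simp
    · simpa using memLp_one_iff_integrable.1 (hη.memLp_partial 1 _)
    · simpa using memLp_one_iff_integrable.1 (hη.memLp 1)
    · exact fun x _ => differentiableAt_const _
    · exact fun x _ => hη.smooth.differentiable (by simp) x
  simp at hd
  simp [hd]

/-- Product rule with a test function: `η f` is weakly differentiable in the whole space. -/
lemma mul_test (hΩ : MeasurableSet Ω) (h : IsWeakPartial Ω i f g)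
    (hf : MemLp f 2 (volume.restrict Ω)) {η : Space n → ℝ} (hη : IsTestFunction Ω η) :
    IsWeakPartial univ i (fun x => η x * f x)
      (fun x => η x * g x + fderiv ℝ η x (EuclideanSpace.single i 1) * f x) := by
  have key : ∀ {θ u : Space n → ℝ}, MemLp θ ∞ (volume : Measure (Space n)) →
      (∀ x ∉ Ω, θ x = 0) → MemLp u 2 (volume.restrict Ω) →
      MemLp (fun x => θ x * u x) 2 (volume : Measure (Space n)) := by
    intro θ u h1 h2 h3
    have : MemLp (fun x => θ x * u x) 2 (volume.restrict Ω) :=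
      h3.mul' (h1.mono_measure Measure.restrict_le_self)
    rw [← memLp_indicator_iff_restrict hΩ] at this
    refine this.ae_eq (Filter.Eventually.of_forall fun x => ?_)
    by_cases hx : x ∈ Ω
    · simp [hx]
    · simp [hx, h2 x hx]
  refine ⟨?_, fun ψ hψ => ?_⟩
  · rw [Measure.restrict_univ]
    exact (key (hη.memLp _) (fun x hx => hη.eq_zero hx) h.memLp).add
      (key (hη.memLp_partial _ _) (fun x hx => by simp [hη.fderiv_eq_zero hx]) hf)
  · have h1 := h.integral_eq _ (hη.mul hψ.smooth)
    have hd : ∀ x, fderiv ℝ (fun x => η x * ψ x) x (EuclideanSpace.single i 1) =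
        η x * fderiv ℝ ψ x (EuclideanSpace.single i 1) +
          ψ x * fderiv ℝ η x (EuclideanSpace.single i 1) := by
      intro x
      rw [fderiv_fun_mul (hη.smooth.differentiable (by simp) x)
        (hψ.smooth.differentiable (by simp) x)]
      simp
    have m1 : IsTestFunction Ω (fun x => η x * ψ x) := hη.mul hψ.smooth
    have m2 : MemLp (fun x => ψ x * fderiv ℝ η x (EuclideanSpace.single i 1)) 2
        (volume.restrict Ω) :=
      (hψ.smooth.continuous.mul (hη.continuous_partial _)).memLp_of_hasCompactSupport
        (hη.compact_partial _).mul_left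
    rw [setIntegral_univ, setIntegral_univ,
      ← setIntegral_eq_integral_of_forall_compl_eq_zero (s := Ω) (μ := volume)
        (fun x hx => by simp [hη.eq_zero hx]),
      ← setIntegral_eq_integral_of_forall_compl_eq_zero (s := Ω) (μ := volume)
        (fun x hx => by simp [hη.eq_zero hx, hη.fderiv_eq_zero hx])]
    have e1 : ∫ x in Ω, η x * f x * fderiv ℝ ψ x (EuclideanSpace.single i 1) =
        ∫ x in Ω, (f x * fderiv ℝ (fun x => η x * ψ x) x (EuclideanSpace.single i 1) -
          f x * (ψ x * fderiv ℝ η x (EuclideanSpace.single i 1))) :=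
      integral_congr_ae (Filter.Eventually.of_forall fun x => by simp only [hd]; ring)
    have e2 : ∫ x in Ω, (η x * g x + fderiv ℝ η x (EuclideanSpace.single i 1) * f x) * ψ x =
        ∫ x in Ω, (g x * (η x * ψ x) +
          f x * (ψ x * fderiv ℝ η x (EuclideanSpace.single i 1))) :=
      integral_congr_ae (Filter.Eventually.of_forall fun x => by simp only; ring)
    rw [e1, e2, integral_sub (integrable_mul_of_memLp hf (m1.memLp_partial 2 _))
        (integrable_mul_of_memLp hf m2),
      integral_add (integrable_mul_of_memLp h.memLp (m1.memLp 2))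
        (integrable_mul_of_memLp hf m2), h1]
    ring

end IsWeakPartial

section WeakGrad

variable {Ω : Set (Space n)} {f : Space n → ℝ}

lemma MemW12.isWeakGrad (h : MemW12 Ω f) : IsWeakGrad Ω f (weakGrad Ω f) := by
  rw [weakGrad, dif_pos h.2]
  exact h.2.choose_spec

/-- Any weak derivatives of `f` compute the chosen gradient `weakGrad` up to null sets. -/
lemma weakGrad_ae_eq (hΩ : IsOpen Ω) {g : Fin n → Space n → ℝ}
    (h : ∀ i, IsWeakPartial Ω i f (g i)) :
    ∀ᵐ x ∂volume.restrict Ω, ∀ i, weakGrad Ω f x i = g i x := by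
  have hG : IsWeakGrad Ω f (fun x => WithLp.toLp 2 fun i => g i x) :=
    isWeakGrad_iff.2 fun i => h i
  have h1 : IsWeakGrad Ω f (weakGrad Ω f) := by
    rw [weakGrad, dif_pos ⟨_, hG⟩]
    exact (⟨_, hG⟩ : ∃ G, IsWeakGrad Ω f G).choose_spec
  rw [ae_all_iff]
  exact fun i => IsWeakPartial.unique hΩ (isWeakGrad_iff.1 h1 i) (h i)

lemma memW12_iff : MemW12 Ω f ↔ MemLp f 2 (volume.restrict Ω) ∧
    ∃ g : Fin n → Space n → ℝ, ∀ i, IsWeakPartial Ω i f (g i) := by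
  refine and_congr_right fun _ => ⟨fun ⟨G, hG⟩ => ⟨fun i x => G x i, isWeakGrad_iff.1 hG⟩,
    fun ⟨g, hg⟩ => ⟨fun x => WithLp.toLp 2 fun i => g i x, isWeakGrad_iff.2 fun i => hg i⟩⟩

/-- `(f, g, h)` is a second order jet of class `L²` in `Ω`: `g i` and `h i j` are the weak
derivatives `∂ᵢ f` and `∂ⱼ∂ᵢ f`. -/
structure IsJet (Ω : Set (Space n)) (f : Space n → ℝ) (g : Fin n → Space n → ℝ)
    (h : Fin n → Fin n → Space n → ℝ) : Prop where
  memLp : MemLp f 2 (volume.restrict Ω)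
  fst : ∀ i, IsWeakPartial Ω i f (g i)
  snd : ∀ i j, IsWeakPartial Ω j (g i) (h i j)

namespace IsJet

variable {g : Fin n → Space n → ℝ} {h : Fin n → Fin n → Space n → ℝ}
variable {f' : Space n → ℝ} {g' : Fin n → Space n → ℝ} {h' : Fin n → Fin n → Space n → ℝ}

lemma memW22 (hΩ : IsOpen Ω) (H : IsJet Ω f g h) : MemW22 Ω f := by
  refine ⟨memW12_iff.2 ⟨H.memLp, g, H.fst⟩, fun i => ?_⟩
  have e : g i =ᵐ[volume.restrict Ω] fun x => weakGrad Ω f x i := by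
    filter_upwards [weakGrad_ae_eq hΩ H.fst] with x hx using (hx i).symm
  exact memW12_iff.2 ⟨(H.fst i).memLp.ae_eq e, h i,
    fun j => (H.snd i j).congr e (Filter.EventuallyEq.refl _ _)⟩

lemma weakLaplacian_ae_eq (hΩ : IsOpen Ω) (H : IsJet Ω f g h) :
    ∀ᵐ x ∂volume.restrict Ω, weakLaplacian Ω f x = ∑ i, h i i x := by
  have e : ∀ i, g i =ᵐ[volume.restrict Ω] fun x => weakGrad Ω f x i := by
    intro i
    filter_upwards [weakGrad_ae_eq hΩ H.fst] with x hx using (hx i).symm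
  have h2 : ∀ᵐ x ∂volume.restrict Ω, ∀ i j,
      weakGrad Ω (fun y => weakGrad Ω f y i) x j = h i j x := by
    rw [ae_all_iff]
    exact fun i => weakGrad_ae_eq hΩ fun j => (H.snd i j).congr (e i) (Filter.EventuallyEq.refl _ _)
  filter_upwards [h2] with x hx
  exact Finset.sum_congr rfl fun i _ => hx i i

lemma mono {Ω' : Set (Space n)} (H : IsJet Ω f g h) (hΩ : Ω' ⊆ Ω) (hm : MeasurableSet Ω) :
    IsJet Ω' f g h :=
  ⟨H.memLp.mono_measure (Measure.restrict_mono hΩ le_rfl), fun i => (H.fst i).mono hΩ hm,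
    fun i j => (H.snd i j).mono hΩ hm⟩

lemma sub (H : IsJet Ω f g h) (H' : IsJet Ω f' g' h') :
    IsJet Ω (fun x => f x - f' x) (fun i x => g i x - g' i x)
      (fun i j x => h i j x - h' i j x) :=
  ⟨H.memLp.sub H'.memLp, fun i => (H.fst i).sub (H'.fst i) H.memLp H'.memLp,
    fun i j => (H.snd i j).sub (H'.snd i j) (H.fst i).memLp (H'.fst i).memLp⟩

lemma sub_const [IsFiniteMeasure (volume.restrict Ω)] (H : IsJet Ω f g h) (c : ℝ) :
    IsJet Ω (fun x => f x - c) g h := by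
  refine ⟨H.memLp.sub (memLp_const c), fun i => ?_, H.snd⟩
  simpa using (H.fst i).sub (IsWeakPartial.const c) H.memLp (memLp_const c)

end IsJet

lemma MemW22.exists_isJet (h : MemW22 Ω f) : ∃ g h, IsJet Ω f g h := by
  obtain ⟨h1, h2⟩ := h
  exact ⟨fun i x => weakGrad Ω f x i,
    fun i j x => weakGrad Ω (fun y => weakGrad Ω f y i) x j, h1.1,
    isWeakGrad_iff.1 h1.isWeakGrad, fun i => isWeakGrad_iff.1 (h2 i).isWeakGrad⟩

end WeakGrad

/-! ### The Fourier transform of real-valued functions -/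

/-- The Fourier transform of a real-valued function on `ℝⁿ`. -/
noncomputable def ft (f : Space n → ℝ) : Space n → ℂ := 𝓕 fun x => (f x : ℂ)

lemma continuous_ft {f : Space n → ℝ} (hf : Integrable f) : Continuous (ft f) :=
  VectorFourier.fourierIntegral_continuous Real.continuous_fourierChar
    (by exact continuous_inner) hf.ofReal

lemma norm_ft_le (f : Space n → ℝ) (ξ : Space n) : ‖ft f ξ‖ ≤ ∫ x, |f x| := by
  refine (VectorFourier.norm_fourierIntegral_le_integral_norm _ _ _ _ _).trans_eq ?_
  simp

/-- The Fourier transform is symmetric with respect to the bilinear pairing of functions. -/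
lemma integral_fourier_mul_eq {f g : Space n → ℂ} (hf : Integrable f) (hg : Integrable g) :
    ∫ ξ, 𝓕 f ξ * g ξ = ∫ x, f x * 𝓕 g x := by
  have := VectorFourier.integral_fourierIntegral_smul_eq_flip (μ := volume) (ν := volume)
    (L := innerₗ (Space n)) Real.continuous_fourierChar (by exact continuous_inner) hf hg
  rw [flip_innerₗ] at this
  exact this

/-- The Fourier transform of `L²`, defined by density, is given by the Fourier integral on
`L¹ ∩ L²`. -/
lemma ft_ae_eq {f : Space n → ℝ} (hf : Integrable f) (hf2 : MemLp f 2) :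
    (𝓕 (hf2.ofReal (K := ℂ)).toLp : Lp ℂ 2 (volume : Measure (Space n))) =ᵐ[volume] ft f := by
  set F : Lp ℂ 2 (volume : Measure (Space n)) := (hf2.ofReal (K := ℂ)).toLp with hF
  -- both functions define the same distribution: move the Fourier transform to the test function
  refine ae_eq_of_integral_contDiff_smul_eq ?_ ?_ ?_
  · exact (Lp.memLp _).locallyIntegrable (by norm_num)
  · exact (continuous_ft hf).locallyIntegrable
  · intro g g_smooth g_cpt
    have hg₁ : HasCompactSupport (Complex.ofRealCLM ∘ g) := g_cpt.comp_left rfl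
    have hg₂ : ContDiff ℝ ∞ (Complex.ofRealCLM ∘ g) := by fun_prop
    have h := congrArg (fun T => T (hg₁.toSchwartzMap hg₂)) (Lp.fourier_toTemperedDistribution_eq F)
    simp only [TemperedDistribution.fourier_apply, Lp.toTemperedDistribution_apply] at h
    calc ∫ x, g x • (𝓕 F : Lp ℂ 2 (volume : Measure (Space n))) x
        = ∫ x, (hg₁.toSchwartzMap hg₂) x • (𝓕 F : Lp ℂ 2 (volume : Measure (Space n))) x := by
          simp
      _ = ∫ x, (𝓕 (hg₁.toSchwartzMap hg₂)) x • F x := h.symm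
      _ = ∫ x, (f x : ℂ) * 𝓕 (hg₁.toSchwartzMap hg₂ : Space n → ℂ) x := by
          refine integral_congr_ae ?_
          filter_upwards [(hf2.ofReal (K := ℂ)).coeFn_toLp] with x hx
          rw [hF, hx, SchwartzMap.fourier_coe, smul_eq_mul, mul_comm]
          rfl
      _ = ∫ x, ft f x * (hg₁.toSchwartzMap hg₂) x :=
          (integral_fourier_mul_eq hf.ofReal (SchwartzMap.integrable _)).symm
      _ = ∫ x, g x • ft f x := by
          refine integral_congr_ae (Eventually.of_forall fun x => ?_)
          simp [mul_comm]

lemma memLp_ft {f : Space n → ℝ} (hf : Integrable f) (hf2 : MemLp f 2) : MemLp (ft f) 2 :=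
  (Lp.memLp _).ae_eq (ft_ae_eq hf hf2)

/-- Plancherel's theorem on `L¹ ∩ L²`. -/
lemma integral_norm_ft_sq {f : Space n → ℝ} (hf : Integrable f) (hf2 : MemLp f 2) :
    ∫ ξ, ‖ft f ξ‖ ^ 2 = ∫ x, f x ^ 2 := by
  set F : Lp ℂ 2 (volume : Measure (Space n)) := (hf2.ofReal (K := ℂ)).toLp with hF
  have h1 : ∀ G : Lp ℂ 2 (volume : Measure (Space n)), ∫ x, ‖G x‖ ^ 2 = ‖G‖ ^ 2 := by
    intro G
    have := L2.inner_def (𝕜 := ℂ) G G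
    rw [inner_self_eq_norm_sq_to_K] at this
    have h2 : ∀ x, inner ℂ (G x) (G x) = ((‖G x‖ ^ 2 : ℝ) : ℂ) := by
      intro x; rw [inner_self_eq_norm_sq_to_K]; simp
    simp_rw [h2] at this
    have h3 : ∫ x, ((‖G x‖ ^ 2 : ℝ) : ℂ) = ((∫ x, ‖G x‖ ^ 2 : ℝ) : ℂ) := integral_ofReal
    rw [h3] at this
    exact Complex.ofReal_injective (by rw [← this]; simp)
  have h2 : ∫ ξ, ‖ft f ξ‖ ^ 2 = ∫ ξ, ‖(𝓕 F : Lp ℂ 2 (volume : Measure (Space n))) ξ‖ ^ 2 := by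
    refine integral_congr_ae ?_
    filter_upwards [ft_ae_eq hf hf2] with x hx
    rw [hx]
  have h3 : ∫ x, f x ^ 2 = ∫ x, ‖F x‖ ^ 2 := by
    refine integral_congr_ae ?_
    filter_upwards [(hf2.ofReal (K := ℂ)).coeFn_toLp] with x hx
    rw [hx]
    simp
  rw [h2, h3, h1, h1, Lp.norm_fourier_eq]

/-- If the Fourier transform of `f` is integrable, its `L¹` norm bounds the essential supremum
of `f`. -/
lemma ae_abs_le_integral_norm_ft {f : Space n → ℝ} (hf : Integrable f) (hft : Integrable (ft f)) :
    ∀ᵐ x, |f x| ≤ ∫ ξ, ‖ft f ξ‖ := by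
  have hc : Continuous (𝓕⁻ (ft f)) :=
    VectorFourier.fourierIntegral_continuous Real.continuous_fourierChar
      (by exact continuous_inner.neg) hft
  -- Fourier inversion, by duality from the inversion formula for Schwartz functions
  have h : ∀ᵐ x, ((f x : ℝ) : ℂ) = 𝓕⁻ (ft f) x := by
    refine ae_eq_of_integral_contDiff_smul_eq ?_ ?_ ?_
    · exact hf.ofReal.locallyIntegrable
    · exact hc.locallyIntegrable
    · intro g g_smooth g_cpt
      have hg₁ : HasCompactSupport (Complex.ofRealCLM ∘ g) := g_cpt.comp_left rfl
      have hg₂ : ContDiff ℝ ∞ (Complex.ofRealCLM ∘ g) := by fun_prop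
      set G := hg₁.toSchwartzMap hg₂
      have e1 : 𝓕 ((𝓕⁻ G : 𝓢(Space n, ℂ)) : Space n → ℂ) = G := by
        rw [← SchwartzMap.fourier_coe, FourierTransform.fourier_fourierInv_eq]
      have e2 : ∀ ξ, (𝓕⁻ G : 𝓢(Space n, ℂ)) ξ = 𝓕⁻ (G : Space n → ℂ) ξ := fun ξ => by
        rw [SchwartzMap.fourierInv_coe]
      calc ∫ x, g x • (f x : ℂ) = ∫ x, (f x : ℂ) *
              𝓕 ((𝓕⁻ G : 𝓢(Space n, ℂ)) : Space n → ℂ) x := by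
            rw [e1]
            refine integral_congr_ae (Eventually.of_forall fun x => ?_)
            simp [G, mul_comm]
        _ = ∫ ξ, ft f ξ * (𝓕⁻ G : 𝓢(Space n, ℂ)) ξ :=
            (integral_fourier_mul_eq hf.ofReal (SchwartzMap.integrable _)).symm
        _ = ∫ ξ, ft f ξ * 𝓕 (G : Space n → ℂ) (-ξ) := by
            simp_rw [e2, Real.fourierInv_eq_fourier_neg]
        _ = ∫ ξ, ft f (-ξ) * 𝓕 (G : Space n → ℂ) ξ := by
            rw [← integral_neg_eq_self]; simp
        _ = ∫ x, 𝓕 (fun ξ => ft f (-ξ)) x * G x :=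
            (integral_fourier_mul_eq hft.comp_neg (SchwartzMap.integrable _)).symm
        _ = ∫ x, g x • 𝓕⁻ (ft f) x := by
            refine integral_congr_ae (Eventually.of_forall fun x => ?_)
            simp only [Real.fourierInv_eq_fourier_comp_neg]
            simp [G, mul_comm]
  filter_upwards [h] with x hx
  have h1 : |f x| = ‖𝓕⁻ (ft f) x‖ := by rw [← hx]; simp
  rw [h1]
  exact VectorFourier.norm_fourierIntegral_le_integral_norm _ _ _ _ _

/-! ### Weak derivatives of functions with bounded support -/

/-- `f` vanishes almost everywhere outside `Ω`. -/
def VanishesOff (Ω : Set (Space n)) (f : Space n → ℝ) : Prop := ∀ᵐ x, x ∉ Ω → f x = 0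

namespace VanishesOff

variable {Ω : Set (Space n)} {f g : Space n → ℝ}

lemma sub (hf : VanishesOff Ω f) (hg : VanishesOff Ω g) :
    VanishesOff Ω (fun x => f x - g x) := by
  filter_upwards [hf, hg] with x h1 h2 hx
  rw [h1 hx, h2 hx, sub_zero]

lemma sum {ι : Type*} [Fintype ι] {F : ι → Space n → ℝ} (hF : ∀ i, VanishesOff Ω (F i)) :
    VanishesOff Ω (fun x => ∑ i, F i x) := by
  filter_upwards [ae_all_iff.2 hF] with x h1 hx
  exact Finset.sum_eq_zero fun i _ => h1 i hx

lemma setIntegral_comp_eq (hf : VanishesOff Ω f) {φ : ℝ → ℝ}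
    (hφ : φ 0 = 0) : ∫ x in Ω, φ (f x) = ∫ x, φ (f x) := by
  refine setIntegral_eq_integral_of_ae_compl_eq_zero ?_
  filter_upwards [hf] with x hx h
  rw [hx h, hφ]

lemma setIntegral_sq_eq (hf : VanishesOff Ω f) :
    ∫ x in Ω, f x ^ 2 = ∫ x, f x ^ 2 :=
  hf.setIntegral_comp_eq (φ := fun t => t ^ 2) (by simp)

lemma mono {Ω' : Set (Space n)} (hf : VanishesOff Ω f) (h : Ω ⊆ Ω') : VanishesOff Ω' f := by
  filter_upwards [hf] with x hx hx' using hx fun h' => hx' (h h')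

lemma integrableOn_closedBall {R : ℝ} (hf : MemLp f 2) :
    IntegrableOn f (Metric.closedBall (0 : Space n) R) :=
  have : IsFiniteMeasure (volume.restrict (Metric.closedBall (0 : Space n) R)) :=
    ⟨by simpa using measure_closedBall_lt_top⟩
  (hf.mono_measure Measure.restrict_le_self).integrable (by norm_num)

lemma integrable (hΩ : Bornology.IsBounded Ω) (hf : VanishesOff Ω f) (hf2 : MemLp f 2) :
    Integrable f := by
  obtain ⟨R, hR⟩ := hΩ.subset_closedBall (0 : Space n)
  have h1 : Integrable ((Metric.closedBall (0 : Space n) R).indicator f) :=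
    (integrable_indicator_iff measurableSet_closedBall).2 (integrableOn_closedBall hf2)
  refine h1.congr ?_
  filter_upwards [hf.mono hR] with x hx
  by_cases h : x ∈ Metric.closedBall (0 : Space n) R
  · rw [indicator_of_mem h]
  · rw [indicator_of_notMem h, hx h]

/-- The elementary inequality `|t| ≤ 1 + t²` bounds the `L¹` norm by the `L²` norm. -/
lemma integral_abs_le {R : ℝ} (hf : VanishesOff (Metric.closedBall 0 R) f) (hf2 : MemLp f 2) :
    ∫ x, |f x| ≤ volume.real (Metric.closedBall (0 : Space n) R) + ∫ x, f x ^ 2 := by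
  rw [← hf.setIntegral_comp_eq abs_zero,
    ← hf.setIntegral_sq_eq]
  have : IsFiniteMeasure (volume.restrict (Metric.closedBall (0 : Space n) R)) :=
    ⟨by simpa using measure_closedBall_lt_top⟩
  have h2 : IntegrableOn (fun x => f x ^ 2) (Metric.closedBall (0 : Space n) R) :=
    hf2.integrable_sq.integrableOn
  calc ∫ x in Metric.closedBall (0 : Space n) R, |f x|
      ≤ ∫ x in Metric.closedBall (0 : Space n) R, (1 + f x ^ 2) := by
        refine integral_mono (integrableOn_closedBall hf2).abs ((integrable_const _).add h2) fun x => ?_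
        have := sq_abs (f x)
        nlinarith [sq_nonneg (|f x| - 1), abs_nonneg (f x)]
    _ = _ := by
        rw [integral_add (integrable_const _) h2]
        simp

end VanishesOff

/-- For functions with bounded support, test functions need not have compact support. -/
lemma IsWeakPartial.integral_eq_of_vanishesOff {Ω : Set (Space n)} (hΩ : Bornology.IsBounded Ω)
    {i : Fin n} {f g : Space n → ℝ} (h : IsWeakPartial univ i f g) (hf : VanishesOff Ω f)
    (hg : VanishesOff Ω g) {ψ : Space n → ℝ} (hψ : ContDiff ℝ ∞ ψ) :
    ∫ x, f x * fderiv ℝ ψ x (EuclideanSpace.single i 1) = -∫ x, g x * ψ x := by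
  obtain ⟨R, hR0, hR⟩ := hΩ.subset_ball_lt 0 (0 : Space n)
  -- `ψ` may be cut off by `χ`, which equals `1` on a ball containing `Ω`
  let χ : ContDiffBump (0 : Space n) := ⟨R, R + 1, hR0, by linarith⟩
  have hχ : IsTestFunction univ (fun x => χ x * ψ x) :=
    ⟨χ.contDiff.mul hψ, χ.hasCompactSupport.mul_right, subset_univ _⟩
  have h1 := h.integral_eq _ hχ
  rw [setIntegral_univ, setIntegral_univ] at h1
  have e1 : ∫ x, f x * fderiv ℝ ψ x (EuclideanSpace.single i 1) =
      ∫ x, f x * fderiv ℝ (fun x => χ x * ψ x) x (EuclideanSpace.single i 1) := by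
    refine integral_congr_ae ?_
    filter_upwards [hf] with x hx
    by_cases hxΩ : x ∈ Ω
    · have : (fun x => χ x * ψ x) =ᶠ[𝓝 x] ψ := by
        filter_upwards [χ.eventuallyEq_one_of_mem_ball (hR hxΩ)] with y hy
        rw [hy]; simp
      rw [this.fderiv_eq]
    · rw [hx hxΩ]; simp
  have e2 : ∫ x, g x * ψ x = ∫ x, g x * (χ x * ψ x) := by
    refine integral_congr_ae ?_
    filter_upwards [hg] with x hx
    by_cases hxΩ : x ∈ Ω
    · rw [χ.one_of_mem_closedBall (Metric.ball_subset_closedBall (hR hxΩ)), one_mul]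
    · rw [hx hxΩ]; simp
  rw [e1, e2, h1]

/-- Real and imaginary part of the Fourier transform of a real-valued function, which reduce
statements about `ft f` to real test functions. -/
lemma ft_eq {f : Space n → ℝ} (hf : Integrable f) (ξ : Space n) :
    ft f ξ = ((∫ x, f x * Real.cos (2 * Real.pi * inner ℝ x ξ) : ℝ) : ℂ) -
      ((∫ x, f x * Real.sin (2 * Real.pi * inner ℝ x ξ) : ℝ) : ℂ) * Complex.I := by
  have hc : Integrable fun x => f x * Real.cos (2 * Real.pi * inner ℝ x ξ) := by
    refine hf.mul_bdd (c := 1) (by fun_prop) (Eventually.of_forall fun x => ?_)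
    simpa using Real.abs_cos_le_one _
  have hs : Integrable fun x => f x * Real.sin (2 * Real.pi * inner ℝ x ξ) := by
    refine hf.mul_bdd (c := 1) (by fun_prop) (Eventually.of_forall fun x => ?_)
    simpa using Real.abs_sin_le_one _
  have e1 : ((∫ x, f x * Real.cos (2 * Real.pi * inner ℝ x ξ) : ℝ) : ℂ) =
      ∫ x, ((f x * Real.cos (2 * Real.pi * inner ℝ x ξ) : ℝ) : ℂ) := integral_ofReal.symm
  have e2 : ((∫ x, f x * Real.sin (2 * Real.pi * inner ℝ x ξ) : ℝ) : ℂ) =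
      ∫ x, ((f x * Real.sin (2 * Real.pi * inner ℝ x ξ) : ℝ) : ℂ) := integral_ofReal.symm
  rw [ft, Real.fourier_eq', e1, e2, ← integral_mul_const, ← integral_sub hc.ofReal
    (hs.ofReal.mul_const _)]
  refine integral_congr_ae (Eventually.of_forall fun x => ?_)
  simp only [smul_eq_mul]
  rw [Complex.exp_mul_I, ← Complex.ofReal_cos, ← Complex.ofReal_sin]
  rw [show -2 * Real.pi * inner ℝ x ξ = -(2 * Real.pi * inner ℝ x ξ) by ring, Real.cos_neg,
    Real.sin_neg]
  push_cast
  ring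

/-- The Fourier transform turns the weak derivative `∂ᵢ` into multiplication by `2πi ξᵢ`. -/
lemma IsWeakPartial.ft_eq {Ω : Set (Space n)} (hΩ : Bornology.IsBounded Ω)
    {i : Fin n} {f g : Space n → ℝ} (h : IsWeakPartial univ i f g) (hf2 : MemLp f 2)
    (hf : VanishesOff Ω f) (hg : VanishesOff Ω g) (ξ : Space n) :
    ft g ξ = 2 * Real.pi * Complex.I * ξ i * ft f ξ := by
  have hg2 : MemLp g 2 := by simpa using h.memLp
  have hd : ∀ x : Space n, HasFDerivAt (fun x : Space n => 2 * Real.pi * inner ℝ x ξ)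
      ((2 * Real.pi) • (innerSL ℝ ξ)) x := by
    intro x
    have : HasFDerivAt (fun x : Space n => inner ℝ ξ x) (innerSL ℝ ξ) x :=
      (innerSL ℝ ξ).hasFDerivAt
    simp_rw [real_inner_comm] at this ⊢
    simpa using this.const_mul (2 * Real.pi)
  have hs : (innerSL ℝ ξ) (EuclideanSpace.single i 1) = ξ i := by
    simp [EuclideanSpace.inner_single_right]
  have hsm : ContDiff ℝ ∞ fun x : Space n => 2 * Real.pi * inner ℝ x ξ :=
    contDiff_const.mul (contDiff_id.inner ℝ contDiff_const)
  have h1 := h.integral_eq_of_vanishesOff hΩ hf hg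
    (ψ := fun x => Real.cos (2 * Real.pi * inner ℝ x ξ)) hsm.cos
  have h2 := h.integral_eq_of_vanishesOff hΩ hf hg
    (ψ := fun x => Real.sin (2 * Real.pi * inner ℝ x ξ)) hsm.sin
  simp_rw [fun x => (hd x).cos.fderiv] at h1
  simp_rw [fun x => (hd x).sin.fderiv] at h2
  simp only [smul_apply, hs, smul_eq_mul] at h1 h2
  have h1' : ∫ x, g x * Real.cos (2 * Real.pi * inner ℝ x ξ) =
      2 * Real.pi * ξ i * ∫ x, f x * Real.sin (2 * Real.pi * inner ℝ x ξ) := by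
    rw [← integral_const_mul, ← neg_eq_iff_eq_neg.2 h1, ← integral_neg]
    exact integral_congr_ae (Eventually.of_forall fun x => by simp only; ring)
  have h2' : ∫ x, g x * Real.sin (2 * Real.pi * inner ℝ x ξ) =
      -(2 * Real.pi * ξ i * ∫ x, f x * Real.cos (2 * Real.pi * inner ℝ x ξ)) := by
    rw [← integral_const_mul, ← neg_eq_iff_eq_neg.2 h2]
    congr 1
    exact integral_congr_ae (Eventually.of_forall fun x => by simp only; ring)
  rw [PhaseField.ft_eq (hg.integrable hΩ hg2), PhaseField.ft_eq (hf.integrable hΩ hf2), h1', h2']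
  push_cast
  linear_combination (2 * Real.pi * ξ i *
    ((∫ x, f x * Real.sin (2 * Real.pi * inner ℝ x ξ) : ℝ) : ℂ)) * Complex.I_sq

/-- The modulus of the Fourier transform of a weak derivative. -/
lemma norm_ft_partial_sq {Ω : Set (Space n)} (hΩ : Bornology.IsBounded Ω)
    {i : Fin n} {f g : Space n → ℝ} (h : IsWeakPartial univ i f g) (hf2 : MemLp f 2)
    (hf : VanishesOff Ω f) (hg : VanishesOff Ω g) (ξ : Space n) :
    ‖ft g ξ‖ ^ 2 = 4 * Real.pi ^ 2 * ξ i ^ 2 * ‖ft f ξ‖ ^ 2 := by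
  rw [h.ft_eq hΩ hf2 hf hg]
  simp only [norm_mul, mul_pow, Complex.norm_real, Complex.norm_I, Real.norm_eq_abs, sq_abs,
    Complex.norm_ofNat]
  ring

/-! ### Sobolev embedding and Rellich's theorem -/

/-- Weak convergence in `L²(μ)`, tested against all functions in `L²(μ)`. -/
def WeakTendsto {α : Type*} [MeasurableSpace α] (μ : Measure α) (f : ℕ → α → ℝ) (f₀ : α → ℝ) :
    Prop :=
  ∀ φ : α → ℝ, MemLp φ 2 μ → Tendsto (fun k => ∫ x, f k x * φ x ∂μ) atTop (𝓝 (∫ x, f₀ x * φ x ∂μ))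

/-- A second order jet of class `L²` in `ℝⁿ` all of whose entries vanish outside `Ω`. -/
structure IsSupportedJet (Ω : Set (Space n)) (f : Space n → ℝ) (g : Fin n → Space n → ℝ)
    (h : Fin n → Fin n → Space n → ℝ) : Prop extends IsJet univ f g h where
  vanishes : VanishesOff Ω f
  vanishes_fst : ∀ i, VanishesOff Ω (g i)
  vanishes_snd : ∀ i j, VanishesOff Ω (h i j)

/-- The Cauchy–Schwarz inequality in `L²(μ)`. -/
lemma sq_integral_mul_le {α : Type*} [MeasurableSpace α] {μ : Measure α} {a b : α → ℝ}
    (ha : MemLp a 2 μ) (hb : MemLp b 2 μ) :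
    (∫ x, a x * b x ∂μ) ^ 2 ≤ (∫ x, a x ^ 2 ∂μ) * ∫ x, b x ^ 2 ∂μ := by
  have h : ∀ t : ℝ, 0 ≤ (∫ x, a x ^ 2 ∂μ) * (t * t) + (2 * ∫ x, a x * b x ∂μ) * t +
      ∫ x, b x ^ 2 ∂μ := by
    intro t
    have e : ∫ x, (t * a x + b x) ^ 2 ∂μ = (∫ x, a x ^ 2 ∂μ) * (t * t) +
        (2 * ∫ x, a x * b x ∂μ) * t + ∫ x, b x ^ 2 ∂μ := by
      have e1 : ∀ x, (t * a x + b x) ^ 2 = (t * t) * a x ^ 2 + (2 * t) * (a x * b x) + b x ^ 2 :=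
        fun x => by ring
      simp_rw [e1]
      have i1 : Integrable (fun x => t * t * a x ^ 2) μ := ha.integrable_sq.const_mul _
      have i2 : Integrable (fun x => 2 * t * (a x * b x)) μ :=
        (integrable_mul_of_memLp ha hb).const_mul _
      have i3 : Integrable (fun x => t * t * a x ^ 2 + 2 * t * (a x * b x)) μ := i1.add i2
      rw [integral_add i3 hb.integrable_sq, integral_add i1 i2, integral_const_mul,
        integral_const_mul]
      ring
    rw [← e]
    exact integral_nonneg fun x => sq_nonneg _
  have := discrim_le_zero h
  rw [discrim] at this
  nlinarith

lemma ft_sum {ι : Type*} [Fintype ι] {F : ι → Space n → ℝ} (hF : ∀ i, Integrable (F i))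
    (ξ : Space n) : ft (fun x => ∑ i, F i x) ξ = ∑ i, ft (F i) ξ := by
  simp only [ft, Real.fourier_eq]
  rw [← integral_finsetSum]
  · refine integral_congr_ae (Eventually.of_forall fun x => ?_)
    simp [Finset.smul_sum]
  · intro i _
    exact (Real.fourierIntegral_convergent_iff ξ).2 (hF i).ofReal

lemma norm_sq_eq_sum (ξ : Space n) : ‖ξ‖ ^ 2 = ∑ i, ξ i ^ 2 := by
  rw [EuclideanSpace.norm_sq_eq]; simp

lemma memLp_of_univ {f : Space n → ℝ} (h : MemLp f 2 (volume.restrict univ)) : MemLp f 2 := by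
  simpa using h

namespace IsSupportedJet

variable {Ω : Set (Space n)} {f : Space n → ℝ} {g : Fin n → Space n → ℝ}
  {h : Fin n → Fin n → Space n → ℝ}

lemma sub {f' : Space n → ℝ} {g' : Fin n → Space n → ℝ} {h' : Fin n → Fin n → Space n → ℝ}
    (H : IsSupportedJet Ω f g h) (H' : IsSupportedJet Ω f' g' h') :
    IsSupportedJet Ω (fun x => f x - f' x) (fun i x => g i x - g' i x)
      (fun i j x => h i j x - h' i j x) :=
  ⟨H.toIsJet.sub H'.toIsJet, H.vanishes.sub H'.vanishes,
    fun i => (H.vanishes_fst i).sub (H'.vanishes_fst i),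
    fun i j => (H.vanishes_snd i j).sub (H'.vanishes_snd i j)⟩

lemma memLp_zero (H : IsSupportedJet Ω f g h) : MemLp f 2 := memLp_of_univ H.memLp

lemma memLp_fst (H : IsSupportedJet Ω f g h) (i : Fin n) : MemLp (g i) 2 :=
  memLp_of_univ (H.fst i).memLp

lemma memLp_snd (H : IsSupportedJet Ω f g h) (i j : Fin n) : MemLp (h i j) 2 :=
  memLp_of_univ (H.snd i j).memLp

lemma memLp_lap (H : IsSupportedJet Ω f g h) : MemLp (fun x => ∑ i, h i i x) 2 :=
  memLp_finsetSum _ fun i _ => H.memLp_snd i i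

lemma vanishes_lap (H : IsSupportedJet Ω f g h) : VanishesOff Ω (fun x => ∑ i, h i i x) :=
  VanishesOff.sum fun i => H.vanishes_snd i i

lemma ft_snd (H : IsSupportedJet Ω f g h) (hΩ : Bornology.IsBounded Ω) (i j : Fin n) (ξ : Space n) :
    ft (h i j) ξ = -(4 * Real.pi ^ 2 * ξ i * ξ j) * ft f ξ := by
  rw [(H.snd i j).ft_eq hΩ (H.memLp_fst i) (H.vanishes_fst i) (H.vanishes_snd i j),
    (H.fst i).ft_eq hΩ H.memLp_zero H.vanishes (H.vanishes_fst i)]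
  linear_combination (4 * Real.pi ^ 2 * ξ i * ξ j * ft f ξ) * Complex.I_sq

lemma ft_lap (H : IsSupportedJet Ω f g h) (hΩ : Bornology.IsBounded Ω) (ξ : Space n) :
    ft (fun x => ∑ i, h i i x) ξ = -((4 * Real.pi ^ 2 * ‖ξ‖ ^ 2 : ℝ) : ℂ) * ft f ξ := by
  rw [ft_sum fun i => (H.vanishes_snd i i).integrable hΩ (H.memLp_snd i i), norm_sq_eq_sum]
  simp_rw [H.ft_snd hΩ]
  push_cast
  rw [← Finset.sum_mul, Finset.mul_sum, ← Finset.sum_neg_distrib]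
  congr 1
  exact Finset.sum_congr rfl fun i _ => by ring

/-- The Laplacian controls all second derivatives in `L²`, with constant `1`: on the Fourier side
this is the pointwise inequality `|ξᵢ ξⱼ| ≤ |ξ|²`. -/
lemma integral_snd_sq_le (H : IsSupportedJet Ω f g h) (hΩ : Bornology.IsBounded Ω) (i j : Fin n) :
    ∫ x, h i j x ^ 2 ≤ ∫ x, (∑ i, h i i x) ^ 2 := by
  have i1 := (H.vanishes_snd i j).integrable hΩ (H.memLp_snd i j)
  have i2 := H.vanishes_lap.integrable hΩ H.memLp_lap
  rw [← integral_norm_ft_sq i1 (H.memLp_snd i j), ← integral_norm_ft_sq i2 H.memLp_lap]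
  refine integral_mono (memLp_ft i1 (H.memLp_snd i j)).norm.integrable_sq
    (memLp_ft i2 H.memLp_lap).norm.integrable_sq fun ξ => ?_
  refine pow_le_pow_left₀ (norm_nonneg _) ?_ 2
  rw [H.ft_snd hΩ, H.ft_lap hΩ, norm_mul, norm_mul]
  refine mul_le_mul_of_nonneg_right ?_ (norm_nonneg _)
  rw [norm_neg, norm_neg, Complex.norm_real, norm_mul, norm_mul]
  have hi : |ξ i| ≤ ‖ξ‖ := by simpa using PiLp.norm_apply_le ξ i
  have hj : |ξ j| ≤ ‖ξ‖ := by simpa using PiLp.norm_apply_le ξ j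
  have h4 : ‖(4 * (Real.pi : ℂ) ^ 2)‖ = 4 * Real.pi ^ 2 := by
    simp [abs_of_pos Real.pi_pos]
  rw [h4, Complex.norm_real, Complex.norm_real, Real.norm_eq_abs, Real.norm_eq_abs,
    Real.norm_of_nonneg (by positivity), mul_assoc]
  refine mul_le_mul_of_nonneg_left ?_ (by positivity)
  rw [sq]
  exact mul_le_mul hi hj (abs_nonneg _) (norm_nonneg _)

end IsSupportedJet

lemma integrable_inv_one_add_sq (hn : n ≤ 3) :
    Integrable fun ξ : Space n => ((1 + ‖ξ‖ ^ 2)⁻¹) ^ 2 := by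
  have h := integrable_rpow_neg_one_add_norm_sq (E := Space n) (μ := volume) (r := 4)
    (by simp; exact_mod_cast (by omega : n < 4))
  refine h.congr (Eventually.of_forall fun ξ => ?_)
  simp only
  rw [show (-4 / 2 : ℝ) = -(2 : ℕ) by norm_num, Real.rpow_neg (by positivity), Real.rpow_natCast,
    inv_pow]

lemma inv_add_sq_le {M : ℝ} (hM : 1 ≤ M) (t : ℝ) (ht : 0 ≤ t) :
    ((M + t)⁻¹) ^ 2 ≤ ((1 + t)⁻¹) ^ 2 := by
  gcongr

/-- For `n ≤ 3` the weight `(M + |ξ|²)⁻¹` is square integrable, with norm tending to `0` as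
`M → ∞`. -/
lemma exists_integral_inv_add_sq_le (hn : n ≤ 3) {δ : ℝ} (hδ : 0 < δ) :
    ∃ M : ℝ, 1 ≤ M ∧ MemLp (fun ξ : Space n => (M + ‖ξ‖ ^ 2)⁻¹) 2 ∧
      ∫ ξ : Space n, ((M + ‖ξ‖ ^ 2)⁻¹) ^ 2 ≤ δ := by
  have h := tendsto_integral_of_dominated_convergence
    (F := fun (k : ℕ) (ξ : Space n) => (((k + 1 : ℝ) + ‖ξ‖ ^ 2)⁻¹) ^ 2) (f := fun _ => 0)
    (fun ξ : Space n => ((1 + ‖ξ‖ ^ 2)⁻¹) ^ 2) (μ := volume)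
    (fun k => (Measurable.aestronglyMeasurable (by fun_prop)))
    (integrable_inv_one_add_sq hn)
    (fun k => Eventually.of_forall fun ξ => by
      rw [Real.norm_of_nonneg (by positivity)]
      exact inv_add_sq_le (by linarith [(Nat.cast_nonneg k : (0 : ℝ) ≤ k)]) _ (by positivity))
    (Eventually.of_forall fun ξ => by
      have h1 : Tendsto (fun k : ℕ => (k + 1 : ℝ) + ‖ξ‖ ^ 2) atTop atTop :=
        tendsto_atTop_add_const_right _ _
          (tendsto_atTop_add_const_right _ _ tendsto_natCast_atTop_atTop)
      simpa using h1.inv_tendsto_atTop.pow 2)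
  rw [integral_zero] at h
  obtain ⟨k, hk⟩ := (h.eventually (gt_mem_nhds hδ)).exists
  refine ⟨k + 1, by linarith [(Nat.cast_nonneg k : (0 : ℝ) ≤ k)], ?_, hk.le⟩
  rw [memLp_two_iff_integrable_sq (Measurable.aestronglyMeasurable (by fun_prop))]
  refine (integrable_inv_one_add_sq hn).mono' (Measurable.aestronglyMeasurable (by fun_prop))
    (Eventually.of_forall fun ξ => ?_)
  rw [Real.norm_of_nonneg (by positivity)]
  exact inv_add_sq_le (by linarith [(Nat.cast_nonneg k : (0 : ℝ) ≤ k)]) _ (by positivity)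

/-- Sobolev embedding `H² ⊂ L^∞` in dimension at most three, with an arbitrarily small constant in
front of the Laplacian. -/
lemma exists_sq_le_of_isSupportedJet (hn : n ≤ 3) {δ : ℝ} (hδ : 0 < δ) :
    ∃ C : ℝ, 0 ≤ C ∧ ∀ (Ω : Set (Space n)) (f : Space n → ℝ) (g : Fin n → Space n → ℝ)
      (h : Fin n → Fin n → Space n → ℝ), Bornology.IsBounded Ω → IsSupportedJet Ω f g h →
      ∀ᵐ x, f x ^ 2 ≤ C * (∫ x, f x ^ 2) + δ * ∫ x, (∑ i, h i i x) ^ 2 := by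
  obtain ⟨M, hM, hw, hκ⟩ := exists_integral_inv_add_sq_le (n := n) hn (half_pos hδ)
  -- `|ft f| = (M + |ξ|²)⁻¹ · (M + |ξ|²) |ft f|` is a product of two functions in `L²`
  refine ⟨δ * M ^ 2, by positivity, fun Ω f g h hΩ H => ?_⟩
  have i1 := H.vanishes.integrable hΩ H.memLp_zero
  have i2 := H.vanishes_lap.integrable hΩ H.memLp_lap
  have m1 := memLp_ft i1 H.memLp_zero
  have m2 := memLp_ft i2 H.memLp_lap
  set c : ℝ := (4 * Real.pi ^ 2)⁻¹ with hc
  have hc0 : 0 ≤ c := by positivity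
  have hc1 : c ≤ 1 := by
    rw [hc]
    refine inv_le_one_of_one_le₀ ?_
    nlinarith [Real.pi_gt_three]
  have m3 : MemLp (fun ξ : Space n => (M + ‖ξ‖ ^ 2) * ‖ft f ξ‖) 2 := by
    refine ((m1.const_smul (M : ℂ)).sub (m2.const_smul (c : ℂ))).norm.ae_eq
      (Eventually.of_forall fun ξ => ?_)
    simp only [Pi.sub_apply, Pi.smul_apply, smul_eq_mul, H.ft_lap hΩ]
    have : (M : ℂ) * ft f ξ - c * (-((4 * Real.pi ^ 2 * ‖ξ‖ ^ 2 : ℝ) : ℂ) * ft f ξ) =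
        ((M + ‖ξ‖ ^ 2 : ℝ) : ℂ) * ft f ξ := by
      have h1 : (c : ℂ) * ((4 * Real.pi ^ 2 * ‖ξ‖ ^ 2 : ℝ) : ℂ) = ((‖ξ‖ ^ 2 : ℝ) : ℂ) := by
        rw [← Complex.ofReal_mul]
        congr 1
        rw [hc]
        field_simp
      push_cast at h1 ⊢
      linear_combination ft f ξ * h1
    rw [this, norm_mul, Complex.norm_real, Real.norm_of_nonneg (by positivity)]
  have e1 : ∀ ξ, (M + ‖ξ‖ ^ 2)⁻¹ * ((M + ‖ξ‖ ^ 2) * ‖ft f ξ‖) = ‖ft f ξ‖ := by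
    intro ξ
    have : M + ‖ξ‖ ^ 2 ≠ 0 := by positivity
    field_simp
  have hint : Integrable (ft f) := by
    rw [← integrable_norm_iff (continuous_ft i1).aestronglyMeasurable]
    simpa only [e1] using integrable_mul_of_memLp hw m3
  have hcs := sq_integral_mul_le hw m3
  simp only [e1] at hcs
  have hb : ∫ ξ, ((M + ‖ξ‖ ^ 2) * ‖ft f ξ‖) ^ 2 ≤
      2 * M ^ 2 * (∫ x, f x ^ 2) + 2 * ∫ x, (∑ i, h i i x) ^ 2 := by
    rw [← integral_norm_ft_sq i1 H.memLp_zero, ← integral_norm_ft_sq i2 H.memLp_lap,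
      ← integral_const_mul, ← integral_const_mul,
      ← integral_add (m1.norm.integrable_sq.const_mul _) (m2.norm.integrable_sq.const_mul _)]
    refine integral_mono m3.integrable_sq ((m1.norm.integrable_sq.const_mul _).add
      (m2.norm.integrable_sq.const_mul _)) fun ξ => ?_
    rw [H.ft_lap hΩ, norm_mul, norm_neg, Complex.norm_real, Real.norm_of_nonneg (by positivity)]
    have h4 : 1 ≤ 4 * Real.pi ^ 2 := by nlinarith [Real.pi_gt_three]
    have h5 : ‖ξ‖ ^ 2 * ‖ft f ξ‖ ≤ 4 * Real.pi ^ 2 * ‖ξ‖ ^ 2 * ‖ft f ξ‖ := by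
      rw [mul_assoc (4 * Real.pi ^ 2)]
      exact le_mul_of_one_le_left (by positivity) h4
    have h6 := pow_le_pow_left₀ (by positivity) h5 2
    nlinarith [sq_nonneg (M * ‖ft f ξ‖ - ‖ξ‖ ^ 2 * ‖ft f ξ‖)]
  filter_upwards [ae_abs_le_integral_norm_ft i1 hint] with x hx
  have hx2 : f x ^ 2 ≤ (∫ ξ, ‖ft f ξ‖) ^ 2 := by
    rw [← sq_abs]; exact pow_le_pow_left₀ (abs_nonneg _) hx 2
  have hB0 : 0 ≤ 2 * M ^ 2 * (∫ x, f x ^ 2) + 2 * ∫ x, (∑ i, h i i x) ^ 2 := by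
    have h1 : 0 ≤ ∫ x, f x ^ 2 := integral_nonneg fun x => sq_nonneg _
    have h2 : 0 ≤ ∫ x, (∑ i, h i i x) ^ 2 := integral_nonneg fun x => sq_nonneg _
    positivity
  have hA0 : 0 ≤ ∫ ξ : Space n, ((M + ‖ξ‖ ^ 2)⁻¹) ^ 2 := integral_nonneg fun x => sq_nonneg _
  calc f x ^ 2 ≤ _ := hx2.trans hcs
    _ ≤ (δ / 2) * (2 * M ^ 2 * (∫ x, f x ^ 2) + 2 * ∫ x, (∑ i, h i i x) ^ 2) :=
        mul_le_mul hκ hb (integral_nonneg fun x => sq_nonneg _) (by positivity)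
    _ = _ := by ring

/-- Rellich's theorem: a bounded sequence in `H¹(ℝⁿ)` with uniformly bounded supports which
converges weakly to `0` in `L²` converges strongly. Low frequencies are handled by dominated
convergence, and high frequencies by the bound on the gradients. -/
lemma tendsto_integral_sq_of_weakTendsto_zero {Ω : Set (Space n)} (hΩ : Bornology.IsBounded Ω)
    {f : ℕ → Space n → ℝ} {g : ℕ → Fin n → Space n → ℝ}
    (hf2 : ∀ k, MemLp (f k) 2) (hfg : ∀ k i, IsWeakPartial univ i (f k) (g k i))
    (hf : ∀ k, VanishesOff Ω (f k)) (hg : ∀ k i, VanishesOff Ω (g k i)) {K : ℝ}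
    (hfK : ∀ k, ∫ x, f k x ^ 2 ≤ K) (hgK : ∀ k i, ∫ x, g k i x ^ 2 ≤ K)
    (hw : WeakTendsto volume f 0) : Tendsto (fun k => ∫ x, f k x ^ 2) atTop (𝓝 0) := by
  obtain ⟨R₀, hR₀⟩ := hΩ.subset_closedBall (0 : Space n)
  have hK : 0 ≤ K := (integral_nonneg fun x => sq_nonneg _).trans (hfK 0)
  have hg2 : ∀ k i, MemLp (g k i) 2 := fun k i => memLp_of_univ (hfg k i).memLp
  have hfi : ∀ k, Integrable (f k) := fun k => (hf k).integrable hΩ (hf2 k)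
  have hgi : ∀ k i, Integrable (g k i) := fun k i => (hg k i).integrable hΩ (hg2 k i)
  have hbd : ∀ k ξ, ‖ft (f k) ξ‖ ≤ volume.real (Metric.closedBall (0 : Space n) R₀) + K :=
    fun k ξ => (norm_ft_le _ _).trans
      ((((hf k).mono hR₀).integral_abs_le (hf2 k)).trans (by linarith [hfK k]))
  -- pointwise convergence of the Fourier transforms
  have hpt : ∀ ξ, Tendsto (fun k => ft (f k) ξ) atTop (𝓝 0) := by
    intro ξ
    have key : ∀ φ : Space n → ℝ, Continuous φ → (∀ x, |φ x| ≤ 1) →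
        Tendsto (fun k => ∫ x, f k x * φ x) atTop (𝓝 0) := by
      intro φ hφ hφ1
      have hm : MemLp ((Metric.closedBall (0 : Space n) R₀).indicator φ) 2 := by
        rw [memLp_indicator_iff_restrict measurableSet_closedBall]
        have : IsFiniteMeasure (volume.restrict (Metric.closedBall (0 : Space n) R₀)) :=
          ⟨by simpa using measure_closedBall_lt_top⟩
        exact MemLp.of_bound hφ.aestronglyMeasurable 1 (Eventually.of_forall hφ1)
      have h := hw _ hm
      simp only [Pi.zero_apply, zero_mul, integral_zero] at h
      refine h.congr fun k => integral_congr_ae ?_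
      filter_upwards [(hf k).mono hR₀] with x hx
      by_cases hxB : x ∈ Metric.closedBall (0 : Space n) R₀
      · rw [indicator_of_mem hxB]
      · rw [hx hxB]; simp
    have h1 := key (fun x => Real.cos (2 * Real.pi * inner ℝ x ξ)) (by fun_prop)
      fun x => Real.abs_cos_le_one _
    have h2 := key (fun x => Real.sin (2 * Real.pi * inner ℝ x ξ)) (by fun_prop)
      fun x => Real.abs_sin_le_one _
    have h3 := ((Complex.continuous_ofReal.tendsto _).comp h1).sub
      (((Complex.continuous_ofReal.tendsto _).comp h2).mul_const Complex.I)
    simp only [Complex.ofReal_zero, zero_mul, sub_zero] at h3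
    exact h3.congr fun k => (ft_eq (hfi k) ξ).symm
  -- low frequencies contribute nothing in the limit
  have hlow : ∀ R : ℝ, Tendsto (fun k => ∫ ξ in Metric.closedBall (0 : Space n) R, ‖ft (f k) ξ‖ ^ 2)
      atTop (𝓝 0) := by
    intro R
    have : IsFiniteMeasure (volume.restrict (Metric.closedBall (0 : Space n) R)) :=
      ⟨by simpa using measure_closedBall_lt_top⟩
    have h := tendsto_integral_of_dominated_convergence
      (μ := volume.restrict (Metric.closedBall (0 : Space n) R))
      (F := fun k ξ => ‖ft (f k) ξ‖ ^ 2) (f := fun _ => 0)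
      (fun _ => (volume.real (Metric.closedBall (0 : Space n) R₀) + K) ^ 2)
      (fun k => ((continuous_ft (hfi k)).norm.pow 2).aestronglyMeasurable) (integrable_const _)
      (fun k => Eventually.of_forall fun ξ => by
        rw [Real.norm_of_nonneg (by positivity)]
        exact pow_le_pow_left₀ (norm_nonneg _) (hbd k ξ) 2)
      (Eventually.of_forall fun ξ => by simpa using (hpt ξ).norm.pow 2)
    simpa using h
  have hsplit : ∀ R : ℝ, 0 < R → ∀ k, ∫ x, f k x ^ 2 ≤
      (∫ ξ in Metric.closedBall (0 : Space n) R, ‖ft (f k) ξ‖ ^ 2) + n * K / R ^ 2 := by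
    intro R hR k
    have m1 := memLp_ft (hfi k) (hf2 k)
    have m2 : ∀ i, MemLp (ft (g k i)) 2 := fun i => memLp_ft (hgi k i) (hg2 k i)
    have hs : Integrable fun ξ => ∑ i, ‖ft (g k i) ξ‖ ^ 2 :=
      integrable_finsetSum _ fun i _ => (m2 i).norm.integrable_sq
    have hgs : ∑ i, ∫ x, g k i x ^ 2 ≤ n * K := by
      calc ∑ i, ∫ x, g k i x ^ 2 ≤ ∑ _i : Fin n, K := Finset.sum_le_sum fun i _ => hgK k i
        _ = n * K := by simp
    calc ∫ x, f k x ^ 2 = ∫ ξ, ‖ft (f k) ξ‖ ^ 2 := (integral_norm_ft_sq (hfi k) (hf2 k)).symm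
      _ ≤ ∫ ξ, ((Metric.closedBall (0 : Space n) R).indicator (fun ξ => ‖ft (f k) ξ‖ ^ 2) ξ +
            (1 / R ^ 2) * ∑ i, ‖ft (g k i) ξ‖ ^ 2) := by
          refine integral_mono m1.norm.integrable_sq
            ((m1.norm.integrable_sq.indicator measurableSet_closedBall).add (hs.const_mul _))
            fun ξ => ?_
          have hnn : 0 ≤ (1 / R ^ 2) * ∑ i, ‖ft (g k i) ξ‖ ^ 2 := by positivity
          by_cases hξ : ξ ∈ Metric.closedBall (0 : Space n) R
          · simp only [indicator_of_mem hξ]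
            linarith
          · simp only [indicator_of_notMem hξ, zero_add]
            have hξR : R ≤ ‖ξ‖ := by
              rw [mem_closedBall_zero_iff, not_le] at hξ
              exact hξ.le
            have e : ∑ i, ‖ft (g k i) ξ‖ ^ 2 = 4 * Real.pi ^ 2 * ‖ξ‖ ^ 2 * ‖ft (f k) ξ‖ ^ 2 := by
              rw [norm_sq_eq_sum, Finset.mul_sum, Finset.sum_mul]
              exact Finset.sum_congr rfl fun i _ =>
                norm_ft_partial_sq hΩ (hfg k i) (hf2 k) (hf k) (hg k i) ξ
            rw [e, one_div, inv_mul_eq_div, le_div_iff₀ (by positivity), mul_comm]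
            refine mul_le_mul_of_nonneg_right ?_ (by positivity)
            have : R ^ 2 ≤ ‖ξ‖ ^ 2 := pow_le_pow_left₀ hR.le hξR 2
            have h4 : 1 ≤ 4 * Real.pi ^ 2 := by nlinarith [Real.pi_gt_three]
            exact this.trans (le_mul_of_one_le_left (by positivity) h4)
      _ = (∫ ξ in Metric.closedBall (0 : Space n) R, ‖ft (f k) ξ‖ ^ 2) +
            (1 / R ^ 2) * ∑ i, ∫ x, g k i x ^ 2 := by
          rw [integral_add (m1.norm.integrable_sq.indicator measurableSet_closedBall)
            (hs.const_mul _), integral_indicator measurableSet_closedBall, integral_const_mul,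
            integral_finsetSum _ fun i _ => (m2 i).norm.integrable_sq]
          congr 2
          exact Finset.sum_congr rfl fun i _ => integral_norm_ft_sq (hgi k i) (hg2 k i)
      _ ≤ _ := by
          have : (1 / R ^ 2) * ∑ i, ∫ x, g k i x ^ 2 ≤ (1 / R ^ 2) * (n * K) :=
            mul_le_mul_of_nonneg_left hgs (by positivity)
          rw [one_div_mul_eq_div (R ^ 2) (n * K)] at this
          linarith
  rw [Metric.tendsto_atTop]
  intro ε hε
  -- `R` is chosen such that the high frequencies contribute less than `ε / 2`
  obtain ⟨R, hR, hRε⟩ : ∃ R : ℝ, 0 < R ∧ n * K / R ^ 2 < ε / 2 := by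
    have h1 : Tendsto (fun R : ℝ => n * K / R ^ 2) atTop (𝓝 0) :=
      tendsto_const_nhds.div_atTop (tendsto_pow_atTop two_ne_zero)
    obtain ⟨R, h2, h3⟩ := ((eventually_gt_atTop (0 : ℝ)).and
      (h1.eventually (gt_mem_nhds (half_pos hε)))).exists
    exact ⟨R, h2, h3⟩
  obtain ⟨N, hN⟩ := eventually_atTop.1 ((hlow R).eventually (gt_mem_nhds (half_pos hε)))
  refine ⟨N, fun k hk => ?_⟩
  rw [Real.dist_eq, sub_zero, abs_of_nonneg (integral_nonneg fun x => sq_nonneg _)]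
  linarith [hN k hk, hsplit R hR k]

/-! ### Weak convergence in `L²` and interior compactness -/

section Abstract

variable {α : Type*} [MeasurableSpace α] {μ : Measure α}

/-- Weak sequential compactness of bounded sets in `L²(μ)`, for finitely many sequences at once. -/
lemma exists_weakTendsto_subseq [IsSeparable μ] {ι : Type*} [Fintype ι] {F : ℕ → ι → α → ℝ}
    (hF : ∀ k i, MemLp (F k i) 2 μ) {C : ℝ} (hC : ∀ k i, ∫ x, F k i x ^ 2 ∂μ ≤ C) :
    ∃ (F₀ : ι → α → ℝ) (s : ℕ → ℕ), StrictMono s ∧ (∀ i, MemLp (F₀ i) 2 μ) ∧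
      ∀ i, WeakTendsto μ (fun k => F (s k) i) (F₀ i) := by
  classical
  -- the sequences form one bounded sequence in the separable Hilbert space `L²(μ; ℝ^ι)`, to which
  -- the sequential Banach–Alaoglu theorem applies
  have hm : ∀ k, MemLp (fun x => WithLp.toLp 2 fun i => F k i x : α → EuclideanSpace ℝ ι) 2 μ :=
    fun k => memLp_euclidean_iff.2 fun i => hF k i
  set X : ℕ → Lp (EuclideanSpace ℝ ι) 2 μ := fun k => (hm k).toLp
  have hX : ∀ k, ∀ᵐ x ∂μ, X k x = WithLp.toLp 2 fun i => F k i x := fun k => (hm k).coeFn_toLp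
  have hnorm : ∀ k, ‖X k‖ ≤ √(Fintype.card ι * C) := by
    intro k
    refine Real.le_sqrt_of_sq_le ?_
    have e : ‖X k‖ ^ 2 = ∫ x, ∑ i, F k i x ^ 2 ∂μ := by
      rw [← real_inner_self_eq_norm_sq, L2.inner_def]
      refine integral_congr_ae ?_
      filter_upwards [hX k] with x hx
      rw [hx, real_inner_self_eq_norm_sq, EuclideanSpace.norm_sq_eq]
      simp
    rw [e, integral_finsetSum _ fun i _ => (hF k i).integrable_sq]
    calc ∑ i, ∫ x, F k i x ^ 2 ∂μ ≤ ∑ _i : ι, C := Finset.sum_le_sum fun i _ => hC k i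
      _ = _ := by simp
  have : Fact ((2 : ℝ≥0∞) ≠ ⊤) := ⟨by norm_num⟩
  have hsc := WeakDual.isSeqCompact_closedBall ℝ (Lp (EuclideanSpace ℝ ι) 2 μ)
    0 (√(Fintype.card ι * C))
  obtain ⟨a, -, s, hs, ha⟩ := hsc
    (x := fun k => StrongDual.toWeakDual (InnerProductSpace.toDual ℝ _ (X k)))
    (fun k => by simpa using hnorm k)
  set X₀ : Lp (EuclideanSpace ℝ ι) 2 μ :=
    (InnerProductSpace.toDual ℝ _).symm (WeakDual.toStrongDual a) with hX₀
  have hlim : ∀ Y : Lp (EuclideanSpace ℝ ι) 2 μ,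
      Tendsto (fun k => inner ℝ (X (s k)) Y) atTop (𝓝 (inner ℝ X₀ Y)) := by
    intro Y
    have h1 : Tendsto (fun k => inner ℝ (X (s k)) Y) atTop (𝓝 (a Y)) :=
      ((WeakDual.eval_continuous Y).tendsto a).comp ha
    rwa [hX₀, InnerProductSpace.toDual_symm_apply]
  refine ⟨fun i x => X₀ x i, s, hs, fun i => memLp_euclidean_iff.1 (Lp.memLp X₀) i, ?_⟩
  intro i φ hφ
  have hY : MemLp (fun x => EuclideanSpace.single i (φ x) : α → EuclideanSpace ℝ ι) 2 μ := by
    rw [memLp_euclidean_iff]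
    intro j
    by_cases hj : j = i
    · subst hj; simpa using hφ
    · simp [hj]
  have h := hlim hY.toLp
  have e : ∀ Z : Lp (EuclideanSpace ℝ ι) 2 μ, inner ℝ Z hY.toLp = ∫ x, Z x i * φ x ∂μ := by
    intro Z
    rw [L2.inner_def]
    refine integral_congr_ae ?_
    filter_upwards [hY.coeFn_toLp] with x hx
    rw [hx]
    simp [EuclideanSpace.inner_single_right, mul_comm]
  simp_rw [e] at h
  refine h.congr fun k => integral_congr_ae ?_
  filter_upwards [hX (s k)] with x hx
  rw [hx]

/-- A crude bound for the `L²` norm of a difference. -/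
lemma integral_sub_sq_le {u v : α → ℝ} (hu : MemLp u 2 μ) (hv : MemLp v 2 μ) {C : ℝ}
    (h1 : ∫ x, u x ^ 2 ∂μ ≤ C) (h2 : ∫ x, v x ^ 2 ∂μ ≤ C) :
    ∫ x, (u x - v x) ^ 2 ∂μ ≤ 4 * C := by
  calc ∫ x, (u x - v x) ^ 2 ∂μ ≤ ∫ x, (2 * u x ^ 2 + 2 * v x ^ 2) ∂μ := by
        refine integral_mono (hu.sub hv).integrable_sq
          ((hu.integrable_sq.const_mul 2).add (hv.integrable_sq.const_mul 2)) fun x => ?_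
        simp only
        nlinarith [sq_nonneg (u x + v x)]
    _ = 2 * (∫ x, u x ^ 2 ∂μ) + 2 * ∫ x, v x ^ 2 ∂μ := by
        rw [integral_add (hu.integrable_sq.const_mul 2) (hv.integrable_sq.const_mul 2),
          integral_const_mul, integral_const_mul]
    _ ≤ 4 * C := by linarith

variable {f : ℕ → α → ℝ} {f₀ : α → ℝ}

lemma WeakTendsto.comp_strictMono (h : WeakTendsto μ f f₀) {s : ℕ → ℕ} (hs : StrictMono s) :
    WeakTendsto μ (fun k => f (s k)) f₀ :=
  fun φ hφ => (h φ hφ).comp hs.tendsto_atTop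

lemma WeakTendsto.sub_limit (h : WeakTendsto μ f f₀) (hf : ∀ k, MemLp (f k) 2 μ)
    (hf₀ : MemLp f₀ 2 μ) : WeakTendsto μ (fun k x => f k x - f₀ x) 0 := by
  intro φ hφ
  have h1 := (h φ hφ).sub_const (∫ x, f₀ x * φ x ∂μ)
  simp only [sub_self] at h1
  simp only [Pi.zero_apply, zero_mul, integral_zero]
  refine h1.congr fun k => ?_
  rw [← integral_sub (integrable_mul_of_memLp (hf k) hφ) (integrable_mul_of_memLp hf₀ hφ)]
  exact integral_congr_ae (Eventually.of_forall fun x => (sub_mul _ _ _).symm)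

/-- Weak lower semicontinuity of a weighted `L²` norm, in a quantitative form: the error term `c`
comes from `a f₀² + 2 a f₀ (f - f₀) ≤ a f²`. -/
lemma WeakTendsto.exists_le_integral_mul_sq (h : WeakTendsto μ f f₀) (hf : ∀ k, MemLp (f k) 2 μ)
    (hf₀ : MemLp f₀ 2 μ) {a : α → ℝ} (ha : MemLp a ∞ μ) (ha0 : ∀ x, 0 ≤ a x) :
    ∃ c : ℕ → ℝ, Tendsto c atTop (𝓝 0) ∧
      ∀ k, ∫ x, a x * f₀ x ^ 2 ∂μ + c k ≤ ∫ x, a x * f k x ^ 2 ∂μ := by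
  have hm : ∀ {u : α → ℝ}, MemLp u 2 μ → MemLp (fun x => a x * u x) 2 μ := fun hu => hu.mul' ha
  refine ⟨fun k => 2 * (∫ x, f k x * (a x * f₀ x) ∂μ - ∫ x, f₀ x * (a x * f₀ x) ∂μ), ?_, ?_⟩
  · simpa using ((h _ (hm hf₀)).sub_const (∫ x, f₀ x * (a x * f₀ x) ∂μ)).const_mul 2
  · intro k
    have i1 : Integrable (fun x => a x * f₀ x ^ 2) μ :=
      (integrable_mul_of_memLp hf₀ (hm hf₀)).congr (Eventually.of_forall fun x => by
        simp only; ring)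
    have i2 : Integrable (fun x => a x * f k x ^ 2) μ :=
      (integrable_mul_of_memLp (hf k) (hm (hf k))).congr (Eventually.of_forall fun x => by
        simp only; ring)
    have i3 := integrable_mul_of_memLp (hf k) (hm hf₀)
    have i4 := integrable_mul_of_memLp hf₀ (hm hf₀)
    simp only
    have i5 : Integrable (fun x => 2 * (f k x * (a x * f₀ x) - f₀ x * (a x * f₀ x))) μ :=
      (i3.sub i4).const_mul 2
    rw [← integral_sub i3 i4, ← integral_const_mul, ← integral_add i1 i5]
    refine integral_mono (i1.add i5) i2 fun x => ?_
    simp only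
    nlinarith [mul_nonneg (ha0 x) (sq_nonneg (f k x - f₀ x))]

lemma WeakTendsto.integral_sq_le (h : WeakTendsto μ f f₀) (hf : ∀ k, MemLp (f k) 2 μ)
    (hf₀ : MemLp f₀ 2 μ) {C : ℝ} (hC : ∀ k, ∫ x, f k x ^ 2 ∂μ ≤ C) : ∫ x, f₀ x ^ 2 ∂μ ≤ C := by
  obtain ⟨c, hc, hc'⟩ := h.exists_le_integral_mul_sq hf hf₀ (a := fun _ => 1)
    (memLp_top_const 1) fun _ => zero_le_one
  simp only [one_mul] at hc'
  have := hc.const_add (∫ x, f₀ x ^ 2 ∂μ)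
  rw [add_zero] at this
  exact le_of_tendsto' this fun k => (hc' k).trans (hC k)

end Abstract

/-- Weak derivatives are stable under weak convergence. -/
lemma WeakTendsto.isWeakPartial {Ω : Set (Space n)} {i : Fin n} {f g : ℕ → Space n → ℝ}
    {f₀ g₀ : Space n → ℝ} (hf : WeakTendsto (volume.restrict Ω) f f₀)
    (hg : WeakTendsto (volume.restrict Ω) g g₀) (hg₀ : MemLp g₀ 2 (volume.restrict Ω))
    (h : ∀ k, IsWeakPartial Ω i (f k) (g k)) : IsWeakPartial Ω i f₀ g₀ := by
  refine ⟨hg₀, fun η hη => ?_⟩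
  have h1 := hf _ (hη.memLp_partial 2 (EuclideanSpace.single i 1))
  have h2 := (hg _ (hη.memLp 2)).neg
  exact tendsto_nhds_unique h1 (h2.congr fun k => ((h k).integral_eq η hη).symm)

/-- Vanishing off `Ω` is stable under weak convergence: test with `f₀` restricted to `Ωᶜ`. -/
lemma WeakTendsto.vanishesOff {Ω : Set (Space n)} (hΩ : MeasurableSet Ω) {f : ℕ → Space n → ℝ}
    {f₀ : Space n → ℝ} (hf : WeakTendsto volume f f₀) (hf₀ : MemLp f₀ 2)
    (h : ∀ k, VanishesOff Ω (f k)) : VanishesOff Ω f₀ := by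
  have h1 := hf _ (hf₀.indicator hΩ.compl)
  have h2 : ∀ k, ∫ x, f k x * Ωᶜ.indicator f₀ x = 0 := fun k => by
    rw [← integral_zero (Space n) ℝ]
    refine integral_congr_ae ?_
    filter_upwards [h k] with x hx
    by_cases hxΩ : x ∈ Ω
    · simp [hxΩ]
    · simp [hx hxΩ]
  simp_rw [h2] at h1
  have h3 := tendsto_nhds_unique h1 tendsto_const_nhds
  have e : ∀ x, f₀ x * Ωᶜ.indicator f₀ x = Ωᶜ.indicator f₀ x ^ 2 := fun x => by
    by_cases hxΩ : x ∈ Ω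
    · simp [hxΩ]
    · simp [hxΩ, sq]
  simp_rw [e] at h3
  rw [integral_eq_zero_iff_of_nonneg (fun x => sq_nonneg _)
    (hf₀.indicator hΩ.compl).integrable_sq] at h3
  filter_upwards [h3] with x hx hxΩ
  simpa [hxΩ] using hx

/-- Smooth cut-off functions for compact subsets of open sets. -/
lemma exists_isTestFunction_eq_one {Ω K : Set (Space n)} (hΩ : IsOpen Ω) (hK : IsCompact K)
    (hKΩ : K ⊆ Ω) : ∃ η : Space n → ℝ, IsTestFunction Ω η ∧ ∀ x ∈ K, η x = 1 := by
  obtain ⟨K', hK', h1, h2⟩ := exists_compact_between hK hΩ hKΩ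
  obtain ⟨η, h3, h4, -⟩ := exists_contMDiffMap_one_nhds_of_subset_interior (n := (⊤ : ℕ∞))
    (modelWithCornersSelf ℝ (Space n)) hK.isClosed h1
  have hs : tsupport η ⊆ K' := closure_minimal (fun x hx => by
    by_contra h; exact hx (h4 x h)) hK'.isClosed
  exact ⟨η, ⟨η.contMDiff.contDiff, hK'.of_isClosed_subset (isClosed_tsupport _) hs, hs.trans h2⟩,
    fun x hx => h3.self_of_nhdsSet x hx⟩

/-- Interior compactness: a sequence converging weakly in `W^{1,2}(Ω)` converges in measure, with
no regularity of `∂Ω` required. -/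
lemma tendstoInMeasure_of_weakTendsto {Ω : Set (Space n)} (hΩ : IsOpen Ω)
    (hb : Bornology.IsBounded Ω) {f : ℕ → Space n → ℝ} {g : ℕ → Fin n → Space n → ℝ}
    {f₀ : Space n → ℝ} {g₀ : Fin n → Space n → ℝ}
    (hf : ∀ k, MemLp (f k) 2 (volume.restrict Ω)) (hf₀ : MemLp f₀ 2 (volume.restrict Ω))
    (hfg : ∀ k i, IsWeakPartial Ω i (f k) (g k i)) (hfg₀ : ∀ i, IsWeakPartial Ω i f₀ (g₀ i))
    {C : ℝ} (hfC : ∀ k, ∫ x in Ω, f k x ^ 2 ≤ C) (hgC : ∀ k i, ∫ x in Ω, g k i x ^ 2 ≤ C)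
    (hfC₀ : ∫ x in Ω, f₀ x ^ 2 ≤ C) (hgC₀ : ∀ i, ∫ x in Ω, g₀ i x ^ 2 ≤ C)
    (hw : WeakTendsto (volume.restrict Ω) f f₀) :
    TendstoInMeasure (volume.restrict Ω) f atTop f₀ := by
  -- strong convergence on compact subsets, by Rellich's theorem for `η (f k - f₀)`
  have hloc : ∀ η : Space n → ℝ, IsTestFunction Ω η →
      Tendsto (fun k => ∫ x, (η x * (f k x - f₀ x)) ^ 2) atTop (𝓝 0) := by
    intro η hη
    obtain ⟨A, hA⟩ := hη.smooth.continuous.bounded_above_of_compact_support hη.compact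
    have hB : ∃ B, ∀ i x, ‖fderiv ℝ η x (EuclideanSpace.single i 1)‖ ≤ B := by
      choose B hB using fun i => (hη.continuous_partial
        (EuclideanSpace.single i 1)).bounded_above_of_compact_support (hη.compact_partial _)
      exact ⟨∑ i, |B i|, fun i x => (hB i x).trans ((le_abs_self _).trans
        (Finset.single_le_sum (f := fun i => |B i|) (fun j _ => abs_nonneg _)
          (Finset.mem_univ i)))⟩
    obtain ⟨B, hB⟩ := hB
    have hA2 : ∀ x, η x ^ 2 ≤ A ^ 2 := fun x => by
      rw [← sq_abs]; exact pow_le_pow_left₀ (abs_nonneg _) (hA x) 2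
    have hB2 : ∀ i x, fderiv ℝ η x (EuclideanSpace.single i 1) ^ 2 ≤ B ^ 2 := fun i x => by
      rw [← sq_abs]; exact pow_le_pow_left₀ (abs_nonneg _) (hB i x) 2
    have hd : ∀ k i, IsWeakPartial Ω i (fun x => f k x - f₀ x) (fun x => g k i x - g₀ i x) :=
      fun k i => (hfg k i).sub (hfg₀ i) (hf k) hf₀
    have hdm : ∀ k, MemLp (fun x => f k x - f₀ x) 2 (volume.restrict Ω) :=
      fun k => (hf k).sub hf₀
    have hgm : ∀ k i, MemLp (fun x => g k i x - g₀ i x) 2 (volume.restrict Ω) :=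
      fun k i => (hd k i).memLp
    have hp : ∀ k i, IsWeakPartial univ i (fun x => η x * (f k x - f₀ x))
        (fun x => η x * (g k i x - g₀ i x) +
          fderiv ℝ η x (EuclideanSpace.single i 1) * (f k x - f₀ x)) :=
      fun k i => (hd k i).mul_test hΩ.measurableSet (hdm k) hη
    have hmΩ : ∀ {u : Space n → ℝ}, MemLp u 2 (volume.restrict Ω) →
        MemLp (fun x => η x * u x) 2 (volume.restrict Ω) := fun hu => hu.mul' (hη.memLp ∞)
    have hv1 : ∀ k, VanishesOff Ω (fun x => η x * (f k x - f₀ x)) := fun k =>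
      Eventually.of_forall fun x hx => by simp [hη.eq_zero hx]
    have hv2 : ∀ k i, VanishesOff Ω (fun x => η x * (g k i x - g₀ i x) +
          fderiv ℝ η x (EuclideanSpace.single i 1) * (f k x - f₀ x)) := fun k i =>
      Eventually.of_forall fun x hx => by simp [hη.eq_zero hx, hη.fderiv_eq_zero hx]
    have hm1 : ∀ k, MemLp (fun x => η x * (f k x - f₀ x)) 2 := by
      intro k
      have := hmΩ (hdm k)
      rw [← memLp_indicator_iff_restrict hΩ.measurableSet] at this
      refine this.ae_eq (Eventually.of_forall fun x => ?_)
      by_cases hx : x ∈ Ω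
      · simp [hx]
      · simp [hx, hη.eq_zero hx]
    refine tendsto_integral_sq_of_weakTendsto_zero hb hm1 hp hv1 hv2
      (K := 2 * (A ^ 2 * (4 * C)) + 2 * (B ^ 2 * (4 * C))) ?_ ?_ ?_
    · intro k
      have hC0 : 0 ≤ C := (integral_nonneg fun x => sq_nonneg _).trans (hfC 0)
      rw [← (hv1 k).setIntegral_sq_eq]
      calc ∫ x in Ω, (η x * (f k x - f₀ x)) ^ 2 ≤ ∫ x in Ω, A ^ 2 * (f k x - f₀ x) ^ 2 := by
            refine integral_mono (hmΩ (hdm k)).integrable_sq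
              ((hdm k).integrable_sq.const_mul _) fun x => ?_
            simp only [mul_pow]
            exact mul_le_mul_of_nonneg_right (hA2 x) (sq_nonneg _)
        _ ≤ A ^ 2 * (4 * C) := by
            rw [integral_const_mul]
            exact mul_le_mul_of_nonneg_left (integral_sub_sq_le (hf k) hf₀ (hfC k) hfC₀) (sq_nonneg _)
        _ ≤ _ := by nlinarith [mul_nonneg (sq_nonneg A) hC0, mul_nonneg (sq_nonneg B) hC0]
    · intro k i
      rw [← (hv2 k i).setIntegral_sq_eq]
      have i1 : IntegrableOn (fun x => 2 * (A ^ 2 * (g k i x - g₀ i x) ^ 2)) Ω :=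
        ((hgm k i).integrable_sq.const_mul _).const_mul _
      have i2 : IntegrableOn (fun x => 2 * (B ^ 2 * (f k x - f₀ x) ^ 2)) Ω :=
        ((hdm k).integrable_sq.const_mul _).const_mul _
      calc ∫ x in Ω, (η x * (g k i x - g₀ i x) +
              fderiv ℝ η x (EuclideanSpace.single i 1) * (f k x - f₀ x)) ^ 2
          ≤ ∫ x in Ω, (2 * (A ^ 2 * (g k i x - g₀ i x) ^ 2) +
              2 * (B ^ 2 * (f k x - f₀ x) ^ 2)) := by
            refine integral_mono (((hp k i).memLp.mono_measure
              (Measure.restrict_mono (subset_univ Ω) le_rfl)).integrable_sq) (i1.add i2) fun x => ?_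
            simp only
            have h1 := mul_le_mul_of_nonneg_right (hA2 x) (sq_nonneg (g k i x - g₀ i x))
            have h2 := mul_le_mul_of_nonneg_right (hB2 i x) (sq_nonneg (f k x - f₀ x))
            nlinarith [sq_nonneg (η x * (g k i x - g₀ i x) -
              fderiv ℝ η x (EuclideanSpace.single i 1) * (f k x - f₀ x))]
        _ = 2 * (A ^ 2 * ∫ x in Ω, (g k i x - g₀ i x) ^ 2) +
              2 * (B ^ 2 * ∫ x in Ω, (f k x - f₀ x) ^ 2) := by
            rw [integral_add i1 i2]
            simp only [integral_const_mul]
        _ ≤ _ := by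
            have h1 := integral_sub_sq_le (hfg k i).memLp (hfg₀ i).memLp (hgC k i) (hgC₀ i)
            have h2 := integral_sub_sq_le (hf k) hf₀ (hfC k) hfC₀
            have h3 := mul_le_mul_of_nonneg_left h1 (sq_nonneg A)
            have h4 := mul_le_mul_of_nonneg_left h2 (sq_nonneg B)
            linarith
    · intro φ hφ
      have h1 := hw.sub_limit hf hf₀ (fun x => η x * φ x)
        ((hφ.mono_measure Measure.restrict_le_self).mul' (hη.memLp ∞))
      simp only [Pi.zero_apply, zero_mul, integral_zero] at h1 ⊢
      refine h1.congr fun k => ?_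
      rw [← setIntegral_eq_integral_of_forall_compl_eq_zero (s := Ω) (μ := volume)
        (fun x hx => by simp [hη.eq_zero hx])]
      exact integral_congr_ae (Eventually.of_forall fun x => by simp only; ring)
  -- Chebyshev's inequality on a compact set `K ⊆ Ω` whose complement in `Ω` has small measure
  rw [tendstoInMeasure_iff_norm]
  intro ε hε
  rw [ENNReal.tendsto_nhds_zero]
  intro δ hδ
  rcases eq_or_ne δ ⊤ with rfl | hδt
  · simp
  obtain ⟨K, hKΩ, hK, hKδ⟩ := hΩ.measurableSet.exists_isCompact_sdiff_lt
    (hb.measure_lt_top (μ := volume)).ne (ENNReal.half_pos hδ.ne').ne'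
  obtain ⟨η, hη, hη1⟩ := exists_isTestFunction_eq_one hΩ hK hKΩ
  have hev : ∀ᶠ k in atTop, ∫ x, (η x * (f k x - f₀ x)) ^ 2 < ε ^ 2 * (δ / 2).toReal :=
    (hloc η hη).eventually (gt_mem_nhds (mul_pos (by positivity)
      (ENNReal.toReal_pos (ENNReal.half_pos hδ.ne').ne' (by finiteness))))
  filter_upwards [hev] with k hk
  have hint : IntegrableOn (fun x => (η x * (f k x - f₀ x)) ^ 2) Ω :=
    (MemLp.mul' ((hf k).sub hf₀) (hη.memLp ∞)).integrable_sq
  have hset : {x | ε ≤ ‖f k x - f₀ x‖} ⊆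
      {x | ε ^ 2 ≤ (η x * (f k x - f₀ x)) ^ 2} ∪ Kᶜ := by
    intro x hx
    by_cases hxK : x ∈ K
    · left
      simp only [mem_ofPred_eq, hη1 x hxK, one_mul]
      rw [← sq_abs (f k x - f₀ x)]
      exact pow_le_pow_left₀ hε.le hx 2
    · exact Or.inr hxK
  have hch : volume.restrict Ω {x | ε ^ 2 ≤ (η x * (f k x - f₀ x)) ^ 2} ≤ δ / 2 := by
    have h1 := mul_meas_ge_le_integral_of_nonneg (μ := volume.restrict Ω)
      (Eventually.of_forall fun x => sq_nonneg (η x * (f k x - f₀ x))) hint (ε ^ 2)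
    have h2 : ∫ x in Ω, (η x * (f k x - f₀ x)) ^ 2 = ∫ x, (η x * (f k x - f₀ x)) ^ 2 :=
      setIntegral_eq_integral_of_forall_compl_eq_zero (fun x hx => by simp [hη.eq_zero hx])
    have h3 : ε ^ 2 * (volume.restrict Ω).real {x | ε ^ 2 ≤ (η x * (f k x - f₀ x)) ^ 2} ≤
        ε ^ 2 * (δ / 2).toReal := (h1.trans_eq h2).trans hk.le
    have h4 := le_of_mul_le_mul_left h3 (by positivity)
    have hfin : volume.restrict Ω {x | ε ^ 2 ≤ (η x * (f k x - f₀ x)) ^ 2} ≠ ⊤ :=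
      ((measure_mono (subset_univ _)).trans_lt (by
        rw [Measure.restrict_apply_univ]; exact hb.measure_lt_top)).ne
    exact (ENNReal.toReal_le_toReal hfin (by finiteness)).1 h4
  calc volume.restrict Ω {x | ε ≤ ‖f k x - f₀ x‖}
      ≤ volume.restrict Ω {x | ε ^ 2 ≤ (η x * (f k x - f₀ x)) ^ 2} + volume.restrict Ω Kᶜ :=
        (measure_mono hset).trans (measure_union_le _ _)
    _ ≤ δ / 2 + δ / 2 := by
        refine add_le_add hch ?_
        rw [Measure.restrict_apply hK.measurableSet.compl, inter_comm, ← Set.sdiff_eq]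
        exact hKδ.le
    _ = δ := ENNReal.add_halves δ

/-! ### Minimizers of the connectedness functional -/

section Cutoff

variable {l L : ℝ} {V : ℝ → ℝ}

/-- By continuity, the cut-off function also vanishes for `|s| = λ̄⁻¹ (1 - λ)`. -/
lemma IsCutoff.eq_zero_of_le (hV : IsCutoff l L V) {s : ℝ} (hs : L⁻¹ * (1 - l) ≤ |s|) :
    V s = 0 := by
  have hb : 0 < L⁻¹ * (1 - l) := mul_pos (inv_pos.2 hV.L_pos) (by linarith [hV.l_lt_one])
  have hcl : IsClosed {s | V s = 0} := isClosed_eq hV.smooth.continuous continuous_const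
  rcases le_or_gt 0 s with h0 | h0
  · rw [abs_of_nonneg h0] at hs
    have : closure (Ioi (L⁻¹ * (1 - l))) ⊆ {s | V s = 0} :=
      closure_minimal (fun t ht => hV.eq_zero t ((mem_Ioi.1 ht).trans_le (le_abs_self t))) hcl
    rw [closure_Ioi] at this
    exact this hs
  · rw [abs_of_neg h0] at hs
    have : closure (Iio (-(L⁻¹ * (1 - l)))) ⊆ {s | V s = 0} :=
      closure_minimal (fun t ht => hV.eq_zero t
        ((lt_neg_of_lt_neg (mem_Iio.1 ht)).trans_le (neg_le_abs t))) hcl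
    rw [closure_Iio] at this
    exact this (le_neg_of_le_neg hs)

lemma IsCutoff.mem_Icc (hV : IsCutoff l L V) (s : ℝ) : V s ∈ Icc (0 : ℝ) 1 := by
  have ha : 0 < 1 - l := by linarith [hV.l_lt_one]
  have hab : 1 - l ≤ L⁻¹ * (1 - l) :=
    le_mul_of_one_le_left ha.le ((one_le_inv₀ hV.L_pos).2 hV.L_lt_one.le)
  rcases le_or_gt |s| (1 - l) with h1 | h1
  · rw [hV.eq_one s h1]; simp
  rcases le_or_gt (L⁻¹ * (1 - l)) |s| with h2 | h2
  · rw [hV.eq_zero_of_le h2]; simp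
  rcases le_or_gt 0 s with h0 | h0
  · rw [abs_of_nonneg h0] at h1 h2
    have e1 := hV.antitone_right ⟨le_rfl, hab⟩ ⟨h1.le, h2.le⟩ h1.le
    have e2 := hV.antitone_right ⟨h1.le, h2.le⟩ ⟨hab, le_rfl⟩ h2.le
    rw [hV.eq_one (1 - l) (by rw [abs_of_pos ha])] at e1
    rw [hV.eq_zero_of_le (le_abs_self _)] at e2
    exact ⟨e2, e1⟩
  · rw [abs_of_neg h0] at h1 h2
    have hm : s ∈ Icc (-(L⁻¹ * (1 - l))) (-(1 - l)) := ⟨by linarith, by linarith⟩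
    have e1 := hV.monotone_left hm ⟨by linarith, le_rfl⟩ hm.2
    have e2 := hV.monotone_left ⟨le_rfl, by linarith⟩ hm hm.1
    rw [hV.eq_one (-(1 - l)) (by rw [abs_neg, abs_of_pos ha])] at e1
    rw [hV.eq_zero_of_le (by rw [abs_neg]; exact le_abs_self _)] at e2
    exact ⟨e2, e1⟩

lemma IsCutoff.weight_mem_Icc (hV : IsCutoff l L V) {c : ℝ} (hc : 0 ≤ c) (ε s : ℝ) :
    c * V s + ε ∈ Icc ε (c + ε) := by
  have h := hV.mem_Icc s
  exact ⟨by nlinarith [h.1], by nlinarith [h.2]⟩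

end Cutoff

lemma doubleWell_nonneg (r : ℝ) : 0 ≤ doubleWell r := by unfold doubleWell; positivity

lemma continuous_doubleWell : Continuous doubleWell := by unfold doubleWell; fun_prop

lemma sq_le_doubleWell_add_two (r : ℝ) : r ^ 2 ≤ doubleWell r + 2 := by
  unfold doubleWell; nlinarith [sq_nonneg (r ^ 2 - 3)]

/-- A nonnegative function with finite integral in `[0, ∞]` is integrable. -/
lemma integrable_and_integral_le_of_lintegral_le {α : Type*} [MeasurableSpace α] {μ : Measure α}
    {F : α → ℝ} (hF : AEStronglyMeasurable F μ) (h0 : ∀ x, 0 ≤ F x) {M : ℝ≥0∞} (hM : M ≠ ⊤)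
    (h : ∫⁻ x, ENNReal.ofReal (F x) ∂μ ≤ M) : Integrable F μ ∧ ∫ x, F x ∂μ ≤ M.toReal := by
  have hi : Integrable F μ := by
    rw [← lintegral_ofReal_ne_top_iff_integrable hF (Eventually.of_forall h0)]
    exact ne_top_of_le_ne_top hM h
  refine ⟨hi, ?_⟩
  rw [integral_eq_lintegral_of_nonneg_ae (Eventually.of_forall h0) hF]
  exact ENNReal.toReal_mono hM h

section Conn

variable {Ω : Set (Space n)} {l L : ℝ} {V : ℝ → ℝ} {ε : ℝ} {u : Space n → ℝ}

lemma IsCutoff.aestronglyMeasurable_weight (hV : IsCutoff l L V)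
    (hu : AEStronglyMeasurable u (volume.restrict Ω)) (a c e : ℝ) :
    AEStronglyMeasurable (fun x => c * V (a * u x) + e) (volume.restrict Ω) :=
  (continuous_const.mul (hV.smooth.continuous.comp (continuous_const.mul continuous_id))
    |>.add continuous_const).comp_aestronglyMeasurable hu

/-- A bound on the connectedness functional of `φ` yields integral bounds for `W(φ)` and `∇φ`. -/
lemma bounds_of_connFunctional_le (hV : IsCutoff l L V) (hε : 0 < ε)
    {φ : Space n → ℝ} (hφ : MemW12 Ω φ) {M : ℝ≥0∞} (hM : M ≠ ⊤)
    (h : connFunctional Ω L V ε u φ ≤ M) :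
    Integrable (fun x => doubleWell (φ x)) (volume.restrict Ω) ∧
      ∫ x in Ω, doubleWell (φ x) ≤ M.toReal / ε ∧
      ∀ i, ∫ x in Ω, weakGrad Ω φ x i ^ 2 ≤ M.toReal / ε := by
  have hG := hφ.isWeakGrad.memLp
  have h2 : ∫⁻ x in Ω, ENNReal.ofReal (ε * doubleWell (φ x)) ≤ M := by
    refine (lintegral_mono fun x => ENNReal.ofReal_le_ofReal ?_).trans
      ((le_add_left le_rfl).trans ((le_add_right le_rfl).trans h))
    exact mul_le_mul_of_nonneg_right (hV.weight_mem_Icc (by positivity) ε _).1 (doubleWell_nonneg _)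
  have h3 : ∫⁻ x in Ω, ENNReal.ofReal (ε * ‖weakGrad Ω φ x‖ ^ 2) ≤ M := by
    refine (lintegral_mono fun x => ENNReal.ofReal_le_ofReal ?_).trans ((le_add_left le_rfl).trans h)
    exact mul_le_mul_of_nonneg_right (hV.weight_mem_Icc (by positivity) ε _).1 (sq_nonneg _)
  obtain ⟨i2, b2⟩ := integrable_and_integral_le_of_lintegral_le
    ((continuous_doubleWell.comp_aestronglyMeasurable hφ.1.1).const_mul ε)
    (fun x => mul_nonneg hε.le (doubleWell_nonneg _)) hM h2
  obtain ⟨i3, b3⟩ := integrable_and_integral_le_of_lintegral_le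
    ((hG.1.norm.pow 2).const_mul ε)
    (fun x => mul_nonneg hε.le (sq_nonneg _)) hM h3
  rw [integral_const_mul] at b2 b3
  refine ⟨?_, by rw [le_div_iff₀ hε, mul_comm]; exact b2, fun i => ?_⟩
  · have := i2.const_mul ε⁻¹
    simpa [← mul_assoc, inv_mul_cancel₀ hε.ne'] using this
  · have hle : ∫ x in Ω, weakGrad Ω φ x i ^ 2 ≤ ∫ x in Ω, ‖weakGrad Ω φ x‖ ^ 2 := by
      refine integral_mono (memLp_euclidean_iff.1 hG i).integrable_sq hG.norm.integrable_sq
        fun x => ?_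
      rw [← sq_abs]
      exact pow_le_pow_left₀ (abs_nonneg _) (PiLp.norm_apply_le (weakGrad Ω φ x) i) 2
    rw [le_div_iff₀ hε, mul_comm]
    exact (mul_le_mul_of_nonneg_left hle hε.le).trans b3

lemma memW12_zero : MemW12 Ω (fun _ => (0 : ℝ)) :=
  memW12_iff.2 ⟨MemLp.zero, fun _ _ => 0, fun _ => IsWeakPartial.const 0⟩

/-- The value at `φ = 0` bounds the infimum of the connectedness functional, uniformly in `u`. -/
lemma connFunctional_zero_le (hΩ : IsOpen Ω) (hV : IsCutoff l L V) (hε : 0 < ε)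
    (u : Space n → ℝ) : connFunctional Ω L V ε u (fun _ => 0) ≤
      ENNReal.ofReal ((9 / ε ^ (3 / 2 : ℝ) + ε) / 4) * volume Ω := by
  have hg : ∀ᵐ x ∂volume.restrict Ω, ∀ i, weakGrad Ω (fun _ => (0 : ℝ)) x i = 0 :=
    weakGrad_ae_eq hΩ (g := fun _ _ => 0) fun i => IsWeakPartial.const 0
  have h3 : ∫⁻ x in Ω, ENNReal.ofReal ((8 / ε ^ (3 / 2 : ℝ) * V (L * u x) + ε) *
      ‖weakGrad Ω (fun _ => (0 : ℝ)) x‖ ^ 2) = 0 := by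
    rw [← lintegral_zero (μ := volume.restrict Ω)]
    refine lintegral_congr_ae ?_
    filter_upwards [hg] with x hx
    have : weakGrad Ω (fun _ => (0 : ℝ)) x = 0 := by ext i; simpa using hx i
    simp [this]
  unfold connFunctional
  rw [h3]
  simp only [mul_zero, integral_zero, abs_zero, ENNReal.ofReal_zero, zero_add, add_zero]
  calc _ ≤ ∫⁻ _ in Ω, ENNReal.ofReal ((9 / ε ^ (3 / 2 : ℝ) + ε) / 4) := by
        refine lintegral_mono fun x => ENNReal.ofReal_le_ofReal ?_
        have := (hV.weight_mem_Icc (c := 9 / ε ^ (3 / 2 : ℝ)) (by positivity) ε (L * u x)).2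
        simp only [doubleWell]
        linarith
    _ = _ := by simp

/-- Existence of a minimizer of the connectedness functional: minimizing sequences are bounded in
`W^{1,2}(Ω)`, and a weak limit is a minimizer since the linear term is weakly continuous, the
weighted double well term passes to the limit by Fatou's lemma along an almost everywhere convergent
subsequence, and the weighted gradient term is weakly lower semicontinuous. -/
theorem exists_minimizer_connFunctional (hΩ : IsOpen Ω) (hb : Bornology.IsBounded Ω)
    (hV : IsCutoff l L V) (hε : 0 < ε) (hu : MemLp u 2 (volume.restrict Ω)) :
    ∃ φ : Space n → ℝ, MemW12 Ω φ ∧ connFunctional Ω L V ε u φ < ⊤ ∧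
      ∀ ψ : Space n → ℝ, MemW12 Ω ψ →
        connFunctional Ω L V ε u φ ≤ connFunctional Ω L V ε u ψ := by
  have hfin : IsFiniteMeasure (volume.restrict Ω) := ⟨by simpa using hb.measure_lt_top⟩
  set A := connFunctional Ω L V ε u
  set m : ℝ≥0∞ := ⨅ (φ : Space n → ℝ) (_ : MemW12 Ω φ), A φ with hm
  have hle : ∀ ψ, MemW12 Ω ψ → m ≤ A ψ := fun ψ hψ => iInf₂_le ψ hψ
  have hmt : m < ⊤ := (hle _ memW12_zero).trans_lt ((connFunctional_zero_le hΩ hV hε u).trans_lt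
    (ENNReal.mul_lt_top ENNReal.ofReal_lt_top hb.measure_lt_top))
  have hseq : ∀ k : ℕ, ∃ φ, MemW12 Ω φ ∧ A φ < m + (k + 1 : ℝ≥0∞)⁻¹ := by
    intro k
    have h1 : m < m + (k + 1 : ℝ≥0∞)⁻¹ := ENNReal.lt_add_right hmt.ne (by simp)
    rw [hm, iInf_lt_iff] at h1
    obtain ⟨φ, hφ⟩ := h1
    rw [iInf_lt_iff] at hφ
    obtain ⟨h2, h3⟩ := hφ
    exact ⟨φ, h2, h3⟩
  choose φ hφ hφm using hseq
  have hM : m + 1 ≠ ⊤ := by finiteness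
  have hφM : ∀ k, A (φ k) ≤ m + 1 := fun k => (hφm k).le.trans (by
    gcongr
    exact ENNReal.inv_le_one.2 (by simp))
  have hbd := fun k => bounds_of_connFunctional_le hV hε (hφ k) hM (hφM k)
  set B : ℝ := (m + 1).toReal / ε with hB
  set C : ℝ := B + 2 * (volume.restrict Ω).real univ with hC
  have hBC : B ≤ C := by
    have : 0 ≤ (volume.restrict Ω).real univ := measureReal_nonneg
    linarith
  have hφC : ∀ k, ∫ x in Ω, φ k x ^ 2 ≤ C := by
    intro k
    calc ∫ x in Ω, φ k x ^ 2 ≤ ∫ x in Ω, (doubleWell (φ k x) + 2) :=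
          integral_mono (hφ k).1.integrable_sq ((hbd k).1.add (integrable_const _))
            fun x => sq_le_doubleWell_add_two _
      _ = (∫ x in Ω, doubleWell (φ k x)) + 2 * (volume.restrict Ω).real univ := by
          rw [integral_add (hbd k).1 (integrable_const _), integral_const, smul_eq_mul]
          ring
      _ ≤ C := by linarith [(hbd k).2.1]
  have hgC : ∀ k i, ∫ x in Ω, weakGrad Ω (φ k) x i ^ 2 ≤ C :=
    fun k i => ((hbd k).2.2 i).trans hBC
  have hwg : ∀ k i, IsWeakPartial Ω i (φ k) (fun x => weakGrad Ω (φ k) x i) :=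
    fun k => isWeakGrad_iff.1 (hφ k).isWeakGrad
  -- a weakly convergent subsequence of the functions together with their gradients
  obtain ⟨F₀, s, hs, hF₀, hw⟩ := exists_weakTendsto_subseq (μ := volume.restrict Ω)
    (F := fun k (o : Option (Fin n)) => o.elim (φ k) fun i x => weakGrad Ω (φ k) x i) (C := C)
    (by rintro k (_ | i); exacts [(hφ k).1, (hwg k i).memLp])
    (by rintro k (_ | i); exacts [hφC k, hgC k i])
  set φ₀ := F₀ none with hφ₀
  have hw0 : WeakTendsto (volume.restrict Ω) (fun k => φ (s k)) φ₀ := hw none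
  have hw1 : ∀ i, WeakTendsto (volume.restrict Ω) (fun k x => weakGrad Ω (φ (s k)) x i)
    (F₀ (some i)) := fun i => hw (some i)
  have hp : ∀ i, IsWeakPartial Ω i φ₀ (F₀ (some i)) := fun i =>
    hw0.isWeakPartial (hw1 i) (hF₀ (some i)) fun k => hwg (s k) i
  have hφ₀W : MemW12 Ω φ₀ := memW12_iff.2 ⟨hF₀ none, _, hp⟩
  have hmeas := tendstoInMeasure_of_weakTendsto hΩ hb (fun k => (hφ (s k)).1) (hF₀ none)
    (fun k => hwg (s k)) hp (fun k => hφC (s k)) (fun k => hgC (s k))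
    (hw0.integral_sq_le (fun k => (hφ (s k)).1) (hF₀ none) fun k => hφC (s k))
    (fun i => (hw1 i).integral_sq_le (fun k => (hwg (s k) i).memLp) (hF₀ (some i))
      fun k => hgC (s k) i) hw0
  -- an almost everywhere convergent subsequence
  obtain ⟨t, ht, hae⟩ := hmeas.exists_seq_tendsto_ae
  set w₁ : Space n → ℝ := fun x => 9 / ε ^ (3 / 2 : ℝ) * V (L * u x) + ε with hw₁
  set w₂ : Space n → ℝ := fun x => 8 / ε ^ (3 / 2 : ℝ) * V (L * u x) + ε with hw₂
  have hw₁m : AEStronglyMeasurable w₁ (volume.restrict Ω) :=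
    hV.aestronglyMeasurable_weight hu.1 _ _ _
  have hw₂m : AEStronglyMeasurable w₂ (volume.restrict Ω) :=
    hV.aestronglyMeasurable_weight hu.1 _ _ _
  have hw₁b : ∀ x, w₁ x ∈ Icc ε (9 / ε ^ (3 / 2 : ℝ) + ε) := fun x =>
    hV.weight_mem_Icc (by positivity) ε _
  have hw₂b : ∀ x, w₂ x ∈ Icc ε (8 / ε ^ (3 / 2 : ℝ) + ε) := fun x =>
    hV.weight_mem_Icc (by positivity) ε _
  have hw₂L : MemLp w₂ ⊤ (volume.restrict Ω) :=
    MemLp.of_bound hw₂m _ (Eventually.of_forall fun x => by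
      rw [Real.norm_of_nonneg (hε.le.trans (hw₂b x).1)]; exact (hw₂b x).2)
  -- a subsequence along which the double well terms converge
  set T₂ : (Space n → ℝ) → ℝ≥0∞ := fun ψ => ∫⁻ x in Ω, ENNReal.ofReal (w₁ x * doubleWell (ψ x))
  obtain ⟨τ, r, hr, hτ⟩ := CompactSpace.tendsto_subseq fun k => T₂ (φ (s (t k)))
  set q : ℕ → ℕ := fun k => t (r k) with hq
  have hqm : StrictMono q := ht.comp hr
  have hT₂ : T₂ φ₀ ≤ τ := by
    have hm2 : ∀ ψ : Space n → ℝ, AEStronglyMeasurable ψ (volume.restrict Ω) →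
        AEMeasurable (fun x => ENNReal.ofReal (w₁ x * doubleWell (ψ x))) (volume.restrict Ω) :=
      fun ψ hψ => (hw₁m.mul
        (continuous_doubleWell.comp_aestronglyMeasurable hψ)).aemeasurable.ennreal_ofReal
    calc T₂ φ₀ = ∫⁻ x in Ω, liminf (fun k =>
          ENNReal.ofReal (w₁ x * doubleWell (φ (s (q k)) x))) atTop := by
          refine lintegral_congr_ae ?_
          filter_upwards [hae] with x hx
          refine (Tendsto.liminf_eq ?_).symm
          exact (ENNReal.continuous_ofReal.tendsto _).comp
            (((continuous_doubleWell.tendsto _).comp (hx.comp hr.tendsto_atTop)).const_mul _)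
      _ ≤ liminf (fun k => T₂ (φ (s (q k)))) atTop :=
          lintegral_liminf_le' fun k => hm2 _ (hφ _).1.1
      _ = τ := hτ.liminf_eq
  -- the gradient term
  set I : ℕ → ℝ := fun k => ∑ i, ∫ x in Ω, w₂ x * weakGrad Ω (φ (s (q k))) x i ^ 2
  set I₀ : ℝ := ∑ i, ∫ x in Ω, w₂ x * F₀ (some i) x ^ 2
  have hT₃ : ∀ {ψ : Space n → ℝ} {g : Fin n → Space n → ℝ}, (∀ i, IsWeakPartial Ω i ψ (g i)) →
      ∫⁻ x in Ω, ENNReal.ofReal (w₂ x * ‖weakGrad Ω ψ x‖ ^ 2) =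
        ENNReal.ofReal (∑ i, ∫ x in Ω, w₂ x * g i x ^ 2) := by
    intro ψ g hg
    have hi : ∀ i, Integrable (fun x => w₂ x * g i x ^ 2) (volume.restrict Ω) := fun i =>
      (hg i).memLp.integrable_sq.bdd_mul hw₂m (Eventually.of_forall fun x => by
        rw [Real.norm_of_nonneg (hε.le.trans (hw₂b x).1)]; exact (hw₂b x).2)
    rw [← integral_finsetSum _ fun i _ => hi i,
      ofReal_integral_eq_lintegral_ofReal (integrable_finsetSum _ fun i _ => hi i)
        (Eventually.of_forall fun x => Finset.sum_nonneg fun i _ =>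
          mul_nonneg (hε.le.trans (hw₂b x).1) (sq_nonneg _))]
    refine lintegral_congr_ae ?_
    filter_upwards [weakGrad_ae_eq hΩ hg] with x hx
    rw [norm_sq_eq_sum, Finset.mul_sum]
    simp_rw [hx]
  choose c hc hc' using fun i => ((hw1 i).comp_strictMono hqm).exists_le_integral_mul_sq
    (fun k => (hwg (s (q k)) i).memLp) (hF₀ (some i)) hw₂L (fun x => hε.le.trans (hw₂b x).1)
  have hI : ∀ k, I₀ + ∑ i, c i k ≤ I k := fun k => by
    rw [← Finset.sum_add_distrib]
    exact Finset.sum_le_sum fun i _ => hc' i k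
  have hcI : Tendsto (fun k => ENNReal.ofReal (I₀ + ∑ i, c i k)) atTop (𝓝 (ENNReal.ofReal I₀)) := by
    refine (ENNReal.continuous_ofReal.tendsto _).comp ?_
    have := (tendsto_finsetSum Finset.univ fun i _ => hc i).const_add I₀
    simpa using this
  -- the linear term
  have hVu : MemLp (fun x => 1 / ε * V (u x)) 2 (volume.restrict Ω) := by
    refine MemLp.of_bound ((continuous_const.mul
      hV.smooth.continuous).comp_aestronglyMeasurable hu.1) (1 / ε)
      (Eventually.of_forall fun x => ?_)
    have := hV.mem_Icc (u x)
    rw [Real.norm_of_nonneg (mul_nonneg (by positivity) this.1)]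
    exact mul_le_of_le_one_right (by positivity) this.2
  have hT₁ : Tendsto (fun k => ENNReal.ofReal |∫ x in Ω, 1 / ε * V (u x) * φ (s (q k)) x|) atTop
      (𝓝 (ENNReal.ofReal |∫ x in Ω, 1 / ε * V (u x) * φ₀ x|)) := by
    refine (ENNReal.continuous_ofReal.tendsto _).comp (Tendsto.abs ?_)
    have := hw0.comp_strictMono hqm _ hVu
    simpa only [mul_comm] using this
  have hlim := (hT₁.add hτ).add hcI
  have hup : Tendsto (fun k => m + (s (q k) + 1 : ℝ≥0∞)⁻¹) atTop (𝓝 (m + 0)) := by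
    refine Tendsto.const_add m ?_
    have h1 : Tendsto (fun k : ℕ => ((k + 1 : ℕ) : ℝ≥0∞)⁻¹) atTop (𝓝 0) :=
      ENNReal.tendsto_inv_nat_nhds_zero.comp (tendsto_add_atTop_nat 1)
    have h2 := h1.comp (hs.comp hqm).tendsto_atTop
    simpa [Function.comp_def] using h2
  have hfinal : A φ₀ ≤ m := by
    have h1 : A φ₀ ≤ ENNReal.ofReal |∫ x in Ω, 1 / ε * V (u x) * φ₀ x| + τ +
        ENNReal.ofReal I₀ := by
      refine add_le_add (add_le_add le_rfl hT₂) (hT₃ hp).le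
    refine h1.trans ?_
    rw [← add_zero m]
    refine le_of_tendsto_of_tendsto' hlim hup fun k => ?_
    refine le_trans ?_ (hφm (s (q k))).le
    refine add_le_add le_rfl ?_
    exact (ENNReal.ofReal_le_ofReal (hI k)).trans (hT₃ (hwg (s (q k)))).ge
  exact ⟨φ₀, hφ₀W, hfinal.trans_lt hmt, fun ψ hψ => hfinal.trans (hle ψ hψ)⟩

end Conn

/-! ### Confined phase fields and coercivity of the total energy -/

/-- A smooth boundary is a null set. Locally it is a level set `{f = 0}` with `df(x) ≠ 0`; for `v`
with `df(x) v = 1` the map `F y = y - x + (f y - df(x) (y - x)) v` has derivative `id` at `x`, so it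
distorts volumes by a factor close to `1`, and it sends the level set into the kernel of `df(x)`. -/
lemma HasSmoothBoundary.volume_frontier_eq_zero {Ω : Set (Space n)} (hΩ : IsOpen Ω)
    (h : HasSmoothBoundary Ω) : volume (frontier Ω) = 0 := by
  refine measure_null_of_locally_null _ fun x hx => ?_
  obtain ⟨U, hU, hxU, f, hf, hfx, hΩU⟩ := h x hx
  obtain ⟨v, hv⟩ : ∃ v, fderiv ℝ f x v = 1 := by
    obtain ⟨w, hw⟩ : ∃ w, fderiv ℝ f x w ≠ 0 := by
      by_contra! hc
      exact hfx (ContinuousLinearMap.ext hc)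
    exact ⟨(fderiv ℝ f x w)⁻¹ • w, by simp [hw]⟩
  have hzero : ∀ y ∈ frontier Ω, y ∈ U → f y = 0 := by
    intro y hy hyU
    refine le_antisymm ?_ ?_
    · have hcont : ContinuousWithinAt f (Ω ∩ U) y :=
        (hf.continuousOn y hyU).mono inter_subset_right
      have hcl : y ∈ closure (Ω ∩ U) := by
        rw [mem_closure_iff_nhds]
        intro N hN
        obtain ⟨z, hz, hzΩ⟩ := mem_closure_iff_nhds.1 (frontier_subset_closure hy) (N ∩ U)
          (inter_mem hN (hU.mem_nhds hyU))
        exact ⟨z, hz.1, hzΩ, hz.2⟩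
      refine ContinuousWithinAt.closure_le hcl hcont (continuousWithinAt_const (b := (0 : ℝ)))
        fun z hz => ?_
      rw [hΩU] at hz
      exact hz.2.le
    · by_contra! hlt
      have : y ∈ Ω ∩ U := by rw [hΩU]; exact ⟨hyU, hlt⟩
      rw [hΩ.frontier_eq] at hy
      exact hy.2 this.1
  have hstrict : HasStrictFDerivAt f (fderiv ℝ f x) x :=
    (hf.contDiffAt (hU.mem_nhds hxU)).hasStrictFDerivAt (by simp)
  set F : Space n → Space n := fun y => (y - x) + (f y - fderiv ℝ f x (y - x)) • v with hF
  have hFs : HasStrictFDerivAt F (ContinuousLinearMap.id ℝ (Space n)) x := by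
    have h1 : HasStrictFDerivAt (fun y : Space n => y - x) (ContinuousLinearMap.id ℝ (Space n)) x :=
      (hasStrictFDerivAt_id x).sub_const x
    have h2 := h1.add ((hstrict.sub ((fderiv ℝ f x).hasStrictFDerivAt.comp x h1)).smul_const v)
    exact h2.congr_fderiv (by ext y; simp)
  -- near `x`, the map `F` shrinks volumes at most by the factor `1 / 2`
  have hdet : ((1 / 2 : NNReal) : ℝ≥0∞) <
      ENNReal.ofReal |(ContinuousLinearMap.id ℝ (Space n)).det| := by
    rw [ContinuousLinearMap.det]
    simp
  obtain ⟨δ, hδ, hδ0⟩ := ((mul_le_addHaar_image_of_lt_det volume _ hdet).and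
    self_mem_nhdsWithin).exists
  obtain ⟨s, hs, hsF⟩ := hFs.approximates_deriv_on_nhds (c := δ) (Or.inr hδ0)
  refine ⟨s ∩ U ∩ frontier Ω, inter_comm (frontier Ω) (s ∩ U) ▸
    inter_mem_nhdsWithin _ (inter_mem hs (hU.mem_nhds hxU)), ?_⟩
  have hle := hδ _ F (hsF.mono_set (inter_subset_left.trans inter_subset_left :
    s ∩ U ∩ frontier Ω ⊆ s))
  have hker : F '' (s ∩ U ∩ frontier Ω) ⊆ (LinearMap.ker (fderiv ℝ f x).toLinearMap :
      Submodule ℝ (Space n)) := by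
    rintro _ ⟨y, ⟨⟨-, hyU⟩, hy⟩, rfl⟩
    simp [hF, hzero y hy hyU, hv]
  have hnull : volume ((LinearMap.ker (fderiv ℝ f x).toLinearMap : Submodule ℝ (Space n)) :
      Set (Space n)) = 0 := by
    refine Measure.addHaar_submodule _ _ fun htop => ?_
    rw [LinearMap.ker_eq_top] at htop
    exact hfx (ContinuousLinearMap.coe_injective htop)
  have h0 := hle.trans ((measure_mono hker).trans_eq hnull)
  simpa using h0

/-- A weak derivative of `f` in `ℝⁿ` vanishes wherever `f` does, up to null sets: it vanishes in the
open complement of the closure of `Ω`, and `∂Ω` is a null set. -/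
lemma IsWeakPartial.vanishesOff {Ω : Set (Space n)} (hfr : volume (frontier Ω) = 0)
    (hΩ : IsOpen Ω) {i : Fin n} {f g : Space n → ℝ} (h : IsWeakPartial univ i f g)
    (hf : VanishesOff Ω f) : VanishesOff Ω g := by
  have hO : IsOpen (closure Ω)ᶜ := isClosed_closure.isOpen_compl
  have hf0 : f =ᵐ[volume.restrict (closure Ω)ᶜ] fun _ => 0 := by
    rw [Filter.EventuallyEq, ae_restrict_iff' hO.measurableSet]
    filter_upwards [hf] with x hx hx' using hx fun hxΩ => hx' (subset_closure hxΩ)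
  have h1 := IsWeakPartial.unique hO
    ((h.mono (subset_univ _) MeasurableSet.univ).congr hf0 (EventuallyEq.refl _ _))
    (IsWeakPartial.const 0)
  rw [Filter.EventuallyEq, ae_restrict_iff' hO.measurableSet] at h1
  have h2 : ∀ᵐ x, x ∉ frontier Ω := measure_eq_zero_iff_ae_notMem.1 hfr
  filter_upwards [h1, h2] with x hx1 hx2 hx
  refine hx1 fun hcl => hx2 ?_
  rw [hΩ.frontier_eq]
  exact ⟨hcl, hx⟩

/-- For a confined phase field `u`, all derivatives of `u + 1` up to order two vanish off `Ω`. -/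
lemma IsConfined.exists_isSupportedJet {Ω : Set (Space n)} (hfr : volume (frontier Ω) = 0)
    (hΩ : IsOpen Ω) {u : Space n → ℝ} (hu : IsConfined Ω u) :
    ∃ g h, IsSupportedJet Ω (fun x => u x + 1) g h := by
  obtain ⟨g, h, H⟩ := hu.memW22_add_one.exists_isJet
  have h0 : VanishesOff Ω (fun x => u x + 1) :=
    Eventually.of_forall fun x hx => by simp [hu.eq_neg_one x hx]
  have h1 : ∀ i, VanishesOff Ω (g i) := fun i => (H.fst i).vanishesOff hfr hΩ h0
  exact ⟨g, h, H, h0, h1, fun i j => (H.snd i j).vanishesOff hfr hΩ (h1 i)⟩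

lemma IsSupportedJet.isJet_sub_one {Ω : Set (Space n)} (hb : Bornology.IsBounded Ω)
    {u : Space n → ℝ} {g : Fin n → Space n → ℝ} {h : Fin n → Fin n → Space n → ℝ}
    (H : IsSupportedJet Ω (fun x => u x + 1) g h) : IsJet Ω u g h := by
  have : IsFiniteMeasure (volume.restrict Ω) := ⟨by simpa using hb.measure_lt_top⟩
  simpa using (H.toIsJet.mono (subset_univ Ω) MeasurableSet.univ).sub_const 1

/-- A supported jet of a function `f` gives rise to the confined phase field `f - 1`, after `f` has
been redefined to be exactly `0` outside `Ω`. -/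
lemma IsSupportedJet.exists_isConfined {Ω : Set (Space n)} (hΩ : IsOpen Ω)
    (hb : Bornology.IsBounded Ω) {f : Space n → ℝ} {g : Fin n → Space n → ℝ}
    {h : Fin n → Fin n → Space n → ℝ} (H : IsSupportedJet Ω f g h) :
    ∃ u, IsConfined Ω u ∧ IsSupportedJet Ω (fun x => u x + 1) g h ∧ ∀ᵐ x, u x + 1 = f x := by
  have hae : ∀ᵐ x, f x = Ω.indicator f x - 1 + 1 := by
    filter_upwards [H.vanishes] with x hx
    by_cases hxΩ : x ∈ Ω
    · simp [hxΩ]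
    · simp [hxΩ, hx hxΩ]
  have hae' : f =ᵐ[volume.restrict univ] fun x => Ω.indicator f x - 1 + 1 := by
    rw [Measure.restrict_univ]; exact hae
  have hJ : IsSupportedJet Ω (fun x => Ω.indicator f x - 1 + 1) g h := by
    refine ⟨⟨?_, fun i => ?_, H.snd⟩, ?_, H.vanishes_fst, H.vanishes_snd⟩
    · exact H.memLp.ae_eq hae'
    · exact (H.fst i).congr hae' (EventuallyEq.refl _ _)
    · exact Eventually.of_forall fun x hx => by simp [hx]
  refine ⟨fun x => Ω.indicator f x - 1, ⟨?_, fun x hx => by simp [hx], ?_⟩, hJ, ?_⟩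
  · exact (hJ.isJet_sub_one hb).memW22 hΩ
  · exact hJ.toIsJet.memW22 isOpen_univ
  · filter_upwards [hae] with x hx using hx.symm

lemma c₀_pos : 0 < c₀ := by
  refine intervalIntegral.intervalIntegral_pos_of_pos_on ?_ (fun x hx => ?_) (by norm_num)
  · refine Continuous.intervalIntegrable ?_ _ _
    exact (continuous_const.mul continuous_doubleWell).sqrt
  · refine Real.sqrt_pos.2 (mul_pos two_pos ?_)
    have : 0 < 1 - x ^ 2 := by nlinarith [hx.1, hx.2]
    unfold doubleWell
    positivity

lemma deriv_doubleWell (r : ℝ) : deriv doubleWell r = r ^ 3 - r := by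
  have h : HasDerivAt doubleWell (2 * (1 - r ^ 2) * (-(2 * r)) / 4) r := by
    have h1 : HasDerivAt (fun r : ℝ => 1 - r ^ 2) (-(2 * r)) r := by
      simpa using (hasDerivAt_pow 2 r).const_sub 1
    exact ((h1.pow 2).div_const 4).congr_deriv (by simp)
  rw [h.deriv]
  ring

lemma sq_deriv_doubleWell (r : ℝ) : (r ^ 3 - r) ^ 2 = 4 * r ^ 2 * doubleWell r := by
  unfold doubleWell; ring

section Energies

variable {Ω : Set (Space n)} {u : Space n → ℝ} {g : Fin n → Space n → ℝ}
  {h : Fin n → Fin n → Space n → ℝ}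

lemma IsJet.diffuseArea_eq (hΩ : IsOpen Ω) (H : IsJet Ω u g h) (ε : ℝ) :
    diffuseArea Ω ε u = 1 / c₀ * ∫ x in Ω, (ε / 2 * (∑ i, g i x ^ 2) + 1 / ε * doubleWell (u x)) := by
  unfold diffuseArea
  congr 1
  refine integral_congr_ae ?_
  filter_upwards [weakGrad_ae_eq hΩ H.fst] with x hx
  rw [norm_sq_eq_sum]
  simp_rw [hx]

lemma IsJet.diffuseWillmore_eq (hΩ : IsOpen Ω) (H : IsJet Ω u g h) (ε : ℝ) :
    diffuseWillmore Ω ε u =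
      1 / c₀ * ∫ x in Ω, 1 / ε * (ε * (∑ i, h i i x) - 1 / ε * (u x ^ 3 - u x)) ^ 2 := by
  unfold diffuseWillmore
  congr 1
  refine integral_congr_ae ?_
  filter_upwards [H.weakLaplacian_ae_eq hΩ] with x hx
  rw [hx, deriv_doubleWell]

lemma diffuseWillmore_nonneg {ε : ℝ} (hε : 0 < ε) : 0 ≤ diffuseWillmore Ω ε u :=
  mul_nonneg (one_div_nonneg.2 c₀_pos.le) (integral_nonneg fun x => by positivity)

lemma totalEnergy_nonneg {L S σ ε : ℝ} {V : ℝ → ℝ} (hε : 0 < ε) :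
    0 ≤ totalEnergy Ω L V S σ ε u := by
  have := diffuseWillmore_nonneg (Ω := Ω) (u := u) hε
  unfold totalEnergy
  positivity

end Energies

/-- A phase field in the class of the jet is essentially bounded, by Sobolev embedding. -/
lemma IsSupportedJet.exists_ae_abs_le (hn : n ≤ 3) {Ω : Set (Space n)} (hb : Bornology.IsBounded Ω)
    {f : Space n → ℝ} {g : Fin n → Space n → ℝ} {h : Fin n → Fin n → Space n → ℝ}
    (H : IsSupportedJet Ω f g h) : ∃ B : ℝ, 0 ≤ B ∧ ∀ᵐ x, |f x| ≤ B := by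
  obtain ⟨C, -, hC⟩ := exists_sq_le_of_isSupportedJet (n := n) hn one_pos
  refine ⟨√(C * (∫ x, f x ^ 2) + 1 * ∫ x, (∑ i, h i i x) ^ 2), Real.sqrt_nonneg _, ?_⟩
  filter_upwards [hC Ω f g h hb H] with x hx
  exact Real.abs_le_sqrt hx

lemma memLp_top_of_continuous_comp {Ω : Set (Space n)} {u : Space n → ℝ}
    (hu : AEStronglyMeasurable u (volume.restrict Ω)) {B : ℝ}
    (hB : ∀ᵐ x ∂volume.restrict Ω, |u x| ≤ B) {φ : ℝ → ℝ} (hφ : Continuous φ) :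
    MemLp (fun x => φ (u x)) ⊤ (volume.restrict Ω) := by
  obtain ⟨A, hA⟩ := (isCompact_Icc (a := -B) (b := B)).exists_bound_of_continuousOn hφ.continuousOn
  refine memLp_top_of_bound (C := A) (hφ.comp_aestronglyMeasurable hu) ?_
  filter_upwards [hB] with x hx
  exact hA _ (abs_le.1 hx)

/-- Bounded phase fields have integrable double well potential. -/
lemma IsJet.integrable_doubleWell {Ω : Set (Space n)} (hb : Bornology.IsBounded Ω)
    {u : Space n → ℝ} {g : Fin n → Space n → ℝ} {h : Fin n → Fin n → Space n → ℝ}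
    (H : IsJet Ω u g h) {B : ℝ} (hB : ∀ᵐ x ∂volume.restrict Ω, |u x| ≤ B) :
    Integrable (fun x => doubleWell (u x)) (volume.restrict Ω) := by
  have hfin : IsFiniteMeasure (volume.restrict Ω) := ⟨by simpa using hb.measure_lt_top⟩
  exact (memLp_top_of_continuous_comp H.memLp.1 hB continuous_doubleWell).integrable le_top

lemma IsSupportedJet.ae_restrict_abs_le {Ω : Set (Space n)} {u : Space n → ℝ} {B : ℝ}
    (hB : ∀ᵐ x, |u x + 1| ≤ B) : ∀ᵐ x ∂volume.restrict Ω, |u x| ≤ B + 1 := by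
  filter_upwards [ae_restrict_of_ae hB] with x hx
  calc |u x| = |(u x + 1) - 1| := by ring_nf
    _ ≤ |u x + 1| + |1| := abs_sub _ _
    _ ≤ B + 1 := by simpa using hx

/-- The diffuse Willmore energy controls the Laplacian up to the lower order term, which is treated
by means of the identity `W'(u)² = 4 u² W(u)`. -/
lemma IsSupportedJet.integral_lap_sq_le {Ω : Set (Space n)} (hΩ : IsOpen Ω)
    (hb : Bornology.IsBounded Ω) {ε : ℝ} (hε : 0 < ε) {u : Space n → ℝ}
    {g : Fin n → Space n → ℝ} {h : Fin n → Fin n → Space n → ℝ}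
    (H : IsSupportedJet Ω (fun x => u x + 1) g h) {B : ℝ}
    (hu1 : ∀ᵐ x ∂volume.restrict Ω, |u x| ≤ B)
    {Q : ℝ} (hQ : ∀ᵐ x ∂volume.restrict Ω, u x ^ 2 ≤ Q) :
    ε ^ 2 * ∫ x, (∑ i, h i i x) ^ 2 ≤ 2 * (ε * (c₀ * diffuseWillmore Ω ε u)) +
      8 * Q / ε ^ 2 * ∫ x in Ω, doubleWell (u x) := by
  have hfin : IsFiniteMeasure (volume.restrict Ω) := ⟨by simpa using hb.measure_lt_top⟩
  have HJ := H.isJet_sub_one hb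
  have hWi := HJ.integrable_doubleWell hb hu1
  have hlapΩ : MemLp (fun x => ∑ i, h i i x) 2 (volume.restrict Ω) :=
    H.memLp_lap.mono_measure Measure.restrict_le_self
  have hW'L : MemLp (fun x => u x ^ 3 - u x) 2 (volume.restrict Ω) :=
    (memLp_top_of_continuous_comp HJ.memLp.1 hu1 (φ := fun r => r ^ 3 - r)
      (by fun_prop)).mono_exponent le_top
  set R : Space n → ℝ := fun x => ε * (∑ i, h i i x) - 1 / ε * (u x ^ 3 - u x) with hR
  have hRi : Integrable (fun x => R x ^ 2) (volume.restrict Ω) :=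
    ((hlapΩ.const_mul ε).sub (hW'L.const_mul (1 / ε))).integrable_sq
  have hRe : ∫ x in Ω, R x ^ 2 = ε * (c₀ * diffuseWillmore Ω ε u) := by
    rw [HJ.diffuseWillmore_eq hΩ, integral_const_mul, ← mul_assoc c₀, mul_one_div_cancel c₀_pos.ne',
      one_mul, ← mul_assoc, mul_one_div_cancel hε.ne', one_mul]
  have hpt : ∀ᵐ x ∂volume.restrict Ω, ε ^ 2 * (∑ i, h i i x) ^ 2 ≤
      2 * R x ^ 2 + 8 * Q / ε ^ 2 * doubleWell (u x) := by
    filter_upwards [hQ] with x hx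
    have h1 : (1 / ε * (u x ^ 3 - u x)) ^ 2 * 2 ≤ 8 * Q / ε ^ 2 * doubleWell (u x) := by
      have e : (1 / ε * (u x ^ 3 - u x)) ^ 2 * 2 = 8 / ε ^ 2 * (u x ^ 2 * doubleWell (u x)) := by
        rw [mul_pow, sq_deriv_doubleWell]
        ring
      have e' : 8 * Q / ε ^ 2 * doubleWell (u x) = 8 / ε ^ 2 * (Q * doubleWell (u x)) := by
        ring
      rw [e, e']
      exact mul_le_mul_of_nonneg_left
        (mul_le_mul_of_nonneg_right hx (doubleWell_nonneg _)) (by positivity)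
    have h2 : ε ^ 2 * (∑ i, h i i x) ^ 2 = (R x + 1 / ε * (u x ^ 3 - u x)) ^ 2 := by
      rw [hR]; ring
    rw [h2]
    nlinarith [sq_nonneg (R x - 1 / ε * (u x ^ 3 - u x))]
  calc ε ^ 2 * ∫ x, (∑ i, h i i x) ^ 2 = ∫ x in Ω, ε ^ 2 * (∑ i, h i i x) ^ 2 := by
        rw [integral_const_mul, H.vanishes_lap.setIntegral_sq_eq]
    _ ≤ ∫ x in Ω, (2 * R x ^ 2 + 8 * Q / ε ^ 2 * doubleWell (u x)) :=
        integral_mono_ae (hlapΩ.integrable_sq.const_mul _)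
          ((hRi.const_mul 2).add (hWi.const_mul _)) hpt
    _ = 2 * (∫ x in Ω, R x ^ 2) + 8 * Q / ε ^ 2 * ∫ x in Ω, doubleWell (u x) := by
        rw [integral_add (hRi.const_mul 2) (hWi.const_mul _), integral_const_mul,
          integral_const_mul]
    _ = _ := by rw [hRe]

/-- Coercivity of the total energy: it controls the `H²(ℝⁿ)` norm of `u + 1`. The nonlinearity is
absorbed by means of `W'(u)² = 4 u² W(u)` and the Sobolev embedding with small constant. -/
lemma exists_bound_of_totalEnergy_le (hn : n ≤ 3) {Ω : Set (Space n)} (hΩ : IsOpen Ω)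
    (hb : Bornology.IsBounded Ω) {L S σ ε : ℝ} {V : ℝ → ℝ} (hε : 0 < ε) (hS : 0 < S) {E : ℝ}
    (hE : 0 ≤ E) :
    ∃ K : ℝ, 0 ≤ K ∧ ∀ (u : Space n → ℝ) (g : Fin n → Space n → ℝ)
      (h : Fin n → Fin n → Space n → ℝ), IsSupportedJet Ω (fun x => u x + 1) g h →
      totalEnergy Ω L V S σ ε u ≤ E →
      ∫ x, (u x + 1) ^ 2 ≤ K ∧ (∀ i, ∫ x, g i x ^ 2 ≤ K) ∧ ∀ i j, ∫ x, h i j x ^ 2 ≤ K := by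
  have hfin : IsFiniteMeasure (volume.restrict Ω) := ⟨by simpa using hb.measure_lt_top⟩
  have hc := c₀_pos
  set vol : ℝ := (volume.restrict Ω).real univ with hvol
  have hvol0 : 0 ≤ vol := measureReal_nonneg
  -- `s` bounds the unnormalized diffuse area
  set s : ℝ := c₀ * (S + 1 + ε ^ (1 - σ) * E) with hs
  have hs0 : 0 < s := by positivity
  set K₁ : ℝ := 2 * (ε * s) + 6 * vol with hK₁
  have hK₁0 : 0 ≤ K₁ := by positivity
  -- `δ` is chosen such that `16 δ s / ε = ε² / 2`
  obtain ⟨C, hC0, hC⟩ := exists_sq_le_of_isSupportedJet (n := n) hn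
    (δ := ε ^ 3 / (32 * s)) (by positivity)
  set K₂ : ℝ := 2 / ε ^ 2 * (2 * ε * (c₀ * E) + 16 * (C * K₁ + 1) * s / ε) with hK₂
  have hK₂0 : 0 ≤ K₂ := by positivity
  refine ⟨K₁ + 2 * s / ε + K₂, by positivity, fun u g h H hEu => ?_⟩
  have HJ := H.isJet_sub_one hb
  obtain ⟨B, hB0, hB⟩ := H.exists_ae_abs_le hn hb
  have hu1 := IsSupportedJet.ae_restrict_abs_le (Ω := Ω) hB
  have hWi := HJ.integrable_doubleWell hb hu1
  have hgi : ∀ i, Integrable (fun x => g i x ^ 2) (volume.restrict Ω) := fun i =>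
    (HJ.fst i).memLp.integrable_sq
  -- consequences of the energy bound
  have hWill : diffuseWillmore Ω ε u ≤ E := by
    refine le_trans ?_ hEu
    unfold totalEnergy
    have h1 : 0 ≤ 1 / ε ^ (1 - σ) * (diffuseArea Ω ε u - S) ^ 2 := by positivity
    have h2 : 0 ≤ 1 / ε ^ (1 / 2 - σ / 2) *
      (connInf Ω L V ε u - ∫ x in Ω, 1 / ε * V (u x)) ^ 2 := by positivity
    linarith
  have hArea : ∫ x in Ω, (ε / 2 * (∑ i, g i x ^ 2) + 1 / ε * doubleWell (u x)) ≤ s := by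
    have h1 : 1 / ε ^ (1 - σ) * (diffuseArea Ω ε u - S) ^ 2 ≤ E := by
      refine le_trans ?_ hEu
      unfold totalEnergy
      have h1 := diffuseWillmore_nonneg (Ω := Ω) (u := u) hε
      have h2 : 0 ≤ 1 / ε ^ (1 / 2 - σ / 2) *
        (connInf Ω L V ε u - ∫ x in Ω, 1 / ε * V (u x)) ^ 2 := by positivity
      linarith
    rw [one_div, inv_mul_le_iff₀ (by positivity)] at h1
    have h2 : diffuseArea Ω ε u ≤ S + 1 + ε ^ (1 - σ) * E := by
      nlinarith [sq_nonneg (diffuseArea Ω ε u - S - 1)]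
    rw [HJ.diffuseArea_eq hΩ, one_div, inv_mul_le_iff₀ hc] at h2
    exact h2
  have hsum0 : 0 ≤ ∑ i, ∫ x in Ω, g i x ^ 2 :=
    Finset.sum_nonneg fun i _ => integral_nonneg fun x => sq_nonneg _
  have hW0 : 0 ≤ ∫ x in Ω, doubleWell (u x) := integral_nonneg fun x => doubleWell_nonneg _
  have hsplit : ε / 2 * (∑ i, ∫ x in Ω, g i x ^ 2) + 1 / ε * ∫ x in Ω, doubleWell (u x) ≤ s := by
    rw [integral_add ((integrable_finsetSum _ fun i _ => hgi i).const_mul _) (hWi.const_mul _),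
      integral_const_mul, integral_const_mul, integral_finsetSum _ fun i _ => hgi i] at hArea
    exact hArea
  have hWb : ∫ x in Ω, doubleWell (u x) ≤ ε * s := by
    have h1 : 1 / ε * ∫ x in Ω, doubleWell (u x) ≤ s := by
      have : 0 ≤ ε / 2 * ∑ i, ∫ x in Ω, g i x ^ 2 := by positivity
      linarith
    rwa [one_div, inv_mul_le_iff₀ hε] at h1
  have hgb : ∀ i, ∫ x, g i x ^ 2 ≤ 2 * s / ε := by
    intro i
    rw [← (H.vanishes_fst i).setIntegral_sq_eq]
    have h1 : ∫ x in Ω, g i x ^ 2 ≤ ∑ i, ∫ x in Ω, g i x ^ 2 :=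
      Finset.single_le_sum (f := fun i => ∫ x in Ω, g i x ^ 2)
        (fun i _ => integral_nonneg fun x => sq_nonneg _) (Finset.mem_univ i)
    have h2 : ε / 2 * ∑ i, ∫ x in Ω, g i x ^ 2 ≤ s := by
      have : 0 ≤ 1 / ε * ∫ x in Ω, doubleWell (u x) := by positivity
      linarith
    rw [le_div_iff₀ hε]
    nlinarith
  have hfb : ∫ x, (u x + 1) ^ 2 ≤ K₁ := by
    rw [← H.vanishes.setIntegral_sq_eq]
    calc ∫ x in Ω, (u x + 1) ^ 2 ≤ ∫ x in Ω, (2 * doubleWell (u x) + 6) := by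
          refine integral_mono (H.memLp_zero.integrable_sq.integrableOn)
            ((hWi.const_mul 2).add (integrable_const _)) fun x => ?_
          have := sq_le_doubleWell_add_two (u x)
          simp only
          nlinarith [sq_nonneg (u x - 1)]
      _ = 2 * (∫ x in Ω, doubleWell (u x)) + 6 * vol := by
          rw [integral_add (hWi.const_mul 2) (integrable_const _), integral_const_mul,
            integral_const, smul_eq_mul]
          ring
      _ ≤ K₁ := by linarith
  -- `Q` bounds `u²` by the Sobolev embedding and `u² ≤ 2 (u + 1)² + 2`
  set D : ℝ := ∫ x, (∑ i, h i i x) ^ 2 with hD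
  have hD0 : 0 ≤ D := integral_nonneg fun x => sq_nonneg _
  set Q : ℝ := 2 * (C * K₁ + ε ^ 3 / (32 * s) * D) + 2 with hQ
  have hQ0 : 0 ≤ Q := by positivity
  have hu2 : ∀ᵐ x ∂volume.restrict Ω, u x ^ 2 ≤ Q := by
    filter_upwards [ae_restrict_of_ae (hC Ω _ g h hb H)] with x hx
    have h1 : C * ∫ x, (u x + 1) ^ 2 ≤ C * K₁ := mul_le_mul_of_nonneg_left hfb hC0
    nlinarith [sq_nonneg (u x + 2)]
  have hDle : ε ^ 2 * D ≤ 2 * (ε * (c₀ * E)) + 8 * Q / ε ^ 2 * (ε * s) := by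
    refine (H.integral_lap_sq_le hΩ hb hε hu1 hu2).trans (add_le_add ?_ ?_)
    · gcongr
    · exact mul_le_mul_of_nonneg_left hWb (by positivity)
  -- the contribution of `D` to `Q` is half of the left-hand side of `hDle` and is absorbed
  have hDK : D ≤ K₂ := by
    have e : 8 * Q / ε ^ 2 * (ε * s) = 16 * (C * K₁ + 1) * s / ε + ε ^ 2 / 2 * D := by
      rw [hQ]
      field_simp
      ring
    rw [e] at hDle
    have h1 : ε ^ 2 / 2 * D ≤ 2 * ε * (c₀ * E) + 16 * (C * K₁ + 1) * s / ε := by linarith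
    rw [hK₂]
    have h2 := mul_le_mul_of_nonneg_left h1 (show 0 ≤ 2 / ε ^ 2 by positivity)
    have h3 : 2 / ε ^ 2 * (ε ^ 2 / 2 * D) = D := by field_simp
    linarith
  have h2s : 0 ≤ 2 * s / ε := by positivity
  refine ⟨by linarith, fun i => by linarith [hgb i], fun i j => ?_⟩
  have := H.integral_snd_sq_le hb i j
  linarith

/-! ### Continuity of the infimum of the connectedness functional -/

section Continuity

variable {Ω : Set (Space n)} {l L : ℝ} {V : ℝ → ℝ} {ε : ℝ}

lemma abs_le_two_add_doubleWell (r : ℝ) : |r| ≤ 2 + doubleWell r := by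
  have h1 := sq_le_doubleWell_add_two r
  have h2 := doubleWell_nonneg r
  rw [← sq_abs] at h1
  nlinarith [sq_nonneg (|r| - 1), sq_nonneg (|r| - 2), abs_nonneg r]

/-- Changing the weight `a ≥ ε` by at most `e` changes a weighted integral by a factor of at most
`1 + e / ε`. -/
lemma lintegral_weight_le {α : Type*} [MeasurableSpace α] {μ : Measure α} {a b F : α → ℝ}
    (hε : 0 < ε) (hb : ∀ x, ε ≤ b x) {e : ℝ} (he : 0 ≤ e) (hab : ∀ᵐ x ∂μ, a x ≤ b x + e)
    (hF : ∀ x, 0 ≤ F x) : ∫⁻ x, ENNReal.ofReal (a x * F x) ∂μ ≤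
      ENNReal.ofReal (1 + e / ε) * ∫⁻ x, ENNReal.ofReal (b x * F x) ∂μ := by
  rw [← lintegral_const_mul' _ _ ENNReal.ofReal_ne_top]
  refine lintegral_mono_ae ?_
  filter_upwards [hab] with x hx
  rw [← ENNReal.ofReal_mul (by positivity)]
  refine ENNReal.ofReal_le_ofReal ?_
  have h1 : e ≤ e / ε * b x := by
    rw [div_mul_eq_mul_div, le_div_iff₀ hε]
    exact mul_le_mul_of_nonneg_left (hb x) he
  calc a x * F x ≤ (b x + e / ε * b x) * F x :=
        mul_le_mul_of_nonneg_right (hx.trans (by linarith)) (hF x)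
    _ = _ := by ring

lemma integrable_cutoff_mul (hV : IsCutoff l L V) {u φ : Space n → ℝ}
    (hu : AEStronglyMeasurable u (volume.restrict Ω)) (hφ : Integrable φ (volume.restrict Ω)) :
    Integrable (fun x => 1 / ε * V (u x) * φ x) (volume.restrict Ω) := by
  refine hφ.bdd_mul (c := |1 / ε|)
    ((continuous_const.mul hV.smooth.continuous).comp_aestronglyMeasurable hu)
    (Eventually.of_forall fun x => ?_)
  have := hV.mem_Icc (u x)
  rw [norm_mul, Real.norm_eq_abs, Real.norm_of_nonneg this.1]
  exact mul_le_of_le_one_right (abs_nonneg _) this.2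

/-- The connectedness functionals of uniformly close phase fields are comparable, uniformly in
`φ`. -/
lemma connFunctional_le_of_ae_close (hb : Bornology.IsBounded Ω) (hV : IsCutoff l L V)
    (hε : 0 < ε) {K : ℝ} (hK0 : 0 ≤ K) (hK : ∀ s t, |V s - V t| ≤ K * |s - t|)
    {u u' : Space n → ℝ} (hu : MemLp u 2 (volume.restrict Ω))
    (hu' : MemLp u' 2 (volume.restrict Ω)) {d : ℝ} (hd : 0 ≤ d)
    (hud : ∀ᵐ x ∂volume.restrict Ω, |u x - u' x| ≤ d) {φ : Space n → ℝ} (hφ : MemW12 Ω φ) :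
    connFunctional Ω L V ε u φ ≤
      ENNReal.ofReal (1 + (K / ε ^ 2 + 9 / ε ^ (3 / 2 : ℝ) * K * L / ε) * d) *
        connFunctional Ω L V ε u' φ + ENNReal.ofReal (2 * (volume.real Ω) * K / ε * d) := by
  have hfin : IsFiniteMeasure (volume.restrict Ω) := ⟨by simpa using hb.measure_lt_top⟩
  have hL := hV.L_pos
  set T₁ := ENNReal.ofReal |∫ x in Ω, 1 / ε * V (u x) * φ x|
  set T₁' := ENNReal.ofReal |∫ x in Ω, 1 / ε * V (u' x) * φ x|
  set T₂ := ∫⁻ x in Ω, ENNReal.ofReal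
    ((9 / ε ^ (3 / 2 : ℝ) * V (L * u x) + ε) * doubleWell (φ x))
  set T₂' := ∫⁻ x in Ω, ENNReal.ofReal
    ((9 / ε ^ (3 / 2 : ℝ) * V (L * u' x) + ε) * doubleWell (φ x)) with hT₂'
  set T₃ := ∫⁻ x in Ω, ENNReal.ofReal
    ((8 / ε ^ (3 / 2 : ℝ) * V (L * u x) + ε) * ‖weakGrad Ω φ x‖ ^ 2)
  set T₃' := ∫⁻ x in Ω, ENNReal.ofReal
    ((8 / ε ^ (3 / 2 : ℝ) * V (L * u' x) + ε) * ‖weakGrad Ω φ x‖ ^ 2)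
  set e : ℝ := 9 / ε ^ (3 / 2 : ℝ) * K * L * d with he
  have he0 : 0 ≤ e := by positivity
  have hw : ∀ c : ℝ, 0 ≤ c → c ≤ 9 / ε ^ (3 / 2 : ℝ) → ∀ᵐ x ∂volume.restrict Ω,
      c * V (L * u x) + ε ≤ (c * V (L * u' x) + ε) + e := by
    intro c hc hc9
    filter_upwards [hud] with x hx
    have h1 : V (L * u x) - V (L * u' x) ≤ K * (L * d) := by
      refine (le_abs_self _).trans ((hK _ _).trans (mul_le_mul_of_nonneg_left ?_ hK0))
      rw [← mul_sub, abs_mul, abs_of_pos hL]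
      exact mul_le_mul_of_nonneg_left hx hL.le
    have h2 : c * (V (L * u x) - V (L * u' x)) ≤ e := by
      calc c * (V (L * u x) - V (L * u' x)) ≤ c * (K * (L * d)) :=
            mul_le_mul_of_nonneg_left h1 hc
        _ ≤ 9 / ε ^ (3 / 2 : ℝ) * (K * (L * d)) :=
            mul_le_mul_of_nonneg_right hc9 (by positivity)
        _ = e := by rw [he]; ring
    linarith
  -- the double well and gradient terms change by a factor close to `1`
  have h2 : T₂ ≤ ENNReal.ofReal (1 + e / ε) * T₂' :=
    lintegral_weight_le hε (fun x => (hV.weight_mem_Icc (by positivity) ε _).1) he0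
      (hw _ (by positivity) le_rfl) fun x => doubleWell_nonneg _
  have h3 : T₃ ≤ ENNReal.ofReal (1 + e / ε) * T₃' :=
    lintegral_weight_le hε (fun x => (hV.weight_mem_Icc (by positivity) ε _).1) he0
      (hw _ (by positivity) (by gcongr; norm_num)) fun x => sq_nonneg _
  have hφi : Integrable φ (volume.restrict Ω) := hφ.1.integrable (by norm_num)
  -- the linear term changes by a multiple of `‖φ‖₁`, which the double well term controls
  have hφ1 : ENNReal.ofReal (∫ x in Ω, |φ x|) ≤
      ENNReal.ofReal (2 * volume.real Ω) + ENNReal.ofReal (1 / ε) * T₂' := by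
    rw [ofReal_integral_eq_lintegral_ofReal hφi.abs (Eventually.of_forall fun x => abs_nonneg _)]
    have hW : ∫⁻ x in Ω, ENNReal.ofReal (doubleWell (φ x)) ≤ ENNReal.ofReal (1 / ε) * T₂' := by
      rw [hT₂', ← lintegral_const_mul' _ _ ENNReal.ofReal_ne_top]
      refine lintegral_mono fun x => ?_
      rw [← ENNReal.ofReal_mul (by positivity)]
      refine ENNReal.ofReal_le_ofReal ?_
      have hw1 := (hV.weight_mem_Icc (c := 9 / ε ^ (3 / 2 : ℝ)) (by positivity) ε (L * u' x)).1
      rw [← mul_assoc, one_div, inv_mul_eq_div]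
      exact le_mul_of_one_le_left (doubleWell_nonneg _) ((one_le_div hε).2 hw1)
    calc ∫⁻ x in Ω, ENNReal.ofReal |φ x|
        ≤ ∫⁻ x in Ω, (ENNReal.ofReal 2 + ENNReal.ofReal (doubleWell (φ x))) := by
          refine lintegral_mono fun x => ?_
          rw [← ENNReal.ofReal_add two_pos.le (doubleWell_nonneg _)]
          exact ENNReal.ofReal_le_ofReal (abs_le_two_add_doubleWell _)
      _ = ENNReal.ofReal (2 * volume.real Ω) +
            ∫⁻ x in Ω, ENNReal.ofReal (doubleWell (φ x)) := by
          rw [lintegral_add_left measurable_const, lintegral_const, Measure.restrict_apply_univ,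
            ENNReal.ofReal_mul two_pos.le, measureReal_def,
            ENNReal.ofReal_toReal hb.measure_lt_top.ne]
      _ ≤ _ := add_le_add le_rfl hW
  have h1 : T₁ ≤ T₁' + ENNReal.ofReal (K / ε * d) *
      (ENNReal.ofReal (2 * volume.real Ω) + ENNReal.ofReal (1 / ε) * T₂') := by
    refine le_trans ?_ (add_le_add le_rfl (mul_le_mul' le_rfl hφ1))
    rw [← ENNReal.ofReal_mul (by positivity), ← ENNReal.ofReal_add (abs_nonneg _)
      (mul_nonneg (by positivity) (integral_nonneg fun x => abs_nonneg _))]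
    refine ENNReal.ofReal_le_ofReal ?_
    have i1 := integrable_cutoff_mul (ε := ε) hV hu.1 hφi
    have i2 := integrable_cutoff_mul (ε := ε) hV hu'.1 hφi
    have hdiff : |(∫ x in Ω, 1 / ε * V (u x) * φ x) - ∫ x in Ω, 1 / ε * V (u' x) * φ x| ≤
        K / ε * d * ∫ x in Ω, |φ x| := by
      rw [← integral_sub i1 i2, ← integral_const_mul, ← Real.norm_eq_abs]
      refine (norm_integral_le_integral_norm _).trans
        (integral_mono_ae (i1.sub i2).norm (hφi.abs.const_mul _) ?_)
      filter_upwards [hud] with x hx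
      have h1 : |V (u x) - V (u' x)| ≤ K * d :=
        (hK _ _).trans (mul_le_mul_of_nonneg_left hx hK0)
      have e1 : 1 / ε * V (u x) * φ x - 1 / ε * V (u' x) * φ x =
          1 / ε * (V (u x) - V (u' x)) * φ x := by ring
      rw [e1, Real.norm_eq_abs, abs_mul, abs_mul, abs_of_pos (by positivity : 0 < 1 / ε)]
      calc 1 / ε * |V (u x) - V (u' x)| * |φ x| ≤ 1 / ε * (K * d) * |φ x| := by gcongr
        _ = K / ε * d * |φ x| := by ring
    have := abs_sub_abs_le_abs_sub (∫ x in Ω, 1 / ε * V (u x) * φ x)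
      (∫ x in Ω, 1 / ε * V (u' x) * φ x)
    linarith
  set κ : ℝ := K / ε ^ 2 + 9 / ε ^ (3 / 2 : ℝ) * K * L / ε with hκ
  have hκ1 : 1 + κ * d = (1 + e / ε) + K / ε * d * (1 / ε) := by
    rw [hκ, he]; field_simp; ring
  have ha : (1 : ℝ≥0∞) ≤ ENNReal.ofReal (1 + κ * d) := by
    rw [ENNReal.one_le_ofReal]
    have : 0 ≤ κ * d := by positivity
    linarith
  have hbn : ENNReal.ofReal (1 + e / ε) ≤ ENNReal.ofReal (1 + κ * d) := by
    refine ENNReal.ofReal_le_ofReal ?_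
    have : 0 ≤ K / ε * d * (1 / ε) := by positivity
    linarith
  calc connFunctional Ω L V ε u φ = T₁ + T₂ + T₃ := rfl
    _ ≤ (T₁' + ENNReal.ofReal (K / ε * d) *
          (ENNReal.ofReal (2 * volume.real Ω) + ENNReal.ofReal (1 / ε) * T₂')) +
          ENNReal.ofReal (1 + e / ε) * T₂' + ENNReal.ofReal (1 + e / ε) * T₃' := by gcongr
    _ = T₁' + ENNReal.ofReal (1 + κ * d) * T₂' + ENNReal.ofReal (1 + e / ε) * T₃' +
          ENNReal.ofReal (2 * volume.real Ω * K / ε * d) := by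
        rw [hκ1, ENNReal.ofReal_add (p := 1 + e / ε) (by positivity) (by positivity),
          ENNReal.ofReal_mul (p := K / ε * d) (by positivity),
          show 2 * volume.real Ω * K / ε * d = (K / ε * d) * (2 * volume.real Ω) by ring,
          ENNReal.ofReal_mul (p := K / ε * d) (by positivity)]
        ring
    _ ≤ ENNReal.ofReal (1 + κ * d) * T₁' + ENNReal.ofReal (1 + κ * d) * T₂' +
          ENNReal.ofReal (1 + κ * d) * T₃' + ENNReal.ofReal (2 * volume.real Ω * K / ε * d) := by
        gcongr
        exact le_mul_of_one_le_left' ha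
    _ = _ := by
        rw [← mul_add, ← mul_add]
        rfl

/-- The infimum of the connectedness functional is Lipschitz continuous with respect to uniform
convergence of the phase field. -/
lemma exists_abs_connInf_sub_le (hΩ : IsOpen Ω) (hb : Bornology.IsBounded Ω)
    (hV : IsCutoff l L V) (hε : 0 < ε) :
    ∃ κ : ℝ, 0 ≤ κ ∧ ∀ u u' : Space n → ℝ, MemLp u 2 (volume.restrict Ω) →
      MemLp u' 2 (volume.restrict Ω) → ∀ d : ℝ, 0 ≤ d →
      (∀ᵐ x ∂volume.restrict Ω, |u x - u' x| ≤ d) →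
      |connInf Ω L V ε u - connInf Ω L V ε u'| ≤ κ * d := by
  have hL := hV.L_pos
  obtain ⟨K, hK⟩ := hV.smooth.lipschitzWith_of_hasCompactSupport hV.compact (by simp)
  have hK' : ∀ s t, |V s - V t| ≤ K * |s - t| := fun s t => by
    simpa [Real.dist_eq] using hK.dist_le_mul s t
  set N : ℝ := (9 / ε ^ (3 / 2 : ℝ) + ε) / 4 * volume.real Ω with hN
  have hN0 : 0 ≤ N := by positivity
  set κ₁ : ℝ := K / ε ^ 2 + 9 / ε ^ (3 / 2 : ℝ) * K * L / ε with hκ₁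
  set κ₂ : ℝ := 2 * volume.real Ω * K / ε with hκ₂
  have hκ₁0 : 0 ≤ κ₁ := by positivity
  have hκ₂0 : 0 ≤ κ₂ := by positivity
  -- the infimum is attained, hence given by the value at a minimizer
  have hmin : ∀ u : Space n → ℝ, MemLp u 2 (volume.restrict Ω) → ∃ φ, MemW12 Ω φ ∧
      connFunctional Ω L V ε u φ ≠ ⊤ ∧
      connInf Ω L V ε u = (connFunctional Ω L V ε u φ).toReal := by
    intro u hu
    obtain ⟨φ, h1, h2, h3⟩ := exists_minimizer_connFunctional hΩ hb hV hε hu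
    refine ⟨φ, h1, h2.ne, ?_⟩
    rw [connInf]
    congr 1
    exact le_antisymm (iInf₂_le φ h1) (le_iInf₂ h3)
  have hle : ∀ (u φ : Space n → ℝ), MemW12 Ω φ → connFunctional Ω L V ε u φ ≠ ⊤ →
      connInf Ω L V ε u ≤ (connFunctional Ω L V ε u φ).toReal := fun u φ hφ ht =>
    ENNReal.toReal_mono ht (iInf₂_le φ hφ)
  have hup : ∀ u : Space n → ℝ, connInf Ω L V ε u ≤ N := by
    intro u
    have h0 := connFunctional_zero_le hΩ hV hε u
    have ht : ENNReal.ofReal ((9 / ε ^ (3 / 2 : ℝ) + ε) / 4) * volume Ω ≠ ⊤ :=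
      ENNReal.mul_ne_top ENNReal.ofReal_ne_top hb.measure_lt_top.ne
    refine (hle u _ memW12_zero (ne_top_of_le_ne_top ht h0)).trans
      ((ENNReal.toReal_mono ht h0).trans_eq ?_)
    rw [ENNReal.toReal_mul, ENNReal.toReal_ofReal (by positivity)]
    rfl
  have key : ∀ u u' : Space n → ℝ, MemLp u 2 (volume.restrict Ω) →
      MemLp u' 2 (volume.restrict Ω) → ∀ d : ℝ, 0 ≤ d →
      (∀ᵐ x ∂volume.restrict Ω, |u x - u' x| ≤ d) →
      connInf Ω L V ε u - connInf Ω L V ε u' ≤ (κ₁ * N + κ₂) * d := by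
    intro u u' hu hu' d hd hud
    obtain ⟨φ, hφ, hφt, hφe⟩ := hmin u' hu'
    have h1 := connFunctional_le_of_ae_close hb hV hε K.2 hK' hu hu' hd hud hφ
    have ht : ENNReal.ofReal (1 + κ₁ * d) * connFunctional Ω L V ε u' φ +
        ENNReal.ofReal (κ₂ * d) ≠ ⊤ :=
      ENNReal.add_ne_top.2 ⟨ENNReal.mul_ne_top ENNReal.ofReal_ne_top hφt, ENNReal.ofReal_ne_top⟩
    have h2 := (hle u φ hφ (ne_top_of_le_ne_top ht h1)).trans (ENNReal.toReal_mono ht h1)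
    rw [ENNReal.toReal_add (ENNReal.mul_ne_top ENNReal.ofReal_ne_top hφt) ENNReal.ofReal_ne_top,
      ENNReal.toReal_mul, ENNReal.toReal_ofReal (by positivity),
      ENNReal.toReal_ofReal (by positivity), ← hφe] at h2
    have h3 : κ₁ * d * connInf Ω L V ε u' ≤ κ₁ * d * N :=
      mul_le_mul_of_nonneg_left (hup u') (by positivity)
    linarith
  refine ⟨κ₁ * N + κ₂, by positivity, fun u u' hu hu' d hd hud => abs_sub_le_iff.2
    ⟨key u u' hu hu' d hd hud, key u' u hu' hu d hd ?_⟩⟩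
  filter_upwards [hud] with x hx
  rwa [abs_sub_comm]

end Continuity

/-! ### Lower semicontinuity and minimizers of the total energy -/

section TotalEnergy

variable {Ω : Set (Space n)}

lemma WeakTendsto.restrict (hΩ : MeasurableSet Ω) {f : ℕ → Space n → ℝ} {f₀ : Space n → ℝ}
    (h : WeakTendsto volume f f₀) : WeakTendsto (volume.restrict Ω) f f₀ := by
  intro φ hφ
  have h1 := h _ ((memLp_indicator_iff_restrict hΩ).2 hφ)
  have e : ∀ F : Space n → ℝ, ∫ x, F x * Ω.indicator φ x = ∫ x in Ω, F x * φ x := fun F => by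
    rw [← integral_indicator hΩ]
    congr 1
    ext x
    by_cases hx : x ∈ Ω <;> simp [hx]
  simpa only [e] using h1

/-- Strong convergence in `L²` implies convergence of the norms. -/
lemma WeakTendsto.tendsto_integral_sq {α : Type*} [MeasurableSpace α] {μ : Measure α}
    {f : ℕ → α → ℝ} {f₀ : α → ℝ} (h : WeakTendsto μ f f₀) (hf : ∀ k, MemLp (f k) 2 μ)
    (hf₀ : MemLp f₀ 2 μ) (hs : Tendsto (fun k => ∫ x, (f k x - f₀ x) ^ 2 ∂μ) atTop (𝓝 0)) :
    Tendsto (fun k => ∫ x, f k x ^ 2 ∂μ) atTop (𝓝 (∫ x, f₀ x ^ 2 ∂μ)) := by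
  have h1 := (hs.add ((h f₀ hf₀).const_mul 2)).sub_const (∫ x, f₀ x * f₀ x ∂μ)
  have e : ∀ k, (∫ x, (f k x - f₀ x) ^ 2 ∂μ) + 2 * (∫ x, f k x * f₀ x ∂μ) -
      ∫ x, f₀ x * f₀ x ∂μ = ∫ x, f k x ^ 2 ∂μ := by
    intro k
    have i1 : Integrable (fun x => (f k x - f₀ x) ^ 2) μ := ((hf k).sub hf₀).integrable_sq
    have i2 := (integrable_mul_of_memLp (hf k) hf₀).const_mul 2
    have i3 := integrable_mul_of_memLp hf₀ hf₀
    have i4 : Integrable (fun x => (f k x - f₀ x) ^ 2 + 2 * (f k x * f₀ x)) μ := i1.add i2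
    rw [← integral_const_mul, ← integral_add i1 i2, ← integral_sub i4 i3]
    exact integral_congr_ae (Eventually.of_forall fun x => by simp only; ring)
  simp_rw [e] at h1
  convert h1 using 2
  simp_rw [sq]
  ring

/-- Convergence of second order jets: weak convergence of all entries in `L²(ℝⁿ)`, with uniform
bounds, for the jets of `u k + 1` towards the jet of `u₀ + 1`. -/
structure JetTendsto (Ω : Set (Space n)) (u : ℕ → Space n → ℝ) (g : ℕ → Fin n → Space n → ℝ)
    (h : ℕ → Fin n → Fin n → Space n → ℝ) (u₀ : Space n → ℝ) (g₀ : Fin n → Space n → ℝ)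
    (h₀ : Fin n → Fin n → Space n → ℝ) (K : ℝ) : Prop where
  jet : ∀ k, IsSupportedJet Ω (fun x => u k x + 1) (g k) (h k)
  jet_limit : IsSupportedJet Ω (fun x => u₀ x + 1) g₀ h₀
  bound : ∀ k, ∫ x, (u k x + 1) ^ 2 ≤ K
  bound_fst : ∀ k i, ∫ x, g k i x ^ 2 ≤ K
  bound_snd : ∀ k i j, ∫ x, h k i j x ^ 2 ≤ K
  weak : WeakTendsto volume (fun k x => u k x + 1) (fun x => u₀ x + 1)
  weak_fst : ∀ i, WeakTendsto volume (fun k => g k i) (g₀ i)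
  weak_snd : ∀ i j, WeakTendsto volume (fun k => h k i j) (h₀ i j)

lemma IsSupportedJet.integral_lap_sq_le_of_bound {f : Space n → ℝ} {g : Fin n → Space n → ℝ}
    {h : Fin n → Fin n → Space n → ℝ} (H : IsSupportedJet Ω f g h) {K : ℝ}
    (hK : ∀ i, ∫ x, h i i x ^ 2 ≤ K) : ∫ x, (∑ i, h i i x) ^ 2 ≤ n * (n * K) := by
  have hi : Integrable fun x => ∑ i, h i i x ^ 2 :=
    integrable_finsetSum _ fun i _ => (H.memLp_snd i i).integrable_sq
  calc ∫ x, (∑ i, h i i x) ^ 2 ≤ ∫ x, n * ∑ i, h i i x ^ 2 := by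
        refine integral_mono H.memLp_lap.integrable_sq (hi.const_mul _) fun x => ?_
        simpa using sq_sum_le_card_mul_sum_sq (s := Finset.univ) (f := fun i => h i i x)
    _ = n * ∑ i, ∫ x, h i i x ^ 2 := by
        rw [integral_const_mul, integral_finsetSum _ fun i _ => (H.memLp_snd i i).integrable_sq]
    _ ≤ n * (n * K) := by
        refine mul_le_mul_of_nonneg_left ?_ (Nat.cast_nonneg n)
        calc ∑ i, ∫ x, h i i x ^ 2 ≤ ∑ _i : Fin n, K := Finset.sum_le_sum fun i _ => hK i
          _ = n * K := by simp

namespace JetTendsto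

variable {u : ℕ → Space n → ℝ} {g : ℕ → Fin n → Space n → ℝ}
  {h : ℕ → Fin n → Fin n → Space n → ℝ} {u₀ : Space n → ℝ} {g₀ : Fin n → Space n → ℝ}
  {h₀ : Fin n → Fin n → Space n → ℝ} {K : ℝ}

lemma bound_sub (T : JetTendsto Ω u g h u₀ g₀ h₀ K) (k : ℕ) :
    ∫ x, ((u k x + 1) - (u₀ x + 1)) ^ 2 ≤ 4 * K :=
  integral_sub_sq_le (T.jet k).memLp_zero T.jet_limit.memLp_zero (T.bound k)
    (T.weak.integral_sq_le (fun k => (T.jet k).memLp_zero) T.jet_limit.memLp_zero T.bound)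

lemma bound_fst_sub (T : JetTendsto Ω u g h u₀ g₀ h₀ K) (k : ℕ) (i : Fin n) :
    ∫ x, (g k i x - g₀ i x) ^ 2 ≤ 4 * K :=
  integral_sub_sq_le ((T.jet k).memLp_fst i) (T.jet_limit.memLp_fst i) (T.bound_fst k i)
    ((T.weak_fst i).integral_sq_le (fun k => (T.jet k).memLp_fst i) (T.jet_limit.memLp_fst i)
      fun k => T.bound_fst k i)

lemma bound_snd_sub (T : JetTendsto Ω u g h u₀ g₀ h₀ K) (k : ℕ) (i j : Fin n) :
    ∫ x, (h k i j x - h₀ i j x) ^ 2 ≤ 4 * K :=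
  integral_sub_sq_le ((T.jet k).memLp_snd i j) (T.jet_limit.memLp_snd i j) (T.bound_snd k i j)
    ((T.weak_snd i j).integral_sq_le (fun k => (T.jet k).memLp_snd i j)
      (T.jet_limit.memLp_snd i j) fun k => T.bound_snd k i j)

/-- Strong convergence of the functions, by Rellich's theorem. -/
lemma tendsto_strong (T : JetTendsto Ω u g h u₀ g₀ h₀ K) (hb : Bornology.IsBounded Ω) :
    Tendsto (fun k => ∫ x, ((u k x + 1) - (u₀ x + 1)) ^ 2) atTop (𝓝 0) :=
  have D := fun k => (T.jet k).sub T.jet_limit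
  tendsto_integral_sq_of_weakTendsto_zero hb (fun k => (D k).memLp_zero) (fun k => (D k).fst)
    (fun k => (D k).vanishes) (fun k => (D k).vanishes_fst) T.bound_sub T.bound_fst_sub
    (T.weak.sub_limit (fun k => (T.jet k).memLp_zero) T.jet_limit.memLp_zero)

/-- Strong convergence of the gradients, by Rellich's theorem for the second derivatives. -/
lemma tendsto_strong_fst (T : JetTendsto Ω u g h u₀ g₀ h₀ K) (hb : Bornology.IsBounded Ω)
    (i : Fin n) : Tendsto (fun k => ∫ x, (g k i x - g₀ i x) ^ 2) atTop (𝓝 0) :=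
  have D := fun k => (T.jet k).sub T.jet_limit
  tendsto_integral_sq_of_weakTendsto_zero hb (fun k => (D k).memLp_fst i) (fun k => (D k).snd i)
    (fun k => (D k).vanishes_fst i) (fun k => (D k).vanishes_snd i)
    (fun k => T.bound_fst_sub k i) (fun k => T.bound_snd_sub k i)
    ((T.weak_fst i).sub_limit (fun k => (T.jet k).memLp_fst i) (T.jet_limit.memLp_fst i))

/-- The compact embedding `H² ⊂ L^∞`: the functions converge uniformly up to null sets. -/
lemma eventually_ae_abs_sub_le (T : JetTendsto Ω u g h u₀ g₀ h₀ K) (hn : n ≤ 3)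
    (hb : Bornology.IsBounded Ω) {η : ℝ} (hη : 0 < η) :
    ∀ᶠ k in atTop, ∀ᵐ x, |u k x - u₀ x| ≤ η := by
  have hK : 0 ≤ K := (integral_nonneg fun x => sq_nonneg _).trans (T.bound 0)
  -- `δ` makes the contribution of the Laplacians at most `η² / 2`
  set δ : ℝ := η ^ 2 / (2 * (n * (n * (4 * K)) + 1)) with hδ
  have hδ0 : 0 < δ := by positivity
  obtain ⟨C, hC0, hC⟩ := exists_sq_le_of_isSupportedJet (n := n) hn hδ0
  have hev : ∀ᶠ k in atTop, C * ∫ x, ((u k x + 1) - (u₀ x + 1)) ^ 2 < η ^ 2 / 2 := by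
    have := (T.tendsto_strong hb).const_mul C
    rw [mul_zero] at this
    exact this.eventually (gt_mem_nhds (by positivity))
  filter_upwards [hev] with k hk
  have D := (T.jet k).sub T.jet_limit
  filter_upwards [hC Ω _ _ _ hb D] with x hx
  have h1 := D.integral_lap_sq_le_of_bound (fun i => T.bound_snd_sub k i i)
  have h2 : δ * (n * (n * (4 * K))) ≤ η ^ 2 / 2 := by
    rw [hδ, div_mul_eq_mul_div, div_le_div_iff₀ (by positivity) two_pos]
    nlinarith [sq_nonneg η]
  have h3 := mul_le_mul_of_nonneg_left h1 hδ0.le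
  refine abs_le_of_sq_le_sq ?_ hη.le
  have e : u k x - u₀ x = (u k x + 1) - (u₀ x + 1) := by ring
  rw [e]
  linarith

lemma ae_tendsto (T : JetTendsto Ω u g h u₀ g₀ h₀ K) (hn : n ≤ 3) (hb : Bornology.IsBounded Ω) :
    ∀ᵐ x, Tendsto (fun k => u k x) atTop (𝓝 (u₀ x)) := by
  have h1 : ∀ j : ℕ, ∃ N, ∀ k ≥ N, ∀ᵐ x, |u k x - u₀ x| ≤ 1 / (j + 1 : ℝ) := fun j =>
    eventually_atTop.1 (T.eventually_ae_abs_sub_le hn hb (by positivity))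
  choose N hN using h1
  have h2 : ∀ᵐ x, ∀ j k, k ≥ N j → |u k x - u₀ x| ≤ 1 / (j + 1 : ℝ) := by
    rw [ae_all_iff]; intro j
    rw [ae_all_iff]; intro k
    by_cases hk : k ≥ N j
    · filter_upwards [hN j k hk] with x hx _ using hx
    · exact Eventually.of_forall fun x h => absurd h hk
  filter_upwards [h2] with x hx
  rw [Metric.tendsto_atTop]
  intro η hη
  obtain ⟨j, hj⟩ := exists_nat_one_div_lt hη
  exact ⟨N j, fun k hk => (hx j k hk).trans_lt hj⟩

lemma exists_ae_abs_le (T : JetTendsto Ω u g h u₀ g₀ h₀ K) (hn : n ≤ 3)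
    (hb : Bornology.IsBounded Ω) :
    ∃ B : ℝ, ∀ k, ∀ᵐ x ∂volume.restrict Ω, |u k x| ≤ B := by
  obtain ⟨C, hC0, hC⟩ := exists_sq_le_of_isSupportedJet (n := n) hn one_pos
  refine ⟨√(C * K + 1 * (n * (n * K))) + 1, fun k => IsSupportedJet.ae_restrict_abs_le ?_⟩
  filter_upwards [hC Ω _ _ _ hb (T.jet k)] with x hx
  refine Real.abs_le_sqrt (hx.trans ?_)
  have h1 := (T.jet k).integral_lap_sq_le_of_bound (fun i => T.bound_snd k i i)
  have h2 := mul_le_mul_of_nonneg_left (T.bound k) hC0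
  linarith

/-- Nonlinear expressions of the phase fields pass to the limit, by dominated convergence. -/
lemma tendsto_integral_comp_mul (T : JetTendsto Ω u g h u₀ g₀ h₀ K) (hn : n ≤ 3)
    (hb : Bornology.IsBounded Ω) {φ : ℝ → ℝ} (hφ : Continuous φ) {ψ : Space n → ℝ}
    (hψ : Integrable ψ (volume.restrict Ω)) :
    Tendsto (fun k => ∫ x in Ω, φ (u k x) * ψ x) atTop (𝓝 (∫ x in Ω, φ (u₀ x) * ψ x)) := by
  obtain ⟨B, hB⟩ := T.exists_ae_abs_le hn hb
  obtain ⟨A, hA⟩ := (isCompact_Icc (a := -B) (b := B)).exists_bound_of_continuousOn hφ.continuousOn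
  refine tendsto_integral_of_dominated_convergence (fun x => A * |ψ x|) (fun k => ?_)
    (hψ.abs.const_mul A) (fun k => ?_) ?_
  · exact (hφ.comp_aestronglyMeasurable ((T.jet k).isJet_sub_one hb).memLp.1).mul hψ.1
  · filter_upwards [hB k] with x hx
    rw [norm_mul, Real.norm_eq_abs (ψ x)]
    exact mul_le_mul_of_nonneg_right (hA _ (abs_le.1 hx)) (abs_nonneg _)
  · filter_upwards [ae_restrict_of_ae (T.ae_tendsto hn hb)] with x hx
    exact ((hφ.tendsto _).comp hx).mul_const _

/-- The diffuse area converges, since the gradients converge strongly. -/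
lemma tendsto_diffuseArea (T : JetTendsto Ω u g h u₀ g₀ h₀ K) (hn : n ≤ 3) (hΩ : IsOpen Ω)
    (hb : Bornology.IsBounded Ω) (ε : ℝ) :
    Tendsto (fun k => diffuseArea Ω ε (u k)) atTop (𝓝 (diffuseArea Ω ε u₀)) := by
  have hfin : IsFiniteMeasure (volume.restrict Ω) := ⟨by simpa using hb.measure_lt_top⟩
  have e : ∀ {v : Space n → ℝ} {g : Fin n → Space n → ℝ} {h : Fin n → Fin n → Space n → ℝ},
      IsSupportedJet Ω (fun x => v x + 1) g h → diffuseArea Ω ε v =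
        1 / c₀ * (ε / 2 * (∑ i, ∫ x, g i x ^ 2) + 1 / ε * ∫ x in Ω, doubleWell (v x) * 1) := by
    intro v g h H
    have HJ := H.isJet_sub_one hb
    obtain ⟨B, -, hB⟩ := H.exists_ae_abs_le hn hb
    have hW := HJ.integrable_doubleWell hb (IsSupportedJet.ae_restrict_abs_le hB)
    have hg : ∀ i, Integrable (fun x => g i x ^ 2) (volume.restrict Ω) := fun i =>
      (HJ.fst i).memLp.integrable_sq
    rw [HJ.diffuseArea_eq hΩ, integral_add
      ((integrable_finsetSum _ fun i _ => hg i).const_mul _) (hW.const_mul _),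
      integral_const_mul, integral_const_mul, integral_finsetSum _ fun i _ => hg i]
    simp_rw [fun i => (H.vanishes_fst i).setIntegral_sq_eq, mul_one]
  simp_rw [e T.jet_limit, fun k => e (T.jet k)]
  refine (((tendsto_finsetSum _ fun i _ => ?_).const_mul _).add
    ((T.tendsto_integral_comp_mul hn hb continuous_doubleWell
      (integrable_const 1)).const_mul _)).const_mul _
  exact (T.weak_fst i).tendsto_integral_sq (fun k => (T.jet k).memLp_fst i)
    (T.jet_limit.memLp_fst i) (T.tendsto_strong_fst hb i)

/-- The mean curvature terms `ε Δu - W'(u) / ε` converge weakly in `L²(Ω)`. -/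
lemma weakTendsto_curvature (T : JetTendsto Ω u g h u₀ g₀ h₀ K) (hn : n ≤ 3) (hΩ : IsOpen Ω)
    (hb : Bornology.IsBounded Ω) (ε : ℝ) :
    WeakTendsto (volume.restrict Ω)
      (fun k x => ε * (∑ i, h k i i x) - 1 / ε * (u k x ^ 3 - u k x))
      (fun x => ε * (∑ i, h₀ i i x) - 1 / ε * (u₀ x ^ 3 - u₀ x)) := by
  have hfin : IsFiniteMeasure (volume.restrict Ω) := ⟨by simpa using hb.measure_lt_top⟩
  intro φ hφ
  have e : ∀ {v : Space n → ℝ} {g : Fin n → Space n → ℝ} {h : Fin n → Fin n → Space n → ℝ},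
      IsSupportedJet Ω (fun x => v x + 1) g h →
      ∫ x in Ω, (ε * (∑ i, h i i x) - 1 / ε * (v x ^ 3 - v x)) * φ x =
        ε * (∑ i, ∫ x in Ω, h i i x * φ x) - 1 / ε * ∫ x in Ω, (v x ^ 3 - v x) * φ x := by
    intro v g h H
    have HJ := H.isJet_sub_one hb
    obtain ⟨B, -, hB⟩ := H.exists_ae_abs_le hn hb
    have hW : MemLp (fun x => v x ^ 3 - v x) 2 (volume.restrict Ω) :=
      (memLp_top_of_continuous_comp HJ.memLp.1 (IsSupportedJet.ae_restrict_abs_le hB)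
        (φ := fun r => r ^ 3 - r) (by fun_prop)).mono_exponent le_top
    have i1 : ∀ i, Integrable (fun x => h i i x * φ x) (volume.restrict Ω) := fun i =>
      integrable_mul_of_memLp (HJ.snd i i).memLp hφ
    have i2 := integrable_mul_of_memLp hW hφ
    rw [← integral_finsetSum _ fun i _ => i1 i, ← integral_const_mul, ← integral_const_mul,
      ← integral_sub ((integrable_finsetSum _ fun i _ => i1 i).const_mul _) (i2.const_mul _)]
    refine integral_congr_ae (Eventually.of_forall fun x => ?_)
    simp only [← Finset.sum_mul]
    ring
  simp_rw [e T.jet_limit, fun k => e (T.jet k)]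
  refine ((tendsto_finsetSum _ fun i _ => ?_).const_mul _).sub
    ((T.tendsto_integral_comp_mul hn hb (φ := fun r => r ^ 3 - r) (by fun_prop)
      (hφ.integrable (by norm_num))).const_mul _)
  exact (T.weak_snd i i).restrict hΩ.measurableSet φ hφ

/-- Lower semicontinuity of the diffuse Willmore energy, with an explicit error sequence. -/
lemma exists_diffuseWillmore_le (T : JetTendsto Ω u g h u₀ g₀ h₀ K) (hn : n ≤ 3) (hΩ : IsOpen Ω)
    (hb : Bornology.IsBounded Ω) {ε : ℝ} (hε : 0 < ε) :
    ∃ c : ℕ → ℝ, Tendsto c atTop (𝓝 0) ∧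
      ∀ k, diffuseWillmore Ω ε u₀ + c k ≤ diffuseWillmore Ω ε (u k) := by
  have hfin : IsFiniteMeasure (volume.restrict Ω) := ⟨by simpa using hb.measure_lt_top⟩
  have hm : ∀ {v : Space n → ℝ} {g : Fin n → Space n → ℝ} {h : Fin n → Fin n → Space n → ℝ},
      IsSupportedJet Ω (fun x => v x + 1) g h →
      MemLp (fun x => ε * (∑ i, h i i x) - 1 / ε * (v x ^ 3 - v x)) 2 (volume.restrict Ω) := by
    intro v g h H
    obtain ⟨B, -, hB⟩ := H.exists_ae_abs_le hn hb
    have hW : MemLp (fun x => v x ^ 3 - v x) 2 (volume.restrict Ω) :=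
      (memLp_top_of_continuous_comp (H.isJet_sub_one hb).memLp.1
        (IsSupportedJet.ae_restrict_abs_le hB)
        (φ := fun r => r ^ 3 - r) (by fun_prop)).mono_exponent le_top
    exact ((H.memLp_lap.mono_measure Measure.restrict_le_self).const_mul ε).sub
      (hW.const_mul (1 / ε))
  obtain ⟨c, hc, hc'⟩ := (T.weakTendsto_curvature hn hΩ hb ε).exists_le_integral_mul_sq
    (fun k => hm (T.jet k)) (hm T.jet_limit) (a := fun _ => 1 / ε) (memLp_top_const _)
    fun _ => by positivity
  refine ⟨fun k => 1 / c₀ * c k, by simpa using hc.const_mul (1 / c₀), fun k => ?_⟩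
  rw [(T.jet_limit.isJet_sub_one hb).diffuseWillmore_eq hΩ,
    ((T.jet k).isJet_sub_one hb).diffuseWillmore_eq hΩ, ← mul_add]
  exact mul_le_mul_of_nonneg_left (hc' k) (one_div_nonneg.2 c₀_pos.le)

/-- Lower semicontinuity of the total energy. -/
lemma exists_le_totalEnergy (T : JetTendsto Ω u g h u₀ g₀ h₀ K) (hn : n ≤ 3) (hΩ : IsOpen Ω)
    (hb : Bornology.IsBounded Ω) {l L S σ ε : ℝ} {V : ℝ → ℝ} (hV : IsCutoff l L V) (hε : 0 < ε) :
    ∃ e : ℕ → ℝ, Tendsto e atTop (𝓝 (totalEnergy Ω L V S σ ε u₀)) ∧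
      ∀ k, e k ≤ totalEnergy Ω L V S σ ε (u k) := by
  have hfin : IsFiniteMeasure (volume.restrict Ω) := ⟨by simpa using hb.measure_lt_top⟩
  obtain ⟨c, hc, hc'⟩ := T.exists_diffuseWillmore_le hn hΩ hb hε
  have hA := T.tendsto_diffuseArea hn hΩ hb ε
  have hVt : Tendsto (fun k => ∫ x in Ω, 1 / ε * V (u k x)) atTop
      (𝓝 (∫ x in Ω, 1 / ε * V (u₀ x))) := by
    have := T.tendsto_integral_comp_mul hn hb hV.smooth.continuous (ψ := fun _ => 1 / ε)
      (integrable_const _)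
    simpa only [mul_comm] using this
  have hI : Tendsto (fun k => connInf Ω L V ε (u k)) atTop (𝓝 (connInf Ω L V ε u₀)) := by
    obtain ⟨κ, hκ0, hκ⟩ := exists_abs_connInf_sub_le hΩ hb hV hε
    rw [Metric.tendsto_atTop]
    intro η hη
    obtain ⟨N, hN⟩ := eventually_atTop.1
      (T.eventually_ae_abs_sub_le hn hb (η := η / (κ + 1)) (by positivity))
    refine ⟨N, fun k hk => ?_⟩
    have h1 := hκ (u k) u₀ ((T.jet k).isJet_sub_one hb).memLp
      (T.jet_limit.isJet_sub_one hb).memLp (η / (κ + 1)) (by positivity)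
      (ae_restrict_of_ae (hN k hk))
    rw [Real.dist_eq]
    refine h1.trans_lt ?_
    rw [mul_div_assoc', div_lt_iff₀ (by positivity)]
    nlinarith
  refine ⟨fun k => diffuseWillmore Ω ε u₀ + c k
    + 1 / ε ^ (1 - σ) * (diffuseArea Ω ε (u k) - S) ^ 2
    + 1 / ε ^ (1 / 2 - σ / 2) * (connInf Ω L V ε (u k) - ∫ x in Ω, 1 / ε * V (u k x)) ^ 2,
    ?_, fun k => ?_⟩
  · have h1 := (((hc.const_add (diffuseWillmore Ω ε u₀)).add
      (((hA.sub_const S).pow 2).const_mul (1 / ε ^ (1 - σ)))).add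
      (((hI.sub hVt).pow 2).const_mul (1 / ε ^ (1 / 2 - σ / 2))))
    rwa [add_zero] at h1
  · unfold totalEnergy
    linarith [hc' k]

end JetTendsto

lemma isSupportedJet_zero : IsSupportedJet Ω (fun _ => (0 : ℝ)) (fun _ _ => 0) (fun _ _ _ => 0) :=
  ⟨⟨MemLp.zero, fun _ => IsWeakPartial.const 0, fun _ _ => IsWeakPartial.const 0⟩,
    Eventually.of_forall fun _ _ => rfl, fun _ => Eventually.of_forall fun _ _ => rfl,
    fun _ _ => Eventually.of_forall fun _ _ => rfl⟩

/-- Weak compactness of sets of confined phase fields with bounded jets. -/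
lemma exists_jetTendsto_subseq (hΩ : IsOpen Ω) (hb : Bornology.IsBounded Ω)
    {u : ℕ → Space n → ℝ} {g : ℕ → Fin n → Space n → ℝ} {h : ℕ → Fin n → Fin n → Space n → ℝ}
    (H : ∀ k, IsSupportedJet Ω (fun x => u k x + 1) (g k) (h k)) {K : ℝ}
    (b₀ : ∀ k, ∫ x, (u k x + 1) ^ 2 ≤ K) (b₁ : ∀ k i, ∫ x, g k i x ^ 2 ≤ K)
    (b₂ : ∀ k i j, ∫ x, h k i j x ^ 2 ≤ K) :
    ∃ (u₀ : Space n → ℝ) (g₀ : Fin n → Space n → ℝ) (h₀ : Fin n → Fin n → Space n → ℝ)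
      (s : ℕ → ℕ), StrictMono s ∧ IsConfined Ω u₀ ∧
      JetTendsto Ω (fun k => u (s k)) (fun k => g (s k)) (fun k => h (s k)) u₀ g₀ h₀ K := by
  obtain ⟨F₀, s, hs, hF₀, hw⟩ := exists_weakTendsto_subseq (μ := (volume : Measure (Space n)))
    (F := fun k (o : Option (Fin n ⊕ Fin n × Fin n)) => o.elim (fun x => u k x + 1) fun q =>
      q.elim (g k) fun p => h k p.1 p.2) (C := K)
    (by
      rintro k (_ | i | ⟨i, j⟩)
      exacts [(H k).memLp_zero, (H k).memLp_fst i, (H k).memLp_snd i j])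
    (by
      rintro k (_ | i | ⟨i, j⟩)
      exacts [b₀ k, b₁ k i, b₂ k i j])
  set f₀ := F₀ none
  set g₀ : Fin n → Space n → ℝ := fun i => F₀ (some (Sum.inl i))
  set h₀ : Fin n → Fin n → Space n → ℝ := fun i j => F₀ (some (Sum.inr (i, j)))
  have w₀ : WeakTendsto volume (fun k x => u (s k) x + 1) f₀ := hw none
  have w₁ : ∀ i, WeakTendsto volume (fun k => g (s k) i) (g₀ i) := fun i => hw _
  have w₂ : ∀ i j, WeakTendsto volume (fun k => h (s k) i j) (h₀ i j) := fun i j => hw _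
  have hm₀ : ∀ o, MemLp (F₀ o) 2 (volume.restrict univ) := fun o => by
    rw [Measure.restrict_univ]; exact hF₀ o
  have hJ : IsSupportedJet Ω f₀ g₀ h₀ := by
    refine ⟨⟨hm₀ _, fun i => ?_, fun i j => ?_⟩, ?_, fun i => ?_, fun i j => ?_⟩
    · exact (w₀.restrict MeasurableSet.univ).isWeakPartial ((w₁ i).restrict MeasurableSet.univ)
        (hm₀ _) fun k => (H (s k)).fst i
    · exact ((w₁ i).restrict MeasurableSet.univ).isWeakPartial
        ((w₂ i j).restrict MeasurableSet.univ) (hm₀ _) fun k => (H (s k)).snd i j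
    · exact w₀.vanishesOff hΩ.measurableSet (hF₀ _) fun k => (H (s k)).vanishes
    · exact (w₁ i).vanishesOff hΩ.measurableSet (hF₀ _) fun k => (H (s k)).vanishes_fst i
    · exact (w₂ i j).vanishesOff hΩ.measurableSet (hF₀ _) fun k => (H (s k)).vanishes_snd i j
  obtain ⟨u₀, hu₀, hJ₀, hae⟩ := hJ.exists_isConfined hΩ hb
  refine ⟨u₀, g₀, h₀, s, hs, hu₀, fun k => H (s k), hJ₀, fun k => b₀ (s k), fun k => b₁ (s k),
    fun k => b₂ (s k), fun φ hφ => ?_, w₁, w₂⟩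
  have e : ∫ x, (u₀ x + 1) * φ x = ∫ x, f₀ x * φ x :=
    integral_congr_ae (by filter_upwards [hae] with x hx; rw [hx])
  rw [e]
  exact w₀ φ hφ

/-- Existence of a minimizer of the total energy among the confined phase fields. -/
theorem exists_minimizer_totalEnergy (hn : n ≤ 3) (hΩ : IsOpen Ω) (hb : Bornology.IsBounded Ω)
    (hfr : volume (frontier Ω) = 0) {l L S σ ε : ℝ} {V : ℝ → ℝ} (hV : IsCutoff l L V)
    (hε : 0 < ε) (hS : 0 < S) :
    ∃ u : Space n → ℝ, IsConfined Ω u ∧ ∀ v : Space n → ℝ, IsConfined Ω v →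
      totalEnergy Ω L V S σ ε u ≤ totalEnergy Ω L V S σ ε v := by
  set A : Set ℝ := totalEnergy Ω L V S σ ε '' {u | IsConfined Ω u} with hA
  -- the constant phase field `-1` is a competitor
  have hne : A.Nonempty := by
    obtain ⟨u, hu, -⟩ := (isSupportedJet_zero (Ω := Ω)).exists_isConfined hΩ hb
    exact ⟨_, u, hu, rfl⟩
  have h0 : ∀ a ∈ A, 0 ≤ a := by
    rintro _ ⟨u, -, rfl⟩
    exact totalEnergy_nonneg hε
  have hbd : BddBelow A := ⟨0, h0⟩
  have hm0 : 0 ≤ sInf A := Real.sInf_nonneg h0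
  have hseq : ∀ k : ℕ, ∃ u, IsConfined Ω u ∧
      totalEnergy Ω L V S σ ε u < sInf A + 1 / (k + 1 : ℝ) := by
    intro k
    obtain ⟨_, ⟨u, hu, rfl⟩, h2⟩ := exists_lt_of_csInf_lt hne
      (lt_add_of_pos_right (sInf A) (by positivity : 0 < 1 / (k + 1 : ℝ)))
    exact ⟨u, hu, h2⟩
  choose u hu huE using hseq
  choose g h H using fun k => (hu k).exists_isSupportedJet hfr hΩ
  obtain ⟨K, -, hK⟩ := exists_bound_of_totalEnergy_le (L := L) (S := S) (σ := σ) (V := V) hn hΩ hb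
    hε hS (E := sInf A + 1) (by linarith)
  have hb' := fun k => hK (u k) (g k) (h k) (H k) ((huE k).le.trans (by
    gcongr
    rw [div_le_one (by positivity)]
    linarith [(Nat.cast_nonneg k : (0 : ℝ) ≤ k)]))
  obtain ⟨u₀, g₀, h₀, s, hs, hu₀, T⟩ := exists_jetTendsto_subseq hΩ hb H (fun k => (hb' k).1)
    (fun k => (hb' k).2.1) (fun k => (hb' k).2.2)
  obtain ⟨e, he, he'⟩ := T.exists_le_totalEnergy (S := S) (σ := σ) hn hΩ hb hV hε
  have hlim : Tendsto (fun k => sInf A + 1 / ((s k : ℕ) + 1 : ℝ)) atTop (𝓝 (sInf A + 0)) :=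
    (tendsto_one_div_add_atTop_nhds_zero_nat.comp hs.tendsto_atTop).const_add _
  rw [add_zero] at hlim
  have hle : totalEnergy Ω L V S σ ε u₀ ≤ sInf A :=
    le_of_tendsto_of_tendsto' he hlim fun k => (he' k).trans (huE (s k)).le
  exact ⟨u₀, hu₀, fun v hv => hle.trans (csInf_le hbd ⟨v, hv, rfl⟩)⟩

end TotalEnergy

end PhaseField

theorem proposition3p1 (n : ℕ) (hn : n = 2 ∨ n = 3)
    (Ω : Set (PhaseField.Space n)) (hΩ_open : IsOpen Ω) (hΩ_bdd : Bornology.IsBounded Ω)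
    (hΩ_smooth : PhaseField.HasSmoothBoundary Ω)
    (l L : ℝ) (V : ℝ → ℝ) (hV : PhaseField.IsCutoff l L V)
    (ε : ℝ) (hε : 0 < ε) :
    (∀ u : PhaseField.Space n → ℝ, PhaseField.MemW22 Ω u →
      ∃ φ : PhaseField.Space n → ℝ, PhaseField.MemW12 Ω φ ∧
        PhaseField.connFunctional Ω L V ε u φ < ⊤ ∧
        ∀ ψ : PhaseField.Space n → ℝ, PhaseField.MemW12 Ω ψ →
          PhaseField.connFunctional Ω L V ε u φ ≤ PhaseField.connFunctional Ω L V ε u ψ) ∧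
    (∀ S σ : ℝ, 0 < S → 0 < σ → σ < 1 →
      ∃ u : PhaseField.Space n → ℝ, PhaseField.IsConfined Ω u ∧
        ∀ v : PhaseField.Space n → ℝ, PhaseField.IsConfined Ω v →
          PhaseField.totalEnergy Ω L V S σ ε u ≤ PhaseField.totalEnergy Ω L V S σ ε v) := by
  refine ⟨fun u hu => ?_, fun S σ hS _ _ => ?_⟩
  · exact PhaseField.exists_minimizer_connFunctional hΩ_open hΩ_bdd hV hε hu.1.1
  · exact PhaseField.exists_minimizer_totalEnergy (by omega) hΩ_open hΩ_bdd
      (hΩ_smooth.volume_frontier_eq_zero hΩ_open) hV hε hS
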